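/- Let $s>-\tfrac12$ and let $\kappa=1$ (defocusing case) or $\kappa=-1$ (focusing case). For a Schwartz function $u:\mathbb R\to\mathbb C$ and $\operatorname{Im}z>0$ let $T(z)$ be the transmission coefficient of the system $$\psi_1'=-iz\,\psi_1+u\,\psi_2,\qquad \psi_2'=iz\,\psi_2+\kappa\,\bar u\,\psi_1 ,$$ that is, the solution with $e^{izx}\psi(x)\to(1,0)$ as $x\to-\infty$ satisfies $e^{izx}\psi(x)\to(T(z)^{-1},0)$ as $x\to+\infty$. Put $G(\tau)=-\kappa\ln|T(i\tau/2)|$, with asymptotic expansion $G(\tau)\sim\sum_{j\ge0}(-1)^jH_{2j}\,\tau^{-2j-1}$ as $\tau\to\infty$, and let $$E_s(u)=\frac{2\sin(\pi s)}{\pi}\int_1^\infty(\tau^2-1)^s\Big(-G(\tau)+\sum_{j=0}^{N}(-1)^jH_{2j}\,\tau^{-2j-1}\Big)d\tau+\sum_{j=0}^{N}\binom sj H_{2j}$$ be the conserved energy, where $N\le s<N+1$ with an integer $N\ge0$ if $s\ge0$, and where both sums are empty if $-\frac12<s<0$. Let $\hat u(\xi)=(2\pi)^{-1/2}\int u(x)e^{-ix\xi}\,dx$.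 Then for every Schwartz function $u$ the function $\varepsilon\mapsto E_s(\varepsilon u)$ of a real variable $\varepsilon$ is analytic at $\varepsilon=0$, and the quartic part $E_{s,4}(u)$ of $E_s$, i.e. the coefficient of $\varepsilon^4$ in its Taylor expansion at $0$, is given by the absolutely convergent integral $$E_{s,4}(u)=\frac{\kappa}{4\pi}\int_{\xi_1+\xi_2=\eta_1+\eta_2}\frac{(1+\xi_1^2)^s+(1+\xi_2^2)^s-(1+\eta_1^2)^s-(1+\eta_2^2)^s}{(\xi_1-\eta_1)(\xi_1-\eta_2)}\;\overline{\hat u(\xi_1)\hat u(\xi_2)}\,\hat u(\eta_1)\hat u(\eta_2)\,d\xi_1\,d\eta_1\,d\eta_2 ,$$ where $\xi_2=\eta_1+\eta_2-\xi_1$. Moreover, this is the quartic I-method correction of the linear energy $\|u\|_{H^s}^2=\int(1+\xi^2)^s|\hat u(\xi)|^2\,d\xi$ for the equation $iu_t+u_{xx}-2\kappa|u|^2u=0$: the terms of degree four in the time derivative of $\|u\|_{H^s}^2+E_{s,4}(u)$ along the flow cancel. That is, for every Schwartz $u$, the derivative at $u$ of $\|\cdot\|_{H^s}^2$ in the direction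 $-2i\kappa|u|^2u$ exists and equals minus the derivative at $t=0$ of the quartic integral above (with its factor) evaluated along the linear flow $\hat u(\xi)\mapsto e^{-it\xi^2}\hat u(\xi)$, which also exists. -/

import Mathlib

open MeasureTheory Filter Topology
open scoped SchwartzMap ComplexConjugate

noncomputable section

namespace NLSEnergy

/-! Throughout, `κ = 1` is the defocusing case and `κ = -1` the focusing case. -/

/-- `(ψ₁, ψ₂)` is the left Jost solution at spectral parameter `z` (with `Im z > 0`) of
`ψ₁' = -i z ψ₁ + u ψ₂`, `ψ₂' = i z ψ₂ + κ ū ψ₁`, normalised by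
`ψ = (e^{-izx}, 0) + o(1) e^{(Im z) x}` as `x → -∞`. -/
structure IsLeftJost (κ : ℝ) (u : ℝ → ℂ) (z : ℂ) (ψ₁ ψ₂ : ℝ → ℂ) : Prop where
  ode₁ : ∀ x : ℝ, HasDerivAt ψ₁ (-Complex.I * z * ψ₁ x + u x * ψ₂ x) x
  ode₂ : ∀ x : ℝ, HasDerivAt ψ₂ (Complex.I * z * ψ₂ x + (κ : ℂ) * conj (u x) * ψ₁ x) x
  left₁ : Tendsto (fun x : ℝ => Complex.exp (Complex.I * z * x) * ψ₁ x) atBot (𝓝 1)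
  left₂ : Tendsto (fun x : ℝ => Complex.exp (Complex.I * z * x) * ψ₂ x) atBot (𝓝 0)

/-- `t` is the value at `z` of the inverse transmission coefficient: the left Jost solution
satisfies `ψ = (t e^{-izx}, 0) + o(1) e^{(Im z) x}` as `x → +∞`. -/
def IsInvTransmission (κ : ℝ) (u : ℝ → ℂ) (z t : ℂ) : Prop :=
  ∃ ψ₁ ψ₂ : ℝ → ℂ, IsLeftJost κ u z ψ₁ ψ₂ ∧
    Tendsto (fun x : ℝ => Complex.exp (Complex.I * z * x) * ψ₁ x) atTop (𝓝 t) ∧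
    Tendsto (fun x : ℝ => Complex.exp (Complex.I * z * x) * ψ₂ x) atTop (𝓝 0)

/-- The transmission coefficient `T(z)`, for `Im z > 0`. -/
def transmission (κ : ℝ) (u : ℝ → ℂ) (z : ℂ) : ℂ :=
  (Classical.epsilon (IsInvTransmission κ u z))⁻¹

/-- `G(τ) = ∓ Re ln T(iτ/2) = ∓ ln |T(iτ/2)|` (upper sign defocusing, lower sign focusing). -/
def logTransmission (κ : ℝ) (u : ℝ → ℂ) (τ : ℝ) : ℝ :=
  -κ * Real.log ‖transmission κ u (Complex.I * τ / 2)‖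

/-- The coefficients `H_{2n}` of the asymptotic expansion
`G(τ) ~ ∑ₙ (-1)ⁿ H_{2n} τ^{-2n-1}` as `τ → ∞`, determined successively. For
`G = logTransmission κ u` this is the (real part of the) expansion
`∓ ln T(z) ~ i ∑ⱼ H_j (2z)^{-j-1}` on the half-line `z = iτ/2`. -/
def evenCoeff (G : ℝ → ℝ) (n : ℕ) : ℝ :=
  limUnder atTop fun τ : ℝ =>
    (-1) ^ n * τ ^ (2 * n + 1) *
      (G τ - ∑ j : Fin n, (-1) ^ (j : ℕ) * evenCoeff G j / τ ^ (2 * (j : ℕ) + 1))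
termination_by n
decreasing_by exact j.isLt

/-- The conserved energy `E_s(u)`, `s > -1/2`:
`(2 sin(πs)/π) ∫₁^∞ (τ²-1)^s (-G(τ) + ∑_{j ≤ N} (-1)^j H_{2j} τ^{-2j-1}) dτ
  + ∑_{j ≤ N} binom(s,j) H_{2j}`,
where `N ≤ s < N + 1` if `s ≥ 0`, and where both sums are empty if `-1/2 < s < 0`. -/
def energy (s κ : ℝ) (u : 𝓢(ℝ, ℂ)) : ℝ :=
  2 * Real.sin (Real.pi * s) / Real.pi *
      (∫ τ in Set.Ioi (1 : ℝ), (τ ^ 2 - 1) ^ s *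
        (-logTransmission κ u τ + ∑ j ∈ Finset.range ⌊s + 1⌋₊,
          (-1) ^ j * evenCoeff (logTransmission κ u) j / τ ^ (2 * j + 1))) +
    ∑ j ∈ Finset.range ⌊s + 1⌋₊, Ring.choose s j * evenCoeff (logTransmission κ u) j

/-- The part of homogeneity `n` of a functional `F` at `u`: the coefficient of `εⁿ` in the
Taylor expansion of `ε ↦ F(εu)` at `ε = 0`. -/
def homogeneousPart (n : ℕ) (F : 𝓢(ℝ, ℂ) → ℝ) (u : 𝓢(ℝ, ℂ)) : ℝ :=
  iteratedDeriv n (fun ε : ℝ => F (ε • u)) 0 / n.factorial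

/-- The unitary Fourier transform `û(ξ) = (2π)^{-1/2} ∫ u(x) e^{-ixξ} dx`. -/
def fourierU (f : ℝ → ℂ) (ξ : ℝ) : ℂ :=
  ((Real.sqrt (2 * Real.pi) : ℝ) : ℂ)⁻¹ *
    ∫ x : ℝ, f x * Complex.exp (-(Complex.I * x * ξ))

/-- `[(1+ξ₁²)^s + (1+ξ₂²)^s - (1+η₁²)^s - (1+η₂²)^s] / ((ξ₁-η₁)(ξ₁-η₂))` with
`ξ₂ = η₁ + η₂ - ξ₁`. -/
def quarticSymbol (s ξ₁ η₁ η₂ : ℝ) : ℝ :=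
  ((1 + ξ₁ ^ 2) ^ s + (1 + (η₁ + η₂ - ξ₁) ^ 2) ^ s - (1 + η₁ ^ 2) ^ s - (1 + η₂ ^ 2) ^ s) /
    ((ξ₁ - η₁) * (ξ₁ - η₂))

/-- The integrand of `quarticForm`, in the variables `p = (ξ₁, η₁, η₂)`, with
`ξ₂ = η₁ + η₂ - ξ₁`. -/
def quarticIntegrand (b : ℝ → ℝ → ℝ → ℝ) (g : ℝ → ℂ) (p : ℝ × ℝ × ℝ) : ℂ :=
  (b p.1 p.2.1 p.2.2 : ℂ) *
    (conj (g p.1 * g (p.2.1 + p.2.2 - p.1)) * (g p.2.1 * g p.2.2))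

/-- The quadrilinear multiplier form with symbol `b`,
`∫_{ξ₁+ξ₂=η₁+η₂} b(ξ,η) conj(g(ξ₁)g(ξ₂)) g(η₁)g(η₂) dξ₁ dη₁ dη₂`,
evaluated at a function `u` with Fourier transform `g`. -/
def quarticForm (b : ℝ → ℝ → ℝ → ℝ) (g : ℝ → ℂ) : ℂ :=
  ∫ p : ℝ × ℝ × ℝ, quarticIntegrand b g p

/-- The linear `H^s` energy `∫ (1+ξ²)^s |f̂(ξ)|² dξ`. -/
def sobolevEnergy (s : ℝ) (f : ℝ → ℂ) : ℝ :=
  ∫ ξ : ℝ, (1 + ξ ^ 2) ^ s * ‖fourierU f ξ‖ ^ 2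

/-- `b` is the symbol of the quartic `I`-method correction of the linear `H^s` energy for
`i u_t + u_xx - 2 κ |u|² u = 0`: in the time derivative of `‖u‖²_{H^s} + quarticForm b û` along
the flow, the quartic terms cancel. The linear flow preserves `‖u‖²_{H^s}`, so the quartic
terms are the derivative of `‖u‖²_{H^s}` in the direction `-2 i κ |u|² u` of the nonlinearity,
and the derivative of the quartic form along the linear flow, `û ↦ e^{-itξ²} û`. -/
def IsIMethodSymbol (s κ : ℝ) (b : ℝ → ℝ → ℝ → ℝ) : Prop :=
  ∀ u : 𝓢(ℝ, ℂ), ∃ d : ℝ,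
    HasDerivAt (fun t : ℝ => sobolevEnergy s fun x =>
      u x + (t : ℂ) * (-2 * Complex.I * (κ : ℂ) * ((‖u x‖ ^ 2 : ℝ) : ℂ) * u x)) d 0 ∧
    HasDerivAt (fun t : ℝ => quarticForm b fun ξ =>
      Complex.exp (-(Complex.I * t * (ξ : ℂ) ^ 2)) * fourierU u ξ) (-(d : ℂ)) 0

end NLSEnergy

end

noncomputable section

namespace NLSEnergy

/-! At z = iτ/2 one has 2iz = -τ, so φ = e^{izx}ψ solves φ₁' = Uφ₂, φ₂' = -τφ₂ + κŪφ₁, and w = φ₂/φ₁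
solves the Riccati equation w' = -τw + κŪ - Uw². Since (log φ₁)' = Uw, the inverse transmission
coefficient is exp ∫ Uw (`isInvTransmission_of_riccati`); a Gronwall argument makes it unique. For U
= εu, iterating R_τ = (τ + d/dx)⁻¹ yields w as a power series in odd powers of ε. Its coefficients
are dominated by Catalan numbers, so it converges for small ε uniformly in |τ| ≥ 1. Hence G is a
series in ε² with explicit coefficients in τ (`hasSum_logTransmission`).

To apply E_s term by term, each coefficient needs an expansion in odd powers of τ⁻¹. Powers come
from R_τ f = τ⁻¹(f - R_τ f'). Even powers drop out because the real part is odd in τ, which is the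
constancy of a Wronskian (`re_integral_riccatiSol_neg`). The k-th coefficient is O(τ^{-2k-1}), so
only finitely many terms of the series contribute to the subtracted sums, and the remainders are
summable (`hasSum_energyFunctional`, `exists_hasSum_energy`). This proves analyticity and identifies
the quartic part with E_s evaluated on the coefficient k = 1.

That coefficient is ∫ R_{-τ}u · u · (conj R_τ u)². R_τ is the Fourier multiplier 1/(τ + iξ), so
Parseval turns its conjugate into a quadrilinear form with kernel 1/((τ+iξ₁)(τ+iη₁)(τ+iη₂)), up to a
factor. Symmetrizing under ξ₁ ↔ ξ₂ and under ξ ↔ η, and using partial fractions, gives the second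
difference of f(ξ) = τ/(τ²+ξ²) divided by (ξ₁-η₁)(ξ₁-η₂) (`re_symmKernel`,
`logTransmissionCoeff_one`). The functional E_s acts linearly in τ and sends half of each such f to
half of (1+ξ²)^s, up to the common normalization, by a Beta integral
(`sin_mul_integral_geomRemainder`); Fubini then replaces f by (1+ξ²)^s.

For the I-method identity, the linear flow multiplies the quartic density by a phase whose frequency
is the second difference of ξ², which equals 2(ξ₁-η₁)(ξ₁-η₂). Differentiation therefore cancels the
denominator, and what remains is minus the derivative of the Sobolev energy along the nonlinearity.
-/

/-! ### The resolvent of d/dx on functions of quadratic decay -/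

/-- The bounded inverse of `τ + d/dx`, for `τ ≠ 0` of either sign. -/
def resolvent (τ : ℝ) (f : ℝ → ℂ) (x : ℝ) : ℂ :=
  (τ : ℂ)⁻¹ * ∫ r in Set.Ioi (0 : ℝ), (Real.exp (-r) : ℂ) * f (x - r / τ)

/-- Continuously differentiable functions which together with their derivative are
`O((1 + x²)⁻¹)`. -/
structure C1Decay (f : ℝ → ℂ) : Prop where
  differentiable : Differentiable ℝ f
  continuous_deriv : Continuous (deriv f)
  bound : ∃ C, ∀ x, ‖f x‖ ≤ C * (1 + x ^ 2)⁻¹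
  deriv_bound : ∃ C, ∀ x, ‖deriv f x‖ ≤ C * (1 + x ^ 2)⁻¹

lemma inv_one_add_sq_le_one (x : ℝ) : (1 + x ^ 2)⁻¹ ≤ 1 :=
  inv_le_one_of_one_le₀ (by nlinarith [sq_nonneg x])

lemma nonneg_of_decay {E : Type*} [NormedAddCommGroup E] {f : ℝ → E} {C : ℝ}
    (h : ∀ x, ‖f x‖ ≤ C * (1 + x ^ 2)⁻¹) : 0 ≤ C := by
  simpa using (norm_nonneg _).trans (h 0)

lemma norm_le_of_decay {E : Type*} [NormedAddCommGroup E] {f : ℝ → E} {C : ℝ}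
    (h : ∀ x, ‖f x‖ ≤ C * (1 + x ^ 2)⁻¹) (x : ℝ) : ‖f x‖ ≤ C :=
  (h x).trans (mul_le_of_le_one_right (nonneg_of_decay h) (inv_one_add_sq_le_one x))

lemma tendsto_inv_one_add_sq_atTop : Tendsto (fun x : ℝ => (1 + x ^ 2)⁻¹) atTop (𝓝 0) :=
  tendsto_inv_atTop_zero.comp (tendsto_atTop_add_const_left _ _ (tendsto_pow_atTop two_ne_zero))

lemma tendsto_inv_one_add_sq_atBot : Tendsto (fun x : ℝ => (1 + x ^ 2)⁻¹) atBot (𝓝 0) := by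
  have := tendsto_inv_one_add_sq_atTop.comp tendsto_neg_atBot_atTop
  simpa [Function.comp_def] using this

lemma tendsto_zero_of_decay {E : Type*} [NormedAddCommGroup E] {f : ℝ → E} {C : ℝ}
    (h : ∀ x, ‖f x‖ ≤ C * (1 + x ^ 2)⁻¹) :
    Tendsto f atTop (𝓝 0) ∧ Tendsto f atBot (𝓝 0) := by
  constructor
  · exact squeeze_zero_norm h (by simpa using tendsto_inv_one_add_sq_atTop.const_mul C)
  · exact squeeze_zero_norm h (by simpa using tendsto_inv_one_add_sq_atBot.const_mul C)

lemma integrable_of_decay {E : Type*} [NormedAddCommGroup E] {f : ℝ → E} {C : ℝ}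
    (hf : AEStronglyMeasurable f) (h : ∀ x, ‖f x‖ ≤ C * (1 + x ^ 2)⁻¹) : Integrable f :=
  (integrable_inv_one_add_sq.const_mul C).mono' hf (Eventually.of_forall h)

/-- Peetre's inequality: translation costs only a polynomial factor in the shift, which e^{-r}
absorbs in the resolvent. -/
lemma inv_one_add_sub_sq_le (x y : ℝ) :
    (1 + (x - y) ^ 2)⁻¹ ≤ 2 * (1 + y ^ 2) * (1 + x ^ 2)⁻¹ := by
  rw [inv_eq_one_div, ← div_eq_mul_inv, div_le_div_iff₀ (by positivity) (by positivity)]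
  nlinarith [sq_nonneg (x - 2 * y), sq_nonneg (y * (x - y)), sq_nonneg (x-y), sq_nonneg y]

lemma integrableOn_exp_neg_mul_pow (n : ℕ) :
    IntegrableOn (fun r : ℝ => Real.exp (-r) * r ^ n) (Set.Ioi 0) := by
  have := Real.GammaIntegral_convergent (s := n + 1) (by positivity)
  simpa [Real.rpow_natCast] using this

lemma integral_exp_neg_mul_pow (n : ℕ) :
    ∫ r in Set.Ioi (0 : ℝ), Real.exp (-r) * r ^ n = n.factorial := by
  have := Real.Gamma_eq_integral (s := n + 1) (by positivity)
  rw [Real.Gamma_nat_eq_factorial] at this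
  simpa [Real.rpow_natCast] using this.symm

lemma integrableOn_exp_neg : IntegrableOn (fun r : ℝ => Real.exp (-r)) (Set.Ioi 0) := by
  simpa using integrableOn_exp_neg_mul_pow 0

/-- The constant is 6 = 2 ∫₀^∞ e^{-r}(1 + r²) dr, from Peetre's inequality with shift r/τ and |r/τ|
≤ r. The gain |τ|⁻¹ per resolvent later fixes the order in τ of each term of the series. -/
lemma norm_resolvent_le {f : ℝ → ℂ} {C τ : ℝ} (hτ : 1 ≤ |τ|)
    (hf : ∀ x, ‖f x‖ ≤ C * (1 + x ^ 2)⁻¹) (x : ℝ) :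
    ‖resolvent τ f x‖ ≤ 6 * C / |τ| * (1 + x ^ 2)⁻¹ := by
  have hC := nonneg_of_decay hf
  have key : ‖∫ r in Set.Ioi (0 : ℝ), (Real.exp (-r) : ℂ) * f (x - r / τ)‖ ≤
      6 * C * (1 + x ^ 2)⁻¹ := by
    have hint : IntegrableOn (fun r : ℝ => (2 * C * (1 + x ^ 2)⁻¹) *
        (Real.exp (-r) * r ^ 0 + Real.exp (-r) * r ^ 2)) (Set.Ioi 0) :=
      ((integrableOn_exp_neg_mul_pow 0).add (integrableOn_exp_neg_mul_pow 2)).const_mul _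
    have := norm_integral_le_of_norm_le hint
      (f := fun r => (Real.exp (-r) : ℂ) * f (x - r / τ)) (Eventually.of_forall fun r => ?_)
    · refine this.trans (le_of_eq ?_)
      rw [integral_const_mul, integral_add (integrableOn_exp_neg_mul_pow 0)
        (integrableOn_exp_neg_mul_pow 2), integral_exp_neg_mul_pow, integral_exp_neg_mul_pow]
      norm_num [Nat.factorial]
      ring
    · rw [norm_mul, Complex.norm_real, Real.norm_eq_abs, Real.abs_exp]
      have h1 : (r / τ) ^ 2 ≤ r ^ 2 := by
        rw [div_pow]
        refine div_le_self (sq_nonneg _) ?_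
        rw [← sq_abs]
        exact one_le_pow₀ hτ
      calc Real.exp (-r) * ‖f (x - r / τ)‖
          ≤ Real.exp (-r) * (C * (2 * (1 + (r / τ) ^ 2) * (1 + x ^ 2)⁻¹)) := by
            gcongr
            exact (hf _).trans (by gcongr; exact inv_one_add_sub_sq_le _ _)
        _ ≤ Real.exp (-r) * (C * (2 * (1 + r ^ 2) * (1 + x ^ 2)⁻¹)) := by gcongr
        _ = _ := by ring
  rw [resolvent, norm_mul, norm_inv, Complex.norm_real, Real.norm_eq_abs]
  calc |τ|⁻¹ * _ ≤ |τ|⁻¹ * (6 * C * (1 + x ^ 2)⁻¹) := by gcongr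
    _ = _ := by ring

lemma integrableOn_exp_neg_mul {g : ℝ → ℂ} (hg : Continuous g) {C : ℝ} (hC : ∀ x, ‖g x‖ ≤ C) :
    IntegrableOn (fun r : ℝ => (Real.exp (-r) : ℂ) * g r) (Set.Ioi 0) := by
  refine Integrable.mono' (integrableOn_exp_neg.mul_const C) (by fun_prop)
    (Eventually.of_forall fun r => ?_)
  rw [norm_mul, Complex.norm_real, Real.norm_eq_abs, Real.abs_exp]
  exact mul_le_mul_of_nonneg_left (hC r) (Real.exp_pos _).le

namespace C1Decay

variable {f g : ℝ → ℂ}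

lemma continuous (hf : C1Decay f) : Continuous f := hf.differentiable.continuous

lemma hasDerivAt (hf : C1Decay f) (x : ℝ) : HasDerivAt f (deriv f x) x :=
  (hf.differentiable x).hasDerivAt

lemma of_hasDerivAt {f f' : ℝ → ℂ} {C C' : ℝ} (h : ∀ x, HasDerivAt f (f' x) x)
    (hc : Continuous f') (hb : ∀ x, ‖f x‖ ≤ C * (1 + x ^ 2)⁻¹)
    (hb' : ∀ x, ‖f' x‖ ≤ C' * (1 + x ^ 2)⁻¹) : C1Decay f := by
  have hd : deriv f = f' := funext fun x => (h x).deriv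
  exact ⟨fun x => (h x).differentiableAt, hd ▸ hc, ⟨C, hb⟩, ⟨C', hd ▸ hb'⟩⟩

lemma mul (hf : C1Decay f) (hg : C1Decay g) : C1Decay (fun x => f x * g x) := by
  obtain ⟨A, hA⟩ := hf.bound
  obtain ⟨A', hA'⟩ := hf.deriv_bound
  obtain ⟨B, hB⟩ := hg.bound
  obtain ⟨B', hB'⟩ := hg.deriv_bound
  refine of_hasDerivAt (C := A * B) (C' := A' * B + A * B')
    (fun x => (hf.hasDerivAt x).mul (hg.hasDerivAt x))
    ((hf.continuous_deriv.mul hg.continuous).add (hf.continuous.mul hg.continuous_deriv))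
    (fun x => ?_) (fun x => ?_)
  · rw [norm_mul]
    calc ‖f x‖ * ‖g x‖ ≤ (A * (1 + x ^ 2)⁻¹) * B :=
          mul_le_mul (hA x) (norm_le_of_decay hB x) (norm_nonneg _) ((norm_nonneg _).trans (hA x))
      _ = _ := by ring
  · refine (norm_add_le _ _).trans ?_
    rw [norm_mul, norm_mul]
    calc _ ≤ (A' * (1 + x ^ 2)⁻¹) * B + (A * (1 + x ^ 2)⁻¹) * B' :=
          add_le_add
            (mul_le_mul (hA' x) (norm_le_of_decay hB x) (norm_nonneg _)
              ((norm_nonneg _).trans (hA' x)))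
            (mul_le_mul (hA x) (norm_le_of_decay hB' x) (norm_nonneg _)
              ((norm_nonneg _).trans (hA x)))
      _ = _ := by ring

lemma add (hf : C1Decay f) (hg : C1Decay g) : C1Decay (fun x => f x + g x) := by
  obtain ⟨A, hA⟩ := hf.bound
  obtain ⟨A', hA'⟩ := hf.deriv_bound
  obtain ⟨B, hB⟩ := hg.bound
  obtain ⟨B', hB'⟩ := hg.deriv_bound
  refine of_hasDerivAt (C := A + B) (C' := A' + B')
    (fun x => (hf.hasDerivAt x).add (hg.hasDerivAt x))
    (hf.continuous_deriv.add hg.continuous_deriv) (fun x => ?_) (fun x => ?_)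
  · rw [add_mul]; exact (norm_add_le _ _).trans (add_le_add (hA x) (hB x))
  · rw [add_mul]; exact (norm_add_le _ _).trans (add_le_add (hA' x) (hB' x))

lemma const_mul (hf : C1Decay f) (c : ℂ) : C1Decay (fun x => c * f x) := by
  obtain ⟨A, hA⟩ := hf.bound
  obtain ⟨A', hA'⟩ := hf.deriv_bound
  refine of_hasDerivAt (C := ‖c‖ * A) (C' := ‖c‖ * A')
    (fun x => (hf.hasDerivAt x).const_mul c)
    (continuous_const.mul hf.continuous_deriv) (fun x => ?_) (fun x => ?_)
  · rw [norm_mul, mul_assoc]; exact mul_le_mul_of_nonneg_left (hA x) (norm_nonneg _)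
  · rw [norm_mul, mul_assoc]; exact mul_le_mul_of_nonneg_left (hA' x) (norm_nonneg _)

lemma neg (hf : C1Decay f) : C1Decay (fun x => -f x) := by
  simpa using hf.const_mul (-1)

lemma zero : C1Decay (fun _ => (0 : ℂ)) :=
  of_hasDerivAt (C := 0) (C' := 0) (fun x => hasDerivAt_const x 0) continuous_const
    (by simp) (by simp)

lemma sum {ι : Type*} (s : Finset ι) {F : ι → ℝ → ℂ} (h : ∀ i ∈ s, C1Decay (F i)) :
    C1Decay (fun x => ∑ i ∈ s, F i x) := by
  classical
  induction s using Finset.induction_on with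
  | empty => simpa using zero
  | insert a s ha ih =>
    simp only [Finset.sum_insert ha]
    exact (h a (by simp)).add (ih fun i hi => h i (by simp [hi]))

lemma star (hf : C1Decay f) : C1Decay (fun x => conj (f x)) := by
  obtain ⟨A, hA⟩ := hf.bound
  obtain ⟨A', hA'⟩ := hf.deriv_bound
  refine of_hasDerivAt (C := A) (C' := A') (f' := fun x => starRingEnd ℂ (deriv f x))
    (fun x => ?_) (Complex.continuous_conj.comp hf.continuous_deriv)
    (by simpa using hA) (by simpa using hA')
  exact (hf.hasDerivAt x).star

lemma integrable (hf : C1Decay f) : Integrable f := by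
  obtain ⟨C, hC⟩ := hf.bound
  exact integrable_of_decay hf.continuous.aestronglyMeasurable hC

lemma hasDerivAt_integral_aux (hf : C1Decay f) (τ x : ℝ) :
    HasDerivAt (fun x => ∫ r in Set.Ioi (0 : ℝ), (Real.exp (-r) : ℂ) * f (x - r / τ))
      (∫ r in Set.Ioi (0 : ℝ), (Real.exp (-r) : ℂ) * deriv f (x - r / τ)) x := by
  obtain ⟨A, hA⟩ := hf.bound
  obtain ⟨A', hA'⟩ := hf.deriv_bound
  have hfc := hf.continuous
  have hfc' := hf.continuous_deriv
  refine (hasDerivAt_integral_of_dominated_loc_of_deriv_le (s := Set.univ) (𝕜 := ℝ)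
    (F := fun x r => (Real.exp (-r) : ℂ) * f (x - r / τ))
    (F' := fun x r => (Real.exp (-r) : ℂ) * deriv f (x - r / τ))
    (bound := fun r => Real.exp (-r) * A') Filter.univ_mem (Eventually.of_forall fun y => ?_) ?_ ?_ ?_ (integrableOn_exp_neg.mul_const A') ?_).2
  · exact Continuous.aestronglyMeasurable (by fun_prop)
  · exact integrableOn_exp_neg_mul (by fun_prop) (fun r => norm_le_of_decay hA _)
  · exact Continuous.aestronglyMeasurable (by fun_prop)
  · refine Eventually.of_forall fun r y _ => ?_
    rw [norm_mul, Complex.norm_real, Real.norm_eq_abs, Real.abs_exp]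
    exact mul_le_mul_of_nonneg_left (norm_le_of_decay hA' _) (Real.exp_pos _).le
  · refine Eventually.of_forall fun r y _ => HasDerivAt.const_mul _ ?_
    exact (hf.hasDerivAt (y - r / τ)).comp_sub_const y (r / τ)

/-- Integration by parts: up to the factor τ⁻¹ on f', the two terms are the derivative in r of
e^{-r} f(x - r/τ). The identity serves twice: as the differential equation of the resolvent, and as
one step of its expansion in τ⁻¹. -/
lemma resolvent_deriv (hf : C1Decay f) {τ : ℝ} (hτ : τ ≠ 0) (x : ℝ) :
    resolvent τ (deriv f) x = f x - τ * resolvent τ f x := by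
  obtain ⟨A, hA⟩ := hf.bound
  obtain ⟨A', hA'⟩ := hf.deriv_bound
  have hfc := hf.continuous
  have hfc' := hf.continuous_deriv
  have hτ' : (τ : ℂ) ≠ 0 := by exact_mod_cast hτ
  have hd : ∀ r : ℝ, HasDerivAt (fun r : ℝ => (Real.exp (-r) : ℂ) * f (x - r / τ))
      (-((Real.exp (-r) : ℂ) * f (x - r / τ)) -
        (τ : ℂ)⁻¹ * ((Real.exp (-r) : ℂ) * deriv f (x - r / τ))) r := by
    intro r
    have h1 : HasDerivAt (fun r : ℝ => (Real.exp (-r) : ℂ)) (-(Real.exp (-r) : ℂ)) r := by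
      have := ((Real.hasDerivAt_exp (-r)).comp r (hasDerivAt_neg r)).ofReal_comp
      simpa [Function.comp_def] using this
    have h2 : HasDerivAt (fun r : ℝ => f (x - r / τ)) (-(τ : ℂ)⁻¹ * deriv f (x - r / τ)) r := by
      have h3 : HasDerivAt (fun r : ℝ => x - r / τ) (-τ⁻¹) r := by
        simpa [div_eq_mul_inv] using ((hasDerivAt_id r).mul_const τ⁻¹).const_sub x
      exact ((hf.hasDerivAt (x - r / τ)).scomp r h3).congr_deriv (by simp)
    refine (h1.mul h2).congr_deriv ?_
    ring
  have hi1 : IntegrableOn (fun r : ℝ => (Real.exp (-r) : ℂ) * f (x - r / τ)) (Set.Ioi 0) :=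
    integrableOn_exp_neg_mul (by fun_prop) (fun r => norm_le_of_decay hA _)
  have hi2 : IntegrableOn (fun r : ℝ => (Real.exp (-r) : ℂ) * deriv f (x - r / τ)) (Set.Ioi 0) :=
    integrableOn_exp_neg_mul (by fun_prop) (fun r => norm_le_of_decay hA' _)
  have hlim : Tendsto (fun r : ℝ => (Real.exp (-r) : ℂ) * f (x - r / τ)) atTop (𝓝 0) := by
    refine squeeze_zero_norm (a := fun r => Real.exp (-r) * A) (fun r => ?_) ?_
    · rw [norm_mul, Complex.norm_real, Real.norm_eq_abs, Real.abs_exp]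
      exact mul_le_mul_of_nonneg_left (norm_le_of_decay hA _) (Real.exp_pos _).le
    · simpa using (Real.tendsto_exp_neg_atTop_nhds_zero).mul_const A
  have := integral_Ioi_of_hasDerivAt_of_tendsto' (a := 0) (fun r _ => hd r)
    (hi1.neg.sub (hi2.const_mul _)) hlim
  rw [integral_sub (by exact hi1.neg) (hi2.const_mul _), integral_neg, integral_const_mul] at this
  simp only [neg_zero, Real.exp_zero, zero_div, sub_zero, Complex.ofReal_one, one_mul,
    zero_sub] at this
  rw [resolvent, resolvent, mul_inv_cancel_left₀ hτ']
  linear_combination -this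

lemma hasDerivAt_resolvent (hf : C1Decay f) {τ : ℝ} (hτ : τ ≠ 0) (x : ℝ) :
    HasDerivAt (resolvent τ f) (f x - τ * resolvent τ f x) x := by
  rw [← hf.resolvent_deriv hτ]
  exact (hf.hasDerivAt_integral_aux τ x).const_mul _

lemma resolvent (hf : C1Decay f) {τ : ℝ} (hτ : 1 ≤ |τ|) : C1Decay (resolvent τ f) := by
  have hτ0 : τ ≠ 0 := by rintro rfl; norm_num at hτ
  obtain ⟨A, hA⟩ := hf.bound
  obtain ⟨A', hA'⟩ := hf.deriv_bound
  have hc : Continuous (NLSEnergy.resolvent τ f) :=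
    continuous_iff_continuousAt.2 fun x => (hf.hasDerivAt_resolvent hτ0 x).continuousAt
  refine of_hasDerivAt (fun x => hf.hasDerivAt_resolvent hτ0 x)
    (hf.continuous.sub (continuous_const.mul hc)) (norm_resolvent_le hτ hA) (fun x => ?_)
    (C' := 6 * A' / |τ|)
  rw [← hf.resolvent_deriv hτ0]
  exact norm_resolvent_le hτ hA' x

end C1Decay

/-! ### The Riccati equation solved by a power series in ε -/

/-- The coefficients of `ε ^ (2 k + 1)` in the decaying solution `w` of the Riccati equation
`w' = -τ w + κ ε ū - ε u w²`. -/
def riccatiCoeff (κ : ℝ) (u : ℝ → ℂ) (τ : ℝ) : ℕ → ℝ → ℂ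
  | 0 => resolvent τ fun x => (κ : ℂ) * conj (u x)
  | k + 1 => resolvent τ fun x => -(u x * ∑ i : Fin (k + 1),
      riccatiCoeff κ u τ i x * riccatiCoeff κ u τ (k - i) x)
termination_by k => k
decreasing_by all_goals omega

/-- The sources of the recursion for `riccatiCoeff`. -/
def riccatiSource (κ : ℝ) (u : ℝ → ℂ) (τ : ℝ) : ℕ → ℝ → ℂ
  | 0 => fun x => (κ : ℂ) * conj (u x)
  | k + 1 => fun x => -(u x * ∑ i : Fin (k + 1),
      riccatiCoeff κ u τ i x * riccatiCoeff κ u τ (k - i) x)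

lemma riccatiCoeff_eq (κ : ℝ) (u : ℝ → ℂ) (τ : ℝ) (k : ℕ) :
    riccatiCoeff κ u τ k = resolvent τ (riccatiSource κ u τ k) := by
  cases k <;> rw [riccatiCoeff] <;> rfl

section Riccati

variable {κ : ℝ} {u : ℝ → ℂ} {τ : ℝ}

lemma riccatiSource_c1Decay_of (hu : C1Decay u) (k : ℕ)
    (h : ∀ i < k, C1Decay (riccatiCoeff κ u τ i)) : C1Decay (riccatiSource κ u τ k) := by
  cases k with
  | zero => exact hu.star.const_mul _
  | succ k =>
    exact (hu.mul (C1Decay.sum (Finset.univ : Finset (Fin (k + 1))) fun i _ => (h i i.isLt).mul (h (k - i) (Nat.sub_lt_succ k i)))).neg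

lemma riccatiCoeff_c1Decay (hu : C1Decay u) (hτ : 1 ≤ |τ|) (k : ℕ) :
    C1Decay (riccatiCoeff κ u τ k) := by
  induction k using Nat.strong_induction_on with
  | _ k ih =>
    rw [riccatiCoeff_eq]
    exact (riccatiSource_c1Decay_of hu k ih).resolvent hτ

lemma riccatiSource_c1Decay (hu : C1Decay u) (hτ : 1 ≤ |τ|) (k : ℕ) :
    C1Decay (riccatiSource κ u τ k) :=
  riccatiSource_c1Decay_of hu k fun i _ => riccatiCoeff_c1Decay hu hτ i

lemma hasDerivAt_riccatiCoeff (hu : C1Decay u) (hτ : 1 ≤ |τ|) (k : ℕ) (x : ℝ) :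
    HasDerivAt (riccatiCoeff κ u τ k)
      (riccatiSource κ u τ k x - τ * riccatiCoeff κ u τ k x) x := by
  have hτ0 : τ ≠ 0 := by rintro rfl; norm_num at hτ
  rw [riccatiCoeff_eq]
  exact (riccatiSource_c1Decay hu hτ k).hasDerivAt_resolvent hτ0 x

/-- The recursion is a convolution, as is that of the Catalan numbers, and each resolvent
contributes 6/|τ|. In the quadratic term the factor u alone supplies the spatial decay; both
coefficients enter through their suprema. -/
lemma norm_riccatiSource_le {B : ℝ} (hκ : |κ| = 1) (hB : ∀ x, ‖u x‖ ≤ B * (1 + x ^ 2)⁻¹)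
    (hτ : 1 ≤ |τ|) (k : ℕ) (x : ℝ) :
    ‖riccatiSource κ u τ k x‖ ≤ B * (6 * B / |τ|) ^ (2 * k) * catalan k * (1 + x ^ 2)⁻¹ := by
  have hB0 := nonneg_of_decay hB
  have hτ0 : 0 < |τ| := one_pos.trans_le hτ
  induction k using Nat.strong_induction_on generalizing x with
  | _ k ih =>
    cases k with
    | zero => simpa [riccatiSource, hκ] using hB x
    | succ k =>
      have hW : ∀ i < k + 1, ∀ x, ‖riccatiCoeff κ u τ i x‖ ≤
          (6 * B / |τ|) ^ (2 * i + 1) * catalan i * (1 + x ^ 2)⁻¹ := by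
        intro i hi x
        rw [riccatiCoeff_eq]
        refine (norm_resolvent_le hτ (ih i hi) x).trans (le_of_eq ?_)
        ring
      rw [riccatiSource, norm_neg, norm_mul, catalan_succ]
      push_cast
      calc ‖u x‖ * _ ≤ (B * (1 + x ^ 2)⁻¹) * ∑ i : Fin (k + 1),
            (6 * B / |τ|) ^ (2 * k + 2) * (catalan i * catalan (k - i)) := by
            refine mul_le_mul (hB x) ((norm_sum_le _ _).trans (Finset.sum_le_sum fun i _ => ?_))
              (norm_nonneg _) (by positivity)
            rw [norm_mul]
            calc _ ≤ ((6 * B / |τ|) ^ (2 * (i : ℕ) + 1) * catalan i) *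
                  ((6 * B / |τ|) ^ (2 * (k - i : ℕ) + 1) * catalan (k - i)) := by
                  gcongr
                  · exact norm_le_of_decay (hW i (by omega)) x
                  · exact norm_le_of_decay (hW (k - i) (by omega)) x
              _ = (6 * B / |τ|) ^ ((2 * (i : ℕ) + 1) + (2 * (k - i : ℕ) + 1)) *
                  (catalan i * catalan (k - i)) := by rw [pow_add]; ring
              _ = _ := by
                congr 2
                omega
        _ = _ := by
          rw [← Finset.mul_sum]
          ring

lemma norm_riccatiCoeff_le {B : ℝ} (hκ : |κ| = 1) (hB : ∀ x, ‖u x‖ ≤ B * (1 + x ^ 2)⁻¹)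
    (hτ : 1 ≤ |τ|) (k : ℕ) (x : ℝ) :
    ‖riccatiCoeff κ u τ k x‖ ≤
      (6 * B / |τ|) ^ (2 * k + 1) * catalan k * (1 + x ^ 2)⁻¹ := by
  rw [riccatiCoeff_eq]
  refine (norm_resolvent_le hτ (norm_riccatiSource_le hκ hB hτ k) x).trans (le_of_eq ?_)
  ring

lemma catalan_le_four_pow (k : ℕ) : (catalan k : ℝ) ≤ 4 ^ k := by
  have : catalan k ≤ 4 ^ k := by
    rw [catalan_eq_centralBinom_div]
    exact (Nat.div_le_self _ _).trans (Nat.centralBinom_le_four_pow k)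
  exact_mod_cast this

/-- With `catalan k` ≤ 4^k the ratio of the dominating geometric series is 4(aε)², and the smallness
condition makes it at most 1/2. -/
lemma pow_mul_catalan_le {a b ε : ℝ} (ha : 0 ≤ a) (hab : a ≤ b) (hε : 8 * (b * ε) ^ 2 ≤ 1)
    (k : ℕ) : |ε| ^ (2 * k) * (a ^ (2 * k) * catalan k) ≤ (1 / 2) ^ k := by
  have h1 : (a * ε) ^ 2 ≤ (b * ε) ^ 2 := by
    rw [mul_pow, mul_pow]; gcongr
  calc |ε| ^ (2 * k) * (a ^ (2 * k) * catalan k)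
      ≤ |ε| ^ (2 * k) * (a ^ (2 * k) * 4 ^ k) := by gcongr; exact catalan_le_four_pow k
    _ = (4 * (a * ε) ^ 2) ^ k := by
      rw [pow_mul, pow_mul, sq_abs, mul_pow a, mul_pow, mul_pow]; ring
    _ ≤ (1 / 2) ^ k := by gcongr; linarith

/-- The decaying solution of `w' = -τ w + κ ε ū - ε u w²`, for small `ε`. -/
def riccatiSol (κ : ℝ) (u : ℝ → ℂ) (τ ε : ℝ) (x : ℝ) : ℂ :=
  ∑' k : ℕ, (ε : ℂ) ^ (2 * k + 1) * riccatiCoeff κ u τ k x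

variable {B ε : ℝ}

lemma norm_term_le (hκ : |κ| = 1) (hB : ∀ x, ‖u x‖ ≤ B * (1 + x ^ 2)⁻¹) (hτ : 1 ≤ |τ|)
    (hε : 8 * (6 * B * ε) ^ 2 ≤ 1) (k : ℕ) (x : ℝ) :
    ‖(ε : ℂ) ^ (2 * k + 1) * riccatiCoeff κ u τ k x‖ ≤
      6 * B * |ε| * (1 / 2) ^ k * (1 + x ^ 2)⁻¹ := by
  have hB0 := nonneg_of_decay hB
  have hτ0 : 0 < |τ| := one_pos.trans_le hτ
  rw [norm_mul, norm_pow, Complex.norm_real, Real.norm_eq_abs]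
  have hle : 6 * B / |τ| ≤ 6 * B := div_le_self (by positivity) hτ
  calc _ ≤ |ε| ^ (2 * k + 1) * ((6 * B / |τ|) ^ (2 * k + 1) * catalan k * (1 + x ^ 2)⁻¹) := by
        gcongr; exact norm_riccatiCoeff_le hκ hB hτ k x
    _ = (6 * B / |τ|) * |ε| * (|ε| ^ (2 * k) * ((6 * B / |τ|) ^ (2 * k) * catalan k)) *
        (1 + x ^ 2)⁻¹ := by ring
    _ ≤ (6 * B) * |ε| * (1 / 2) ^ k * (1 + x ^ 2)⁻¹ := by
        gcongr
        exact pow_mul_catalan_le (by positivity) hle hε k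

lemma norm_source_term_le (hκ : |κ| = 1) (hB : ∀ x, ‖u x‖ ≤ B * (1 + x ^ 2)⁻¹) (hτ : 1 ≤ |τ|)
    (hε : 8 * (6 * B * ε) ^ 2 ≤ 1) (k : ℕ) (x : ℝ) :
    ‖(ε : ℂ) ^ (2 * k + 1) * riccatiSource κ u τ k x‖ ≤
      B * |ε| * (1 / 2) ^ k * (1 + x ^ 2)⁻¹ := by
  have hB0 := nonneg_of_decay hB
  have hτ0 : 0 < |τ| := one_pos.trans_le hτ
  rw [norm_mul, norm_pow, Complex.norm_real, Real.norm_eq_abs]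
  have hle : 6 * B / |τ| ≤ 6 * B := div_le_self (by positivity) hτ
  calc _ ≤ |ε| ^ (2 * k + 1) * (B * (6 * B / |τ|) ^ (2 * k) * catalan k * (1 + x ^ 2)⁻¹) := by
        gcongr; exact norm_riccatiSource_le hκ hB hτ k x
    _ = B * |ε| * (|ε| ^ (2 * k) * ((6 * B / |τ|) ^ (2 * k) * catalan k)) *
        (1 + x ^ 2)⁻¹ := by ring
    _ ≤ _ := by
        gcongr
        exact pow_mul_catalan_le (by positivity) hle hε k

lemma summable_norm_term (hκ : |κ| = 1) (hB : ∀ x, ‖u x‖ ≤ B * (1 + x ^ 2)⁻¹) (hτ : 1 ≤ |τ|)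
    (hε : 8 * (6 * B * ε) ^ 2 ≤ 1) (x : ℝ) :
    Summable fun k : ℕ => ‖(ε : ℂ) ^ (2 * k + 1) * riccatiCoeff κ u τ k x‖ :=
  Summable.of_nonneg_of_le (fun _ => norm_nonneg _) (fun k => norm_term_le hκ hB hτ hε k x)
    ((summable_geometric_two.mul_left _).mul_right _)

lemma summable_norm_source_term (hκ : |κ| = 1) (hB : ∀ x, ‖u x‖ ≤ B * (1 + x ^ 2)⁻¹)
    (hτ : 1 ≤ |τ|) (hε : 8 * (6 * B * ε) ^ 2 ≤ 1) (x : ℝ) :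
    Summable fun k : ℕ => ‖(ε : ℂ) ^ (2 * k + 1) * riccatiSource κ u τ k x‖ :=
  Summable.of_nonneg_of_le (fun _ => norm_nonneg _)
    (fun k => norm_source_term_le hκ hB hτ hε k x)
    ((summable_geometric_two.mul_left _).mul_right _)

lemma norm_riccatiSol_le (hκ : |κ| = 1) (hB : ∀ x, ‖u x‖ ≤ B * (1 + x ^ 2)⁻¹) (hτ : 1 ≤ |τ|)
    (hε : 8 * (6 * B * ε) ^ 2 ≤ 1) (x : ℝ) :
    ‖riccatiSol κ u τ ε x‖ ≤ 12 * B * |ε| * (1 + x ^ 2)⁻¹ := by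
  refine tsum_of_norm_bounded ?_ (fun k => norm_term_le hκ hB hτ hε k x)
  have := (hasSum_geometric_two.mul_left (6 * B * |ε|)).mul_right (1 + x ^ 2)⁻¹
  rwa [show 6 * B * |ε| * 2 * (1 + x ^ 2)⁻¹ = 12 * B * |ε| * (1 + x ^ 2)⁻¹ by ring] at this

lemma hasDerivAt_riccatiSol (hu : C1Decay u) (hκ : |κ| = 1)
    (hB : ∀ x, ‖u x‖ ≤ B * (1 + x ^ 2)⁻¹) (hτ : 1 ≤ |τ|)
    (hε : 8 * (6 * B * ε) ^ 2 ≤ 1) (x : ℝ) :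
    HasDerivAt (riccatiSol κ u τ ε)
      (-τ * riccatiSol κ u τ ε x + κ * ε * conj (u x) - ε * u x * riccatiSol κ u τ ε x ^ 2) x := by
  have hB0 := nonneg_of_decay hB
  have hd : HasDerivAt (riccatiSol κ u τ ε) (∑' k : ℕ, (ε : ℂ) ^ (2 * k + 1) *
      (riccatiSource κ u τ k x - τ * riccatiCoeff κ u τ k x)) x := by
    refine hasDerivAt_tsum (u := fun k : ℕ => (B * |ε| + |τ| * (6 * B * |ε|)) * (1 / 2) ^ k)
      (summable_geometric_two.mul_left _)
      (fun k y => (hasDerivAt_riccatiCoeff hu hτ k y).const_mul _) (fun k y => ?_)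
      (summable_norm_term hκ hB hτ hε x).of_norm x
    rw [mul_sub, add_mul]
    refine (norm_sub_le _ _).trans (add_le_add ?_ ?_)
    · exact norm_le_of_decay (norm_source_term_le hκ hB hτ hε k) y
    · rw [mul_left_comm, norm_mul, Complex.norm_real, Real.norm_eq_abs, mul_assoc]
      exact mul_le_mul_of_nonneg_left (norm_le_of_decay (norm_term_le hκ hB hτ hε k) y)
        (abs_nonneg _)
  refine hd.congr_deriv ?_
  have hs1 := (summable_norm_source_term hκ hB hτ hε x).of_norm
  have hs2 := summable_norm_term hκ hB hτ hε x
  -- The Cauchy product reproduces the convolution in the sources: exponents 2i+1 and 2(k-i)+1 add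
  -- up to 2k+2.
  have hsq : riccatiSol κ u τ ε x ^ 2 = ∑' k : ℕ, (ε : ℂ) ^ (2 * k + 2) *
      ∑ i : Fin (k + 1), riccatiCoeff κ u τ i x * riccatiCoeff κ u τ (k - i) x := by
    rw [sq, riccatiSol, tsum_mul_tsum_eq_tsum_sum_range_of_summable_norm hs2 hs2]
    refine tsum_congr fun k => ?_
    rw [Finset.sum_range, Finset.mul_sum]
    refine Finset.sum_congr rfl fun i _ => ?_
    have : 2 * k + 2 = (2 * (i : ℕ) + 1) + (2 * (k - i) + 1) := by omega
    rw [this, pow_add]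
    ring
  have h1 : ∑' k : ℕ, (ε : ℂ) ^ (2 * k + 1) * riccatiSource κ u τ k x =
      κ * ε * conj (u x) - ε * u x * riccatiSol κ u τ ε x ^ 2 := by
    -- The source of index 0 is the inhomogeneity κū; the shifted sum is -εuw².
    rw [hs1.tsum_eq_zero_add, hsq, ← tsum_mul_left, sub_eq_add_neg, ← tsum_neg]
    congr 1
    · simp only [riccatiSource]; ring
    · refine tsum_congr fun k => ?_
      simp only [riccatiSource]
      ring
  have h2 : ∑' k : ℕ, (ε : ℂ) ^ (2 * k + 1) * (riccatiSource κ u τ k x -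
      τ * riccatiCoeff κ u τ k x) = ∑' k : ℕ, (ε : ℂ) ^ (2 * k + 1) * riccatiSource κ u τ k x -
      τ * riccatiSol κ u τ ε x := by
    rw [riccatiSol, ← tsum_mul_left, ← hs1.tsum_sub (hs2.of_norm.mul_left _)]
    exact tsum_congr fun k => by ring
  rw [h2, h1]
  ring

lemma continuous_riccatiSol (hu : C1Decay u) (hκ : |κ| = 1)
    (hB : ∀ x, ‖u x‖ ≤ B * (1 + x ^ 2)⁻¹) (hτ : 1 ≤ |τ|)
    (hε : 8 * (6 * B * ε) ^ 2 ≤ 1) : Continuous (riccatiSol κ u τ ε) :=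
  continuous_iff_continuousAt.2 fun x =>
    (hasDerivAt_riccatiSol hu hκ hB hτ hε x).continuousAt

/-- The coefficients of `ε ^ (2 k + 2)` in the logarithm of the inverse transmission coefficient
of `ε u` at `iτ/2`. -/
def logCoeff (κ : ℝ) (u : ℝ → ℂ) (k : ℕ) (τ : ℝ) : ℂ := ∫ x, u x * riccatiCoeff κ u τ k x

lemma norm_logCoeff_le (hκ : |κ| = 1) (hB : ∀ x, ‖u x‖ ≤ B * (1 + x ^ 2)⁻¹)
    (hτ : 1 ≤ |τ|) (k : ℕ) :
    ‖logCoeff κ u k τ‖ ≤ Real.pi * B * (6 * B / |τ|) ^ (2 * k + 1) * catalan k := by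
  have hB0 := nonneg_of_decay hB
  have := norm_integral_le_of_norm_le (f := fun x => u x * riccatiCoeff κ u τ k x)
    (integrable_inv_one_add_sq.const_mul (B * ((6 * B / |τ|) ^ (2 * k + 1) * catalan k)))
    (Eventually.of_forall fun x => ?_)
  · refine this.trans (le_of_eq ?_)
    rw [integral_const_mul, integral_univ_inv_one_add_sq]
    ring
  · rw [norm_mul]
    calc _ ≤ B * ((6 * B / |τ|) ^ (2 * k + 1) * catalan k * (1 + x ^ 2)⁻¹) := by
          gcongr
          · exact norm_le_of_decay hB x
          · exact norm_riccatiCoeff_le hκ hB hτ k x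
      _ = _ := by ring

lemma hasSum_logCoeff (hu : C1Decay u) (hκ : |κ| = 1)
    (hB : ∀ x, ‖u x‖ ≤ B * (1 + x ^ 2)⁻¹) (hτ : 1 ≤ |τ|)
    (hε : 8 * (6 * B * ε) ^ 2 ≤ 1) :
    HasSum (fun k : ℕ => (ε : ℂ) ^ (2 * k + 2) * logCoeff κ u k τ)
      (∫ x, ε * u x * riccatiSol κ u τ ε x) := by
  have hB0 := nonneg_of_decay hB
  have hm : ∀ k, Continuous fun x =>
      (ε : ℂ) * u x * ((ε : ℂ) ^ (2 * k + 1) * riccatiCoeff κ u τ k x) := fun k =>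
    (continuous_const.mul hu.continuous).mul
      (continuous_const.mul (riccatiCoeff_c1Decay hu hτ k).continuous)
  have hbd : ∀ (k : ℕ) x, ‖(ε : ℂ) * u x * ((ε : ℂ) ^ (2 * k + 1) * riccatiCoeff κ u τ k x)‖ ≤
      (|ε| * B * (6 * B * |ε|)) * (1 / 2) ^ k * (1 + x ^ 2)⁻¹ := by
    intro k x
    rw [norm_mul, norm_mul, Complex.norm_real, Real.norm_eq_abs]
    calc _ ≤ |ε| * B * (6 * B * |ε| * (1 / 2) ^ k * (1 + x ^ 2)⁻¹) := by
          gcongr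
          · exact norm_le_of_decay hB x
          · exact norm_term_le hκ hB hτ hε k x
      _ = _ := by ring
  have hint : ∀ k, Integrable fun x =>
      (ε : ℂ) * u x * ((ε : ℂ) ^ (2 * k + 1) * riccatiCoeff κ u τ k x) := fun k =>
    integrable_of_decay (hm k).aestronglyMeasurable (hbd k)
  have key := hasSum_integral_of_summable_integral_norm hint ?_
  · have h1 : ∀ k : ℕ, (ε : ℂ) ^ (2 * k + 2) * logCoeff κ u k τ =
        ∫ x, (ε : ℂ) * u x * ((ε : ℂ) ^ (2 * k + 1) * riccatiCoeff κ u τ k x) := by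
      intro k
      rw [logCoeff, ← integral_const_mul]
      exact integral_congr_ae (Eventually.of_forall fun x => by ring)
    have h2 : ∫ x, ε * u x * riccatiSol κ u τ ε x =
        ∫ x, ∑' k : ℕ, (ε : ℂ) * u x * ((ε : ℂ) ^ (2 * k + 1) * riccatiCoeff κ u τ k x) :=
      integral_congr_ae (Eventually.of_forall fun x => by
        simp only [riccatiSol, tsum_mul_left])
    simpa only [h1, h2] using key
  · refine Summable.of_nonneg_of_le (fun k => integral_nonneg fun x => norm_nonneg _) (fun k => ?_)
      ((summable_geometric_two.mul_left (|ε| * B * (6 * B * |ε|))).mul_right Real.pi)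
    calc _ ≤ ∫ x, (|ε| * B * (6 * B * |ε|)) * (1 / 2) ^ k * (1 + x ^ 2)⁻¹ :=
          integral_mono (hint k).norm (integrable_inv_one_add_sq.const_mul _) (hbd k)
      _ = _ := by rw [integral_const_mul, integral_univ_inv_one_add_sq]

end Riccati

/-- Joint measurability in (τ, x) is what the recursion propagates; it gives measurability in τ of
the coefficients, which are later integrated against (τ² - 1)^s. -/
lemma stronglyMeasurable_resolvent {F : ℝ → ℝ → ℂ}
    (hF : StronglyMeasurable fun p : ℝ × ℝ => F p.1 p.2) :
    StronglyMeasurable fun p : ℝ × ℝ => resolvent p.1 (F p.1) p.2 := by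
  unfold resolvent
  have h1 : StronglyMeasurable fun q : (ℝ × ℝ) × ℝ =>
      (Real.exp (-q.2) : ℂ) * F q.1.1 (q.1.2 - q.2 / q.1.1) := by
    refine StronglyMeasurable.mul (Measurable.stronglyMeasurable (by fun_prop)) ?_
    exact hF.comp_measurable (g := fun q : (ℝ × ℝ) × ℝ => (q.1.1, q.1.2 - q.2 / q.1.1))
      (by fun_prop)
  exact (Measurable.stronglyMeasurable (by fun_prop)).mul h1.integral_prod_right'

lemma stronglyMeasurable_riccatiCoeff {κ : ℝ} {u : ℝ → ℂ} (hu : Continuous u) (k : ℕ) :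
    StronglyMeasurable fun p : ℝ × ℝ => riccatiCoeff κ u p.1 k p.2 := by
  induction k using Nat.strong_induction_on with
  | _ k ih =>
    simp_rw [riccatiCoeff_eq]
    refine stronglyMeasurable_resolvent (F := fun τ => riccatiSource κ u τ k) ?_
    cases k with
    | zero => exact Continuous.stronglyMeasurable (by unfold riccatiSource; fun_prop)
    | succ k =>
      simp only [riccatiSource]
      refine (StronglyMeasurable.mul (Continuous.stronglyMeasurable (by fun_prop)) ?_).neg
      exact Finset.stronglyMeasurable_fun_sum _ fun i _ =>
        (ih i (by omega)).mul (ih (k - i) (by omega))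

lemma stronglyMeasurable_logCoeff {κ : ℝ} {u : ℝ → ℂ} (hu : Continuous u) (k : ℕ) :
    StronglyMeasurable (logCoeff κ u k) := by
  unfold logCoeff
  exact StronglyMeasurable.integral_prod_right' (f := fun p : ℝ × ℝ =>
    u p.2 * riccatiCoeff κ u p.1 k p.2)
    ((Continuous.stronglyMeasurable (by fun_prop)).mul (stronglyMeasurable_riccatiCoeff hu k))

/-! ### Jost solutions and the transmission coefficient on the imaginary half-line -/

lemma exists_primitive {E : Type*} [NormedAddCommGroup E] [NormedSpace ℝ E] [CompleteSpace E]
    {f : ℝ → E} (hc : Continuous f) (hi : Integrable f) :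
    ∃ F : ℝ → E, (∀ x, HasDerivAt F (f x) x) ∧ Tendsto F atBot (𝓝 0) ∧
      Tendsto F atTop (𝓝 (∫ x, f x)) := by
  refine ⟨fun x => (∫ y in Set.Iic 0, f y) + ∫ y in (0 : ℝ)..x, f y, fun x => ?_, ?_, ?_⟩
  · exact (intervalIntegral.integral_hasDerivAt_right (hc.intervalIntegrable _ _)
      hc.aestronglyMeasurable.stronglyMeasurableAtFilter hc.continuousAt).const_add _
  · have h := (intervalIntegral_tendsto_integral_Iic 0 hi.integrableOn tendsto_id).neg.const_add
      (∫ y in Set.Iic 0, f y)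
    simp only [add_neg_cancel, id] at h
    simpa only [← intervalIntegral.integral_symm] using h
  · have h := (intervalIntegral_tendsto_integral_Ioi 0 hi.integrableOn tendsto_id).const_add
      (∫ y in Set.Iic 0, f y)
    rwa [intervalIntegral.integral_Iic_add_Ioi hi.integrableOn hi.integrableOn] at h

/-- Gronwall from -∞: (|d₁|² + |d₂|²) exp(-2∫_{-∞}^x |U|) is nonincreasing, since the term -τd₂ has
the good sign and the two couplings contribute at most 4|U||d₁||d₂|. It tends to 0 at -∞, hence
vanishes. -/
lemma eq_zero_of_zero_at_left {κ τ : ℝ} {U d₁ d₂ : ℝ → ℂ} (hκ : |κ| = 1) (hτ : 0 ≤ τ)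
    (hc : Continuous U) (hi : Integrable U)
    (h₁ : ∀ x, HasDerivAt d₁ (U x * d₂ x) x)
    (h₂ : ∀ x, HasDerivAt d₂ (-τ * d₂ x + κ * conj (U x) * d₁ x) x)
    (l₁ : Tendsto d₁ atBot (𝓝 0)) (l₂ : Tendsto d₂ atBot (𝓝 0)) (x : ℝ) : d₁ x = 0 := by
  obtain ⟨F, hF, hF0, -⟩ := exists_primitive hc.norm hi.norm
  set N : ℝ → ℝ := fun x => (‖d₁ x‖ ^ 2 + ‖d₂ x‖ ^ 2) * Real.exp (-2 * F x) with hN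
  have hd : ∀ x, HasDerivAt N
      ((2 * inner ℝ (d₁ x) (U x * d₂ x) +
        2 * inner ℝ (d₂ x) (-τ * d₂ x + κ * conj (U x) * d₁ x)) * Real.exp (-2 * F x) +
        (‖d₁ x‖ ^ 2 + ‖d₂ x‖ ^ 2) * (Real.exp (-2 * F x) * (-2 * ‖U x‖))) x := fun x =>
    ((h₁ x).norm_sq.add (h₂ x).norm_sq).mul ((hF x).const_mul (-2)).exp
  have hanti : Antitone N := by
    refine antitone_of_deriv_nonpos (fun x => (hd x).differentiableAt) fun x => ?_
    rw [(hd x).deriv]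
    have e1 : inner ℝ (d₁ x) (U x * d₂ x) ≤ ‖U x‖ * (‖d₁ x‖ * ‖d₂ x‖) := by
      refine (real_inner_le_norm _ _).trans (le_of_eq ?_)
      rw [norm_mul]; ring
    have e2 : inner ℝ (d₂ x) (-τ * d₂ x + κ * conj (U x) * d₁ x) ≤
        ‖U x‖ * (‖d₁ x‖ * ‖d₂ x‖) := by
      rw [inner_add_right]
      have e3 : inner ℝ (d₂ x) (-(τ : ℂ) * d₂ x) ≤ 0 := by
        have : -(τ : ℂ) * d₂ x = (-τ) • d₂ x := by simp
        rw [this, real_inner_smul_right, real_inner_self_eq_norm_sq]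
        nlinarith [sq_nonneg ‖d₂ x‖]
      have e4 : inner ℝ (d₂ x) (κ * conj (U x) * d₁ x) ≤ ‖U x‖ * (‖d₁ x‖ * ‖d₂ x‖) := by
        refine (real_inner_le_norm _ _).trans (le_of_eq ?_)
        rw [norm_mul, norm_mul, Complex.norm_real, Real.norm_eq_abs, hκ, RCLike.norm_conj]; ring
      linarith
    have e5 : ‖U x‖ * (2 * (‖d₁ x‖ * ‖d₂ x‖)) ≤ ‖U x‖ * (‖d₁ x‖ ^ 2 + ‖d₂ x‖ ^ 2) := by
      gcongr
      nlinarith [sq_nonneg (‖d₁ x‖ - ‖d₂ x‖)]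
    have e6 : (2 * inner ℝ (d₁ x) (U x * d₂ x) +
        2 * inner ℝ (d₂ x) (-τ * d₂ x + κ * conj (U x) * d₁ x)) +
        (‖d₁ x‖ ^ 2 + ‖d₂ x‖ ^ 2) * (-2 * ‖U x‖) ≤ 0 := by linarith
    have := mul_nonpos_of_nonpos_of_nonneg e6 (Real.exp_pos (-2 * F x)).le
    linarith
  have hlim : Tendsto N atBot (𝓝 0) := by
    have := ((l₁.norm.pow 2).add (l₂.norm.pow 2)).mul (hF0.const_mul (-2)).rexp
    simpa [hN] using this
  have hx : N x ≤ 0 := hanti.ge_of_tendsto hlim x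
  have h3 : ‖d₁ x‖ ^ 2 + ‖d₂ x‖ ^ 2 ≤ 0 := by
    by_contra h
    exact absurd hx (not_le.2 (mul_pos (not_le.1 h) (Real.exp_pos _)))
  have h4 : ‖d₁ x‖ ^ 2 = 0 := by nlinarith [sq_nonneg ‖d₁ x‖, sq_nonneg ‖d₂ x‖]
  simpa using h4

/-- Multiplying by e^{izx} removes the diagonal term of the first equation and turns that of the
second into 2iz = -τ. -/
lemma IsLeftJost.hasDerivAt_mul_exp {κ τ : ℝ} {U ψ₁ ψ₂ : ℝ → ℂ}
    (h : IsLeftJost κ U (Complex.I * τ / 2) ψ₁ ψ₂) (x : ℝ) :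
    HasDerivAt (fun x : ℝ => Complex.exp (Complex.I * (Complex.I * τ / 2) * x) * ψ₁ x)
      (U x * (Complex.exp (Complex.I * (Complex.I * τ / 2) * x) * ψ₂ x)) x ∧
    HasDerivAt (fun x : ℝ => Complex.exp (Complex.I * (Complex.I * τ / 2) * x) * ψ₂ x)
      (-τ * (Complex.exp (Complex.I * (Complex.I * τ / 2) * x) * ψ₂ x) +
        κ * conj (U x) * (Complex.exp (Complex.I * (Complex.I * τ / 2) * x) * ψ₁ x)) x := by
  have he : HasDerivAt (fun x : ℝ => Complex.exp (Complex.I * (Complex.I * τ / 2) * x))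
      (Complex.exp (Complex.I * (Complex.I * τ / 2) * x) * (Complex.I * (Complex.I * τ / 2))) x := by
    simpa using ((Complex.ofRealCLM.hasDerivAt (x := x)).const_mul
      (Complex.I * (Complex.I * τ / 2))).cexp
  constructor
  · exact (he.mul (h.ode₁ x)).congr_deriv (by ring)
  · refine (he.mul (h.ode₂ x)).congr_deriv ?_
    linear_combination (Complex.exp (Complex.I * (Complex.I * τ / 2) * x) * ψ₂ x) *
      (τ : ℂ) * Complex.I_mul_I

lemma IsInvTransmission.unique {κ τ : ℝ} {U : ℝ → ℂ} (hκ : |κ| = 1) (hτ : 0 ≤ τ)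
    (hc : Continuous U) (hi : Integrable U) {t t' : ℂ}
    (h : IsInvTransmission κ U (Complex.I * τ / 2) t)
    (h' : IsInvTransmission κ U (Complex.I * τ / 2) t') : t = t' := by
  obtain ⟨ψ₁, ψ₂, hψ, hr, -⟩ := h
  obtain ⟨χ₁, χ₂, hχ, hr', -⟩ := h'
  have key := eq_zero_of_zero_at_left hκ hτ hc hi
    (fun x => ((hψ.hasDerivAt_mul_exp x).1.sub (hχ.hasDerivAt_mul_exp x).1).congr_deriv
      (mul_sub _ _ _).symm)
    (fun x => ((hψ.hasDerivAt_mul_exp x).2.sub (hχ.hasDerivAt_mul_exp x).2).congr_deriv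
      (by simp only [Pi.sub_apply]; ring))
    (sub_self (1 : ℂ) ▸ hψ.left₁.sub hχ.left₁)
    (sub_self (0 : ℂ) ▸ hψ.left₂.sub hχ.left₂)
  refine tendsto_nhds_unique hr (hr'.congr fun x => ?_)
  exact (sub_eq_zero.1 (key x)).symm

/-- Reverses the passage to the Riccati equation: with F the primitive of Uw vanishing at -∞, the
pair e^{-izx}(e^F, w e^F) is the left Jost solution. Decay of w gives the boundary conditions of the
second component at both ends. -/
lemma isInvTransmission_of_riccati {κ τ C : ℝ} {U w : ℝ → ℂ}
    (hc : Continuous U) (hU : ∃ B, ∀ x, ‖U x‖ ≤ B)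
    (hw : ∀ x, HasDerivAt w (-τ * w x + κ * conj (U x) - U x * w x ^ 2) x)
    (hb : ∀ x, ‖w x‖ ≤ C * (1 + x ^ 2)⁻¹) :
    IsInvTransmission κ U (Complex.I * τ / 2) (Complex.exp (∫ x, U x * w x)) := by
  obtain ⟨B, hB⟩ := hU
  have hwc : Continuous w := continuous_iff_continuousAt.2 fun x => (hw x).continuousAt
  have hi : Integrable fun x => U x * w x := by
    refine integrable_of_decay (C := B * C) (by fun_prop) fun x => ?_
    rw [norm_mul, mul_assoc]
    exact mul_le_mul (hB x) (hb x) (norm_nonneg _) ((norm_nonneg _).trans (hB x))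
  obtain ⟨F, hF, hF0, hF1⟩ := exists_primitive (f := fun x => U x * w x) (by fun_prop) hi
  set a : ℂ := Complex.I * (Complex.I * τ / 2) with ha
  have he : ∀ x : ℝ, HasDerivAt (fun x : ℝ => Complex.exp (-(a * x)))
      (Complex.exp (-(a * x)) * -a) x := fun x => by
    simpa using ((Complex.ofRealCLM.hasDerivAt (x := x)).const_mul a).neg.cexp
  have hcancel : ∀ (x : ℝ) (y : ℂ), Complex.exp (a * x) * (Complex.exp (-(a * x)) * y) = y := by
    intro x y
    rw [← mul_assoc, ← Complex.exp_add, add_neg_cancel, Complex.exp_zero, one_mul]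
  obtain ⟨w1, w0⟩ := tendsto_zero_of_decay hb
  refine ⟨fun x => Complex.exp (-(a * x)) * Complex.exp (F x),
    fun x => Complex.exp (-(a * x)) * (w x * Complex.exp (F x)), ⟨fun x => ?_, fun x => ?_,
      ?_, ?_⟩, ?_, ?_⟩
  · refine ((he x).mul (hF x).cexp).congr_deriv ?_
    rw [ha]; ring
  · refine ((he x).mul ((hw x).mul (hF x).cexp)).congr_deriv ?_
    simp only [ha, Pi.mul_apply]
    linear_combination (-Complex.exp (-(Complex.I * (Complex.I * τ / 2) * x)) * (w x *
      Complex.exp (F x))) * (τ : ℂ) * Complex.I_mul_I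
  · simp only [← ha, hcancel]
    simpa using hF0.cexp
  · simp only [← ha, hcancel]
    simpa using w0.mul hF0.cexp
  · simp only [← ha, hcancel]
    exact hF1.cexp
  · simp only [← ha, hcancel]
    simpa using w1.mul hF1.cexp

/-- The value picked by `Classical.epsilon` is determined by uniqueness, so any exhibited value
computes it. -/
lemma logTransmission_eq {κ τ : ℝ} {U : ℝ → ℂ} {l : ℂ} (hκ : |κ| = 1) (hτ : 0 ≤ τ)
    (hc : Continuous U) (hi : Integrable U)
    (h : IsInvTransmission κ U (Complex.I * τ / 2) (Complex.exp l)) :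
    logTransmission κ U τ = κ * l.re := by
  have h1 : IsInvTransmission κ U (Complex.I * τ / 2)
      (Classical.epsilon (IsInvTransmission κ U (Complex.I * τ / 2))) :=
    Classical.epsilon_spec ⟨_, h⟩
  rw [logTransmission, transmission, h1.unique hκ hτ hc hi h, norm_inv, Complex.norm_exp,
    ← Real.exp_neg, Real.log_exp]
  ring

/-- The coefficients of `ε ^ (2 k + 2)` in `logTransmission κ (ε u)`. -/
def logTransmissionCoeff (κ : ℝ) (u : ℝ → ℂ) (k : ℕ) (τ : ℝ) : ℝ := κ * (logCoeff κ u k τ).re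

lemma hasSum_logTransmission {κ τ B ε : ℝ} {u : ℝ → ℂ} (hu : C1Decay u) (hκ : |κ| = 1)
    (hB : ∀ x, ‖u x‖ ≤ B * (1 + x ^ 2)⁻¹) (hτ : 1 ≤ τ)
    (hε : 8 * (6 * B * ε) ^ 2 ≤ 1) :
    HasSum (fun k : ℕ => ε ^ (2 * k + 2) * logTransmissionCoeff κ u k τ)
      (logTransmission κ (fun x => ε * u x) τ) := by
  have hτ' : 1 ≤ |τ| := hτ.trans (le_abs_self τ)
  have huε := hu.const_mul ε
  have h := isInvTransmission_of_riccati (κ := κ) (τ := τ) (U := fun x => ε * u x)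
    (w := riccatiSol κ u τ ε) huε.continuous
    (by obtain ⟨C, hC⟩ := huε.bound; exact ⟨C, norm_le_of_decay hC⟩)
    (fun x => (hasDerivAt_riccatiSol hu hκ hB hτ' hε x).congr_deriv
      (by rw [map_mul, Complex.conj_ofReal]; ring))
    (norm_riccatiSol_le hκ hB hτ' hε)
  rw [logTransmission_eq hκ (by linarith) huε.continuous huε.integrable h]
  have := (Complex.hasSum_re (hasSum_logCoeff hu hκ hB hτ' hε)).mul_left κ
  refine this.congr_fun fun k => ?_
  rw [logTransmissionCoeff, ← Complex.ofReal_pow, Complex.re_ofReal_mul]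
  ring

/-! ### Power series in even powers of ε -/

section PowerSeries

variable {F : ℝ → ℝ} {e : ℕ → ℝ} {δ : ℝ}

/-- The sum over k is reindexed by the exponent n = 2k + 2, so k = n/2 - 1; odd n and n = 0 lie
outside the range of the injection and get coefficient 0. -/
lemma hasFPowerSeriesAt_of_hasSum_even (hδ : 0 < δ)
    (h : ∀ ε, |ε| < δ → HasSum (fun k : ℕ => ε ^ (2 * k + 2) * e k) (F ε)) :
    HasFPowerSeriesAt F (FormalMultilinearSeries.ofScalars ℝ
      (fun n => if n % 2 = 0 ∧ n ≠ 0 then e (n / 2 - 1) else 0)) 0 := by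
  rw [hasFPowerSeriesAt_iff]
  filter_upwards [Metric.ball_mem_nhds 0 hδ] with ε hε
  have hε' : |ε| < δ := by simpa using hε
  have hinj : Function.Injective fun k : ℕ => 2 * k + 2 := fun a b hab => by
    simp only at hab; omega
  rw [zero_add]
  refine (hinj.hasSum_iff fun n hn => ?_).1 ?_
  · rw [FormalMultilinearSeries.coeff_ofScalars, if_neg, smul_zero]
    rintro ⟨h1, h2⟩
    exact hn ⟨n / 2 - 1, by simp only; omega⟩
  · refine (h ε hε').congr_fun fun k => ?_
    rw [Function.comp_apply, FormalMultilinearSeries.coeff_ofScalars,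
      if_pos ⟨by omega, by omega⟩, smul_eq_mul]
    congr 2
    omega

lemma analyticAt_of_hasSum_even (hδ : 0 < δ)
    (h : ∀ ε, |ε| < δ → HasSum (fun k : ℕ => ε ^ (2 * k + 2) * e k) (F ε)) :
    AnalyticAt ℝ F 0 :=
  (hasFPowerSeriesAt_of_hasSum_even hδ h).analyticAt

lemma iteratedDeriv_four_of_hasSum_even (hδ : 0 < δ)
    (h : ∀ ε, |ε| < δ → HasSum (fun k : ℕ => ε ^ (2 * k + 2) * e k) (F ε)) :
    iteratedDeriv 4 F 0 / Nat.factorial 4 = e 1 := by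
  have h1 := hasFPowerSeriesAt_of_hasSum_even hδ h
  have h2 := h1.analyticAt.hasFPowerSeriesAt
  have h3 := congrArg (fun p => FormalMultilinearSeries.coeff p 4)
    (h2.eq_formalMultilinearSeries h1)
  simpa [FormalMultilinearSeries.coeff_ofScalars] using h3

/-- Uniqueness of Taylor coefficients, used to pass from an identity for all small ε to one for each
order. -/
lemma eq_zero_of_hasSum_even (hδ : 0 < δ)
    (h : ∀ ε, |ε| < δ → HasSum (fun k : ℕ => ε ^ (2 * k + 2) * e k) 0) (k : ℕ) : e k = 0 := by
  have h1 := hasFPowerSeriesAt_of_hasSum_even (F := fun _ => 0) hδ h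
  have h3 := congrArg (fun p => FormalMultilinearSeries.coeff p (2 * k + 2)) h1.eq_zero
  simp only [FormalMultilinearSeries.coeff_ofScalars] at h3
  rw [if_pos ⟨by omega, by omega⟩] at h3
  simpa [show (2 * k + 2) / 2 - 1 = k by omega, FormalMultilinearSeries.coeff] using h3

end PowerSeries

/-! ### Oddness in τ of the real parts of the coefficients -/

lemma exists_pos_small (B : ℝ) : ∃ δ > 0, ∀ ε : ℝ, |ε| < δ → 8 * (6 * B * ε) ^ 2 ≤ 1 := by
  -- This choice gives |6Bε| ≤ 1/3, and 8/9 ≤ 1.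
  refine ⟨1 / (18 * (|B| + 1)), by positivity, fun ε hε => ?_⟩
  have h1 : |6 * B * ε| ≤ 1 / 3 := by
    rw [abs_mul, abs_mul, abs_of_pos (by norm_num : (0 : ℝ) < 6)]
    calc 6 * |B| * |ε| ≤ 6 * (|B| + 1) * (1 / (18 * (|B| + 1))) := by
          gcongr; linarith
      _ = 1 / 3 := by field_simp; norm_num
  rw [← sq_abs]
  have := abs_nonneg (6 * B * ε)
  nlinarith

/-- The logarithms of the inverse transmission coefficient computed from the left and from the
right Jost solution agree. -/
lemma re_integral_riccatiSol_neg {κ τ B ε : ℝ} {u : ℝ → ℂ} (hu : C1Decay u) (hκ : |κ| = 1)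
    (hB : ∀ x, ‖u x‖ ≤ B * (1 + x ^ 2)⁻¹) (hτ : 1 ≤ |τ|)
    (hε : 8 * (6 * B * ε) ^ 2 ≤ 1) :
    (∫ x, ε * u x * riccatiSol κ u τ ε x).re +
      (∫ x, ε * u x * riccatiSol κ u (-τ) ε x).re = 0 := by
  have hτ' : 1 ≤ |-τ| := by rwa [abs_neg]
  have hκ2 : (κ : ℂ) ^ 2 = 1 := by
    rw [← Complex.ofReal_pow, ← sq_abs, hκ]; simp
  have hB0 := nonneg_of_decay hB
  have hc := fun {t : ℝ} (ht : 1 ≤ |t|) => continuous_riccatiSol (κ := κ) hu hκ hB ht hε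
  have hint : ∀ {t : ℝ}, 1 ≤ |t| → Integrable fun x => ε * u x * riccatiSol κ u t ε x := by
    intro t ht
    refine integrable_of_decay (C := |ε| * B * (12 * B * |ε|))
      ((continuous_const.mul hu.continuous).mul (hc ht)).aestronglyMeasurable fun x => ?_
    rw [norm_mul, norm_mul, Complex.norm_real, Real.norm_eq_abs]
    calc _ ≤ |ε| * B * (12 * B * |ε| * (1 + x ^ 2)⁻¹) := by
          gcongr
          · exact norm_le_of_decay hB x
          · exact norm_riccatiSol_le hκ hB ht hε x
      _ = _ := by ring
  obtain ⟨F, hF, hF0, hF1⟩ := exists_primitive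
    ((continuous_const.mul hu.continuous).mul (hc hτ)) (hint hτ)
  obtain ⟨G, hG, hG0, hG1⟩ := exists_primitive
    ((continuous_const.mul hu.continuous).mul (hc hτ')) (hint hτ')
  set w := riccatiSol κ u τ ε with hw
  set v := riccatiSol κ u (-τ) ε with hv
  -- This is a Wronskian. Let w be φ₂/φ₁ for a solution with φ₁ = e^F. Conjugating the equation of
  -- v, κv̄ is the quotient χ₁/χ₂ of a solution with χ₂ = e^{-τx}e^{Ḡ}. Then φ₁χ₂ - φ₂χ₁ is e^{-τx}
  -- times the displayed function; the system has trace -τ, so the displayed function is constant.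
  have hconst : ∀ x, HasDerivAt
      (fun x => (1 - w x * (κ * conj (v x))) * Complex.exp (F x + conj (G x))) 0 x := by
    intro x
    have hwd := hasDerivAt_riccatiSol hu hκ hB hτ hε x
    have hvd := (hasDerivAt_riccatiSol hu hκ hB hτ' hε x).star
    have := ((hwd.mul (hvd.const_mul (κ : ℂ))).const_sub 1).mul ((hF x).add (hG x).star).cexp
    refine this.congr_deriv ?_
    simp only [Pi.mul_apply, Pi.add_apply, ← hw, ← hv, RCLike.star_def, map_add, map_sub,
      map_mul, map_pow, Complex.conj_ofReal, Complex.conj_conj, Complex.ofReal_neg, neg_neg]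
    linear_combination (-(Complex.exp (F x + conj (G x)) * ε *
      (w x * u x + conj (u x) * conj (v x)))) * hκ2
  have hcst : ∀ x y, (1 - w x * (κ * conj (v x))) * Complex.exp (F x + conj (G x)) =
      (1 - w y * (κ * conj (v y))) * Complex.exp (F y + conj (G y)) := fun x y =>
    is_const_of_deriv_eq_zero (fun x => (hconst x).differentiableAt)
      (fun x => (hconst x).deriv) x y
  obtain ⟨w1, w0⟩ := tendsto_zero_of_decay (norm_riccatiSol_le (κ := κ) hκ hB hτ hε)
  obtain ⟨v1, v0⟩ := tendsto_zero_of_decay (norm_riccatiSol_le (κ := κ) hκ hB hτ' hε)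
  have hcj := Complex.continuous_conj
  have l0 := ((w0.mul (((hcj.tendsto _).comp v0).const_mul (κ : ℂ))).const_sub 1).mul
    (hF0.add ((hcj.tendsto _).comp hG0)).cexp
  have l1 := ((w1.mul (((hcj.tendsto _).comp v1).const_mul (κ : ℂ))).const_sub 1).mul
    (hF1.add ((hcj.tendsto _).comp hG1)).cexp
  -- At -∞ the constant is 1, at +∞ it is the exponential of one integral plus the conjugate of the
  -- other; taking norms leaves the sum of the real parts.
  have e0 := tendsto_nhds_unique l0 (tendsto_const_nhds.congr fun x => hcst 0 x)
  have e1 := tendsto_nhds_unique l1 (tendsto_const_nhds.congr fun x => hcst 0 x)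
  rw [← e0] at e1
  simp only [map_zero, mul_zero, sub_zero, add_zero, Complex.exp_zero, one_mul] at e1
  have := congrArg norm e1
  rw [Complex.norm_exp, norm_one, Real.exp_eq_one_iff] at this
  simpa using this

lemma re_logCoeff_neg {κ τ : ℝ} {u : ℝ → ℂ} (hu : C1Decay u) (hκ : |κ| = 1)
    (hτ : 1 ≤ |τ|) (k : ℕ) : (logCoeff κ u k (-τ)).re = -(logCoeff κ u k τ).re := by
  obtain ⟨B, hB⟩ := hu.bound
  obtain ⟨δ, hδ, hsmall⟩ := exists_pos_small B
  have := eq_zero_of_hasSum_even (e := fun k => (logCoeff κ u k τ).re + (logCoeff κ u k (-τ)).re)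
    hδ (fun ε hε => ?_) k
  · linarith
  · rw [← re_integral_riccatiSol_neg hu hκ hB hτ (hsmall ε hε)]
    refine ((Complex.hasSum_re (hasSum_logCoeff hu hκ hB hτ (hsmall ε hε))).add
      (Complex.hasSum_re (hasSum_logCoeff hu hκ hB
        (by rwa [abs_neg] : 1 ≤ |-τ|) (hsmall ε hε)))).congr_fun fun k => ?_
    rw [← Complex.ofReal_pow, Complex.re_ofReal_mul, Complex.re_ofReal_mul]
    ring

/-! ### Asymptotic expansions as |τ| → ∞ -/

lemma schwartz_decay (f : 𝓢(ℝ, ℂ)) : ∃ C, ∀ x, ‖f x‖ ≤ C * (1 + x ^ 2)⁻¹ := by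
  obtain ⟨A, hA⟩ := f.decay 0 0
  obtain ⟨B, hB⟩ := f.decay 2 0
  refine ⟨A + B, fun x => ?_⟩
  have h1 := hA.2 x
  have h2 := hB.2 x
  simp only [pow_zero, one_mul, norm_iteratedFDeriv_zero, Real.norm_eq_abs, sq_abs] at h1 h2
  rw [← div_eq_mul_inv, le_div_iff₀ (by positivity)]
  linarith

lemma schwartz_c1Decay (f : 𝓢(ℝ, ℂ)) : C1Decay f := by
  have h : ⇑(SchwartzMap.derivCLM ℝ ℂ f) = deriv f := funext fun x => by simp
  refine ⟨f.differentiable, h ▸ (SchwartzMap.derivCLM ℝ ℂ f).continuous, schwartz_decay f,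
    h ▸ schwartz_decay (SchwartzMap.derivCLM ℝ ℂ f)⟩

/-- Products of Schwartz functions. -/
def schwartzMul (f g : 𝓢(ℝ, ℂ)) : 𝓢(ℝ, ℂ) :=
  SchwartzMap.pairing (𝕜 := ℝ) (ContinuousLinearMap.mul ℝ ℂ) f g

@[simp] lemma schwartzMul_apply (f g : 𝓢(ℝ, ℂ)) (x : ℝ) : schwartzMul f g x = f x * g x := by
  simp [schwartzMul]

/-- Complex conjugates of Schwartz functions. -/
def schwartzConj (f : 𝓢(ℝ, ℂ)) : 𝓢(ℝ, ℂ) :=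
  SchwartzMap.postcompCLM (𝕜 := ℝ) (Complex.conjCLE : ℂ →L[ℝ] ℂ) f

@[simp] lemma schwartzConj_apply (f : 𝓢(ℝ, ℂ)) (x : ℝ) : schwartzConj f x = conj (f x) := by
  simp [schwartzConj]

/-- `W τ` has an asymptotic expansion to order `J` in powers of `τ⁻¹` as `|τ| → ∞`, with
coefficients that are Schwartz functions. -/
def HasExpansion : ℕ → (ℝ → ℝ → ℂ) → Prop
  | 0, W => ∃ C, ∀ τ, 1 ≤ |τ| → Continuous (W τ) ∧ ∀ x, ‖W τ x‖ ≤ C * (1 + x ^ 2)⁻¹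
  | J + 1, W => ∃ (f : 𝓢(ℝ, ℂ)) (V : ℝ → ℝ → ℂ), HasExpansion J V ∧
      ∀ τ, 1 ≤ |τ| → ∀ x, W τ x = f x + (τ : ℂ)⁻¹ * V τ x

lemma norm_ofReal_inv_le_one {τ : ℝ} (hτ : 1 ≤ |τ|) : ‖(τ : ℂ)⁻¹‖ ≤ 1 := by
  rw [norm_inv, Complex.norm_real, Real.norm_eq_abs]
  exact inv_le_one_of_one_le₀ hτ

namespace HasExpansion

variable {J : ℕ} {W V : ℝ → ℝ → ℂ}

lemma congr (h : HasExpansion J W) (hWV : ∀ τ, 1 ≤ |τ| → ∀ x, V τ x = W τ x) :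
    HasExpansion J V := by
  cases J with
  | zero =>
    obtain ⟨C, hC⟩ := h
    refine ⟨C, fun τ hτ => ?_⟩
    rw [show V τ = W τ from funext (hWV τ hτ)]
    exact hC τ hτ
  | succ J =>
    obtain ⟨f, X, hX, h⟩ := h
    exact ⟨f, X, hX, fun τ hτ x => (hWV τ hτ x).trans (h τ hτ x)⟩

lemma of_schwartz (f : 𝓢(ℝ, ℂ)) : HasExpansion J (fun _ => f) := by
  induction J generalizing f with
  | zero =>
    obtain ⟨C, hC⟩ := schwartz_decay f
    exact ⟨C, fun τ _ => ⟨f.continuous, hC⟩⟩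
  | succ J ih => exact ⟨f, fun _ => (0 : 𝓢(ℝ, ℂ)), ih 0, fun τ _ x => by simp⟩

lemma succ_zero (f : 𝓢(ℝ, ℂ)) (h : HasExpansion 0 V)
    (hW : ∀ τ, 1 ≤ |τ| → ∀ x, W τ x = f x + (τ : ℂ)⁻¹ * V τ x) : HasExpansion 0 W := by
  obtain ⟨C, hC⟩ := h
  obtain ⟨A, hA⟩ := schwartz_decay f
  refine ⟨A + C, fun τ hτ => ?_⟩
  rw [show W τ = fun x => f x + (τ : ℂ)⁻¹ * V τ x from funext (hW τ hτ)]
  refine ⟨f.continuous.add (continuous_const.mul (hC τ hτ).1), fun x => ?_⟩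
  rw [add_mul]
  refine (norm_add_le _ _).trans (add_le_add (hA x) ?_)
  rw [norm_mul]
  exact (mul_le_of_le_one_left (norm_nonneg _) (norm_ofReal_inv_le_one hτ)).trans ((hC τ hτ).2 x)

lemma of_succ (h : HasExpansion (J + 1) W) : HasExpansion J W := by
  induction J generalizing W with
  | zero =>
    obtain ⟨f, X, hX, h⟩ := h
    exact succ_zero f hX h
  | succ J ih =>
    obtain ⟨f, X, hX, h⟩ := h
    exact ⟨f, X, ih hX, h⟩

lemma to_zero (h : HasExpansion J W) : HasExpansion 0 W := by
  induction J with
  | zero => exact h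
  | succ J ih => exact ih h.of_succ

lemma inv_mul (h : HasExpansion J W) : HasExpansion J fun τ x => (τ : ℂ)⁻¹ * W τ x := by
  have : HasExpansion (J + 1) fun τ x => (τ : ℂ)⁻¹ * W τ x :=
    ⟨0, W, h, fun τ _ x => by simp⟩
  exact this.of_succ

lemma add (hW : HasExpansion J W) (hV : HasExpansion J V) :
    HasExpansion J fun τ x => W τ x + V τ x := by
  induction J generalizing W V with
  | zero =>
    obtain ⟨A, hA⟩ := hW
    obtain ⟨B, hB⟩ := hV
    refine ⟨A + B, fun τ hτ => ⟨(hA τ hτ).1.add (hB τ hτ).1, fun x => ?_⟩⟩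
    rw [add_mul]
    exact (norm_add_le _ _).trans (add_le_add ((hA τ hτ).2 x) ((hB τ hτ).2 x))
  | succ J ih =>
    obtain ⟨f, X, hX, hW⟩ := hW
    obtain ⟨g, Y, hY, hV⟩ := hV
    refine ⟨f + g, _, ih hX hY, fun τ hτ x => ?_⟩
    simp only [hW τ hτ, hV τ hτ, add_apply]
    ring

/-- From (f + τ⁻¹X)(g + τ⁻¹Y): the leading coefficient is fg and the new remainder is fY + Xg +
τ⁻¹XY, to which induction applies. -/
lemma mul (hW : HasExpansion J W) (hV : HasExpansion J V) :
    HasExpansion J fun τ x => W τ x * V τ x := by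
  induction J generalizing W V with
  | zero =>
    obtain ⟨A, hA⟩ := hW
    obtain ⟨B, hB⟩ := hV
    refine ⟨A * B, fun τ hτ => ⟨(hA τ hτ).1.mul (hB τ hτ).1, fun x => ?_⟩⟩
    have h1 := (hA τ hτ).2
    have h2 := (hB τ hτ).2
    rw [norm_mul]
    calc _ ≤ A * (B * (1 + x ^ 2)⁻¹) :=
          mul_le_mul (norm_le_of_decay h1 x) (h2 x) (norm_nonneg _) (nonneg_of_decay h1)
      _ = _ := by ring
  | succ J ih =>
    obtain ⟨f, X, hX, hW⟩ := hW
    obtain ⟨g, Y, hY, hV⟩ := hV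
    refine ⟨schwartzMul f g, _, ((ih (of_schwartz f) hY).add
      (ih hX (of_schwartz g))).add (ih hX hY).inv_mul, fun τ hτ x => ?_⟩
    simp only [hW τ hτ, hV τ hτ, schwartzMul_apply]
    ring

lemma neg (hW : HasExpansion J W) : HasExpansion J fun τ x => -W τ x := by
  induction J generalizing W with
  | zero =>
    obtain ⟨A, hA⟩ := hW
    exact ⟨A, fun τ hτ => ⟨(hA τ hτ).1.neg, by simpa using (hA τ hτ).2⟩⟩
  | succ J ih =>
    obtain ⟨f, X, hX, hW⟩ := hW
    refine ⟨-f, _, ih hX, fun τ hτ x => ?_⟩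
    simp only [hW τ hτ, neg_apply]
    ring

lemma sum {ι : Type*} (s : Finset ι) {F : ι → ℝ → ℝ → ℂ}
    (h : ∀ i ∈ s, HasExpansion J (F i)) : HasExpansion J fun τ x => ∑ i ∈ s, F i τ x := by
  classical
  induction s using Finset.induction_on with
  | empty => exact (of_schwartz 0).congr fun τ _ x => by simp
  | insert a s ha ih =>
    simp only [Finset.sum_insert ha]
    exact (h a (by simp)).add (ih fun i hi => h i (by simp [hi]))

/-- Iterates R_τ f = τ⁻¹(f - R_τ f'); Schwartz functions allow this any number of times. The
coefficient of order zero vanishes. -/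
lemma resolvent_schwartz (f : 𝓢(ℝ, ℂ)) : HasExpansion J fun τ => resolvent τ f := by
  induction J generalizing f with
  | zero =>
    obtain ⟨C, hC⟩ := schwartz_decay f
    have hC0 := nonneg_of_decay hC
    refine ⟨6 * C, fun τ hτ => ⟨((schwartz_c1Decay f).resolvent hτ).continuous, fun x => ?_⟩⟩
    refine (norm_resolvent_le hτ hC x).trans ?_
    gcongr
    exact div_le_self (by positivity) hτ
  | succ J ih =>
    refine ⟨0, _, (of_schwartz f).add (ih (SchwartzMap.derivCLM ℝ ℂ f)).neg, fun τ hτ x => ?_⟩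
    have hτ0 : τ ≠ 0 := by rintro rfl; norm_num at hτ
    have hτ' : (τ : ℂ) ≠ 0 := by exact_mod_cast hτ0
    have h : ⇑(SchwartzMap.derivCLM ℝ ℂ f) = deriv f := funext fun x => by simp
    rw [h, (schwartz_c1Decay f).resolvent_deriv hτ0, zero_apply]
    field_simp
    ring

/-- By linearity R_τ(f + τ⁻¹X) = R_τ f + τ⁻¹R_τ X, which reduces to the case of a fixed Schwartz
function and to a lower order. -/
lemma resolvent (hW : HasExpansion J W) : HasExpansion J fun τ => resolvent τ (W τ) := by
  induction J generalizing W with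
  | zero =>
    obtain ⟨C, hC⟩ := hW
    refine ⟨6 * C, fun τ hτ => ⟨?_, fun x => ?_⟩⟩
    · obtain ⟨hc, hb⟩ := hC τ hτ
      refine continuous_const.mul (continuous_of_dominated (bound := fun r => Real.exp (-r) * C)
        (fun x => Continuous.aestronglyMeasurable (by fun_prop))
        (fun x => Eventually.of_forall fun r => ?_) (integrableOn_exp_neg.mul_const C)
        (Eventually.of_forall fun r => by fun_prop))
      rw [norm_mul, Complex.norm_real, Real.norm_eq_abs, Real.abs_exp]
      exact mul_le_mul_of_nonneg_left (norm_le_of_decay hb _) (Real.exp_pos _).le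
    · have hC0 := nonneg_of_decay (hC τ hτ).2
      refine (norm_resolvent_le hτ (hC τ hτ).2 x).trans ?_
      gcongr
      exact div_le_self (by positivity) hτ
  | succ J ih =>
    obtain ⟨f, X, hX, hW⟩ := hW
    have h0 := hX.to_zero
    have h1 : HasExpansion (J + 1) fun τ x => (τ : ℂ)⁻¹ * NLSEnergy.resolvent τ (X τ) x :=
      ⟨0, _, ih hX, fun τ _ x => by simp⟩
    refine ((resolvent_schwartz f).add h1).congr fun τ hτ x => ?_
    obtain ⟨C, hC⟩ := h0
    obtain ⟨hc, hb⟩ := hC τ hτ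
    obtain ⟨A, hA⟩ := schwartz_decay f
    have hfc := f.continuous
    simp only [NLSEnergy.resolvent]
    rw [← mul_add, ← integral_const_mul (τ : ℂ)⁻¹ (fun r => (Real.exp (-r) : ℂ) * X τ (x - r / τ)),
      ← integral_add
      (integrableOn_exp_neg_mul (by fun_prop) (fun r => norm_le_of_decay hA _))
      ((integrableOn_exp_neg_mul (by fun_prop) (fun r => norm_le_of_decay hb _)).const_mul _)]
    congr 1
    refine integral_congr_ae (Eventually.of_forall fun r => ?_)
    simp only [hW τ hτ]
    ring

lemma integral (hW : HasExpansion J W) :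
    ∃ (c : ℕ → ℂ) (C : ℝ), ∀ τ, 1 ≤ |τ| →
      ‖(∫ x, W τ x) - ∑ j ∈ Finset.range J, c j * (τ : ℂ)⁻¹ ^ j‖ ≤ C * |τ|⁻¹ ^ J := by
  induction J generalizing W with
  | zero =>
    obtain ⟨C, hC⟩ := hW
    refine ⟨0, C * Real.pi, fun τ hτ => ?_⟩
    have := norm_integral_le_of_norm_le (integrable_inv_one_add_sq.const_mul C)
      (Eventually.of_forall (hC τ hτ).2)
    rw [integral_const_mul, integral_univ_inv_one_add_sq] at this
    simpa using this
  | succ J ih =>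
    obtain ⟨f, X, hX, hW⟩ := hW
    have h0 := hX.to_zero
    obtain ⟨c, C, hc⟩ := ih hX
    obtain ⟨A, hA⟩ := h0
    refine ⟨fun j => Nat.casesOn j (∫ x, f x) c, C, fun τ hτ => ?_⟩
    rw [Finset.sum_range_succ', integral_congr_ae (Eventually.of_forall (hW τ hτ)),
      integral_add f.integrable ((integrable_of_decay (hA τ hτ).1.aestronglyMeasurable
        (hA τ hτ).2).const_mul _), integral_const_mul]
    have : (∫ x, f x) + (τ : ℂ)⁻¹ * (∫ x, X τ x) -
        ((∑ j ∈ Finset.range J, c j * (τ : ℂ)⁻¹ ^ (j + 1)) + (∫ x, f x) * (τ : ℂ)⁻¹ ^ 0) =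
        (τ : ℂ)⁻¹ * ((∫ x, X τ x) - ∑ j ∈ Finset.range J, c j * (τ : ℂ)⁻¹ ^ j) := by
      rw [mul_sub, Finset.mul_sum]
      simp only [pow_succ]
      rw [pow_zero, Finset.sum_congr rfl fun j _ => show c j * ((τ : ℂ)⁻¹ ^ j * (τ : ℂ)⁻¹) =
        (τ : ℂ)⁻¹ * (c j * (τ : ℂ)⁻¹ ^ j) by ring]
      ring
    refine (le_of_eq (congrArg norm this)).trans ?_
    rw [norm_mul, norm_inv, Complex.norm_real, Real.norm_eq_abs]
    calc |τ|⁻¹ * _ ≤ |τ|⁻¹ * (C * |τ|⁻¹ ^ J) := by gcongr; exact hc τ hτ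
      _ = _ := by ring

end HasExpansion

lemma hasExpansion_riccatiCoeff (κ : ℝ) (u : 𝓢(ℝ, ℂ)) (J k : ℕ) :
    HasExpansion J fun τ => riccatiCoeff κ u τ k := by
  induction k using Nat.strong_induction_on with
  | _ k ih =>
    simp_rw [riccatiCoeff_eq]
    refine HasExpansion.resolvent (W := fun τ => riccatiSource κ u τ k) ?_
    cases k with
    | zero =>
      exact (HasExpansion.of_schwartz ((κ : ℝ) • schwartzConj u)).congr fun τ _ x => by
        simp [riccatiSource]
    | succ k =>
      exact ((HasExpansion.of_schwartz u).mul (HasExpansion.sum Finset.univ fun i _ =>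
        (ih _ (Fin.isLt i)).mul (ih (k - i) (by omega)))).neg

/-- `h(τ) = ∑_{j < M} (-1)^j η_j τ^{-2j-1} + O(τ^{-2M-1})` for `τ ≥ 1`. -/
def HasOddExpansion (M : ℕ) (h : ℝ → ℝ) (η : ℕ → ℝ) : Prop :=
  ∃ C, ∀ τ, 1 ≤ τ →
    |h τ - ∑ j ∈ Finset.range M, (-1) ^ j * η j / τ ^ (2 * j + 1)| ≤ C / τ ^ (2 * M + 1)

/-- Half the difference of the expansions at τ and at -τ contains only the odd powers. Both signs of
τ are therefore needed in the hypothesis; this is why the resolvent is defined for negative τ as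
well. -/
lemma exists_hasOddExpansion_of_odd {h : ℝ → ℝ} {c : ℕ → ℝ} {C : ℝ} {M : ℕ}
    (hodd : ∀ τ, 1 ≤ |τ| → h (-τ) = -h τ)
    (hexp : ∀ τ, 1 ≤ |τ| →
      |h τ - ∑ j ∈ Finset.range (2 * M + 1), c j * τ⁻¹ ^ j| ≤ C * |τ|⁻¹ ^ (2 * M + 1)) :
    ∃ η, HasOddExpansion M h η := by
  refine ⟨fun j => (-1) ^ j * c (2 * j + 1), C, fun τ hτ => ?_⟩
  have hτ' : 1 ≤ |τ| := hτ.trans (le_abs_self τ)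
  have h1 := hexp τ hτ'
  have h2 := hexp (-τ) (by rwa [abs_neg])
  rw [hodd τ hτ'] at h2
  have h3 : ∀ N : ℕ, ∑ j ∈ Finset.range (2 * N + 1), c j * τ⁻¹ ^ j -
      ∑ j ∈ Finset.range (2 * N + 1), c j * (-τ)⁻¹ ^ j =
      2 * ∑ j ∈ Finset.range N, (-1) ^ j * ((-1) ^ j * c (2 * j + 1)) / τ ^ (2 * j + 1) := by
    intro N
    induction N with
    | zero => simp
    | succ N ih =>
      rw [show 2 * (N + 1) + 1 = 2 * N + 1 + 1 + 1 by ring, Finset.sum_range_succ,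
        Finset.sum_range_succ, Finset.sum_range_succ (fun j => c j * (-τ)⁻¹ ^ j),
        Finset.sum_range_succ (fun j => c j * (-τ)⁻¹ ^ j), Finset.sum_range_succ _ N, mul_add,
        ← ih, ← mul_assoc, ← mul_pow, inv_neg, Odd.neg_pow (n := 2 * N + 1) (by simp),
        Even.neg_pow (n := 2 * N + 1 + 1) ⟨N + 1, by ring⟩]
      simp only [mul_neg, one_mul, mul_one, neg_neg, one_pow, inv_pow, div_eq_mul_inv]
      ring
  rw [abs_neg] at h2
  have hp : |τ|⁻¹ ^ (2 * M + 1) = (τ ^ (2 * M + 1))⁻¹ := by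
    rw [abs_of_pos (by linarith), inv_pow]
  rw [hp] at h1 h2
  rw [div_eq_mul_inv]
  rw [abs_le] at h1 h2 ⊢
  have := h3 M
  constructor <;> linarith

lemma exists_hasOddExpansion_logTransmissionCoeff {κ : ℝ} (hκ : |κ| = 1) (u : 𝓢(ℝ, ℂ))
    (k M : ℕ) : ∃ η, HasOddExpansion M (logTransmissionCoeff κ u k) η := by
  obtain ⟨c, C, hc⟩ := ((HasExpansion.of_schwartz u).mul
    (hasExpansion_riccatiCoeff κ u (2 * M + 1) k)).integral
  refine exists_hasOddExpansion_of_odd (c := fun j => κ * (c j).re) (C := C)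
    (fun τ hτ => ?_) (fun τ hτ => ?_)
  · rw [logTransmissionCoeff, logTransmissionCoeff, re_logCoeff_neg (schwartz_c1Decay u) hκ hτ]
    ring
  · have h1 : logTransmissionCoeff κ u k τ -
        ∑ j ∈ Finset.range (2 * M + 1), κ * (c j).re * τ⁻¹ ^ j =
        κ * ((∫ x, u x * riccatiCoeff κ u τ k x) -
          ∑ j ∈ Finset.range (2 * M + 1), c j * (τ : ℂ)⁻¹ ^ j).re := by
      rw [logTransmissionCoeff, logCoeff, Complex.sub_re, Complex.re_sum, mul_sub, Finset.mul_sum]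
      congr 1
      refine Finset.sum_congr rfl fun j _ => ?_
      rw [← Complex.ofReal_inv, ← Complex.ofReal_pow, Complex.re_mul_ofReal, mul_assoc]
    rw [h1, abs_mul, hκ, one_mul]
    exact (Complex.abs_re_le_norm _).trans (hc τ hτ)

/-! ### Beta integrals and the representation of (1 + X)^s -/

lemma integrableOn_rpow_mul_exp_neg_mul {a r : ℝ} (ha : 0 < a) (hr : 0 < r) :
    IntegrableOn (fun t : ℝ => t ^ (a - 1) * Real.exp (-(r * t))) (Set.Ioi 0) := by
  have := integrableOn_rpow_mul_exp_neg_mul_rpow (p := 1) (s := a - 1) (by linarith) one_pos hr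
  simpa using this

/-- The Beta integral over the half-line. -/
lemma beta_integral_Ioi {a c A : ℝ} (ha : 0 < a) (hac : a < c) (hA : 0 < A) :
    IntegrableOn (fun v : ℝ => v ^ (a - 1) * (A + v) ^ (-c)) (Set.Ioi 0) ∧
    ∫ v in Set.Ioi (0 : ℝ), v ^ (a - 1) * (A + v) ^ (-c) =
      Real.Gamma a * Real.Gamma (c - a) / Real.Gamma c * A ^ (a - c) := by
  have hc : 0 < c := ha.trans hac
  -- Writing (A + v)^{-c} as a Gamma integral in t gives a positive double integral; integrating
  -- first in v or first in t yields the two sides.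
  set K : ℝ × ℝ → ℝ := fun p =>
    p.1 ^ (a - 1) * (p.2 ^ (c - 1) * Real.exp (-((A + p.1) * p.2))) with hK
  have hmeas : Measurable K := by
    refine (Measurable.pow_const measurable_fst _).mul
      ((Measurable.pow_const measurable_snd _).mul (by fun_prop))
  have hrow : ∀ t : ℝ, (fun v => K (v, t)) = fun v => t ^ (c - 1) * Real.exp (-(A * t)) *
      (v ^ (a - 1) * Real.exp (-(t * v))) := by
    intro t
    funext v
    simp only [hK]
    rw [show -((A + v) * t) = -(A * t) + -(t * v) by ring, Real.exp_add]
    ring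
  have hrowint : ∀ t : ℝ, 0 < t → ∫ v in Set.Ioi (0 : ℝ), K (v, t) =
      Real.Gamma a * (t ^ (c - a - 1) * Real.exp (-(A * t))) := by
    intro t ht
    rw [hrow, integral_const_mul, Real.integral_rpow_mul_exp_neg_mul_Ioi ha ht, one_div,
      Real.inv_rpow ht.le, show c - a - 1 = (c - 1) + -a by ring, Real.rpow_add ht,
      Real.rpow_neg ht.le]
    ring
  have hcolint : ∀ v : ℝ, 0 < v → ∫ t in Set.Ioi (0 : ℝ), K (v, t) =
      Real.Gamma c * (v ^ (a - 1) * (A + v) ^ (-c)) := by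
    intro v hv
    simp only [hK]
    rw [integral_const_mul, Real.integral_rpow_mul_exp_neg_mul_Ioi hc (by positivity), one_div,
      Real.inv_rpow (by positivity), Real.rpow_neg (by positivity)]
    ring
  have hpos : ∀ v t : ℝ, 0 < v → 0 < t → 0 ≤ K (v, t) := fun v t hv ht => by
    simp only [hK]; positivity
  have hint : Integrable K ((volume.restrict (Set.Ioi 0)).prod (volume.restrict (Set.Ioi 0))) := by
    rw [integrable_prod_iff' hmeas.aestronglyMeasurable]
    constructor
    · filter_upwards [ae_restrict_mem measurableSet_Ioi] with t ht
      rw [hrow]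
      exact (integrableOn_rpow_mul_exp_neg_mul ha ht).const_mul _
    · have h1 : IntegrableOn (fun t : ℝ => Real.Gamma a *
          (t ^ (c - a - 1) * Real.exp (-(A * t)))) (Set.Ioi 0) :=
        (integrableOn_rpow_mul_exp_neg_mul (by linarith) hA).const_mul _
      refine h1.congr_fun (fun t ht => ?_) measurableSet_Ioi
      simp only
      rw [← hrowint t ht]
      refine setIntegral_congr_fun measurableSet_Ioi fun v hv => ?_
      exact (Real.norm_of_nonneg (hpos v t hv ht)).symm
  have hΓ := (Real.Gamma_pos_of_pos hc).ne'
  constructor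
  · have h2 : IntegrableOn (fun v => Real.Gamma c * (v ^ (a - 1) * (A + v) ^ (-c)))
        (Set.Ioi 0) := by
      refine IntegrableOn.congr_fun hint.integral_prod_left (fun v hv => ?_) measurableSet_Ioi
      exact hcolint v hv
    have h3 := h2.const_mul (Real.Gamma c)⁻¹
    simp only [inv_mul_cancel_left₀ hΓ] at h3
    exact h3
  · have h4 := integral_integral_swap (f := fun v t => K (v, t)) hint
    rw [setIntegral_congr_fun measurableSet_Ioi fun v hv => hcolint v hv,
      setIntegral_congr_fun measurableSet_Ioi fun t ht => hrowint t ht, integral_const_mul,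
      integral_const_mul, Real.integral_rpow_mul_exp_neg_mul_Ioi (by linarith) hA, one_div,
      Real.inv_rpow hA.le, ← Real.rpow_neg hA.le, neg_sub] at h4
    field_simp
    linarith

lemma integrableOn_rpow_div {s c : ℝ} (hs : -1 < s) (hsc : s + 1 < c) :
    IntegrableOn (fun v : ℝ => v ^ s * (1 + v) ^ (-c)) (Set.Ioi 0) := by
  have := (beta_integral_Ioi (a := s + 1) (by linarith) hsc one_pos).1
  simpa using this

/-- The remainder of the `N`-th Taylor polynomial of `X ↦ -1 / (1 + v + X)` at `X = 0`. -/
def geomRemainder (N : ℕ) (v X : ℝ) : ℝ :=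
  -1 / (1 + v + X) + ∑ j ∈ Finset.range N, (-X) ^ j / (1 + v) ^ (j + 1)

lemma geomRemainder_eq {v X : ℝ} (hv : 0 ≤ v) (hX : 0 ≤ X) (N : ℕ) :
    geomRemainder N v X = -(-X) ^ N / ((1 + v) ^ N * (1 + v + X)) := by
  have h1 : 1 + v ≠ 0 := by positivity
  have h2 : 1 + v + X ≠ 0 := by positivity
  induction N with
  | zero => simp [geomRemainder]
  | succ N ih =>
    have : geomRemainder (N + 1) v X = geomRemainder N v X + (-X) ^ N / (1 + v) ^ (N + 1) := by
      rw [geomRemainder, Finset.sum_range_succ, ← add_assoc, geomRemainder]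
    rw [this, ih]
    field_simp
    ring

lemma abs_geomRemainder_le {v X : ℝ} (hv : 0 ≤ v) (hX : 0 ≤ X) (N : ℕ) :
    |geomRemainder N v X| ≤ X ^ N * ((1 + v) ^ (N + 1))⁻¹ := by
  rw [geomRemainder_eq hv hX, abs_div, abs_neg, abs_pow, abs_neg, abs_of_nonneg hX,
    div_eq_mul_inv, abs_of_pos (by positivity)]
  refine mul_le_mul_of_nonneg_left (inv_anti₀ (by positivity) ?_) (by positivity)
  rw [pow_succ]
  exact mul_le_mul_of_nonneg_left (by linarith) (by positivity)

/-- A factor v taken from v^s lowers the order of the remainder by one, at the price of a pure Beta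
integrand. This is the inductive step from s - 1 to s. -/
lemma mul_geomRemainder_succ {v X : ℝ} (hv : 0 ≤ v) (hX : 0 ≤ X) (N : ℕ) :
    v * geomRemainder (N + 1) v X =
      -(1 + X) * geomRemainder N v X - (-X) ^ N * ((1 + v) ^ (N + 1))⁻¹ := by
  have h1 : 1 + v ≠ 0 := by positivity
  have h2 : 1 + v + X ≠ 0 := by positivity
  rw [geomRemainder_eq hv hX, geomRemainder_eq hv hX]
  field_simp
  ring

lemma measurable_geomRemainder (N : ℕ) (X : ℝ) : Measurable fun v => geomRemainder N v X := by
  unfold geomRemainder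
  fun_prop

lemma integrableOn_rpow_mul_geomRemainder {s X : ℝ} {N : ℕ} (hs : -1 < s) (hsN : s < N)
    (hX : 0 ≤ X) : IntegrableOn (fun v => v ^ s * geomRemainder N v X) (Set.Ioi 0) := by
  refine Integrable.mono' ((integrableOn_rpow_div (c := N + 1) hs (by linarith)).const_mul (X ^ N))
    ((Measurable.pow_const measurable_id _).mul
      (measurable_geomRemainder N X)).aestronglyMeasurable ?_
  filter_upwards [ae_restrict_mem measurableSet_Ioi] with v hv
  have hv : 0 < v := hv
  rw [norm_mul, Real.norm_of_nonneg (Real.rpow_nonneg hv.le _), Real.norm_eq_abs,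
    Real.rpow_neg (by positivity), mul_left_comm]
  refine mul_le_mul_of_nonneg_left ?_ (Real.rpow_nonneg hv.le _)
  exact_mod_cast abs_geomRemainder_le hv.le hX N

lemma succ_mul_choose_succ (r : ℝ) (n : ℕ) :
    (n + 1) * Ring.choose r (n + 1) = Ring.choose r n * (r - n) := by
  have h1 := Ring.descPochhammer_eq_factorial_smul_choose r (n + 1)
  have h2 := Ring.descPochhammer_eq_factorial_smul_choose r n
  rw [descPochhammer_succ_right, Polynomial.smeval_mul, h2] at h1
  simp only [Polynomial.smeval_sub, Polynomial.smeval_X, Polynomial.smeval_natCast, pow_one,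
    pow_zero, nsmul_eq_mul, mul_one, Nat.factorial_succ, Nat.cast_mul, Nat.cast_add,
    Nat.cast_one] at h1
  have h3 : (n.factorial : ℝ) ≠ 0 := by positivity
  apply mul_left_cancel₀ h3
  linear_combination -h1

/-- The reflection formula for N = 0; afterwards both sides acquire the factor (N + 1 - s)/(N + 1).
It evaluates the Beta terms left over by the recursion. -/
lemma sin_mul_Gamma_mul_Gamma {s : ℝ} (hs : ∀ n : ℤ, s ≠ n) (N : ℕ) :
    Real.sin (Real.pi * s) / Real.pi * (Real.Gamma s * Real.Gamma (N + 1 - s) / Real.Gamma (N + 1))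
      = (-1) ^ N * Ring.choose (s - 1) N := by
  induction N with
  | zero =>
    have hsin : Real.sin (Real.pi * s) ≠ 0 := by
      rw [Real.sin_ne_zero_iff]
      intro n h
      refine hs n (mul_left_cancel₀ Real.pi_ne_zero ?_)
      linarith
    have := Real.Gamma_mul_Gamma_one_sub s
    simp only [Nat.cast_zero, zero_add, this, Real.Gamma_one, div_one, pow_zero, one_mul,
      Ring.choose_zero_right]
    have := Real.pi_ne_zero
    field_simp
  | succ N ih =>
    have h1 : (N : ℝ) + 1 - s ≠ 0 := fun h => hs (N + 1) (by push_cast; linarith)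
    have h2 : Real.Gamma (((N + 1 : ℕ) : ℝ) + 1 - s) =
        (N + 1 - s) * Real.Gamma (N + 1 - s) := by
      rw [← Real.Gamma_add_one h1]
      congr 1
      push_cast
      ring
    have h3 : Real.Gamma (((N + 1 : ℕ) : ℝ) + 1) = (N + 1) * Real.Gamma (N + 1) := by
      rw [← Real.Gamma_add_one (by positivity)]
      push_cast
      rfl
    have h4 := succ_mul_choose_succ (s - 1) N
    have h5 : (N : ℝ) + 1 ≠ 0 := by positivity
    have h6 : Ring.choose (s - 1) (N + 1) = Ring.choose (s - 1) N * (s - 1 - N) / (N + 1) := by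
      rw [eq_div_iff h5]; linarith
    have h7 : Real.Gamma (N + 1 : ℝ) ≠ 0 := (Real.Gamma_pos_of_pos (by positivity)).ne'
    rw [h2, h3, h6, pow_succ]
    have : Real.sin (Real.pi * s) / Real.pi * (Real.Gamma s * ((N + 1 - s) *
        Real.Gamma (N + 1 - s)) / ((N + 1) * Real.Gamma (N + 1))) =
        (N + 1 - s) / (N + 1) * (Real.sin (Real.pi * s) / Real.pi *
          (Real.Gamma s * Real.Gamma (N + 1 - s) / Real.Gamma (N + 1))) := by
      field_simp
    rw [this, ih]
    ring

lemma sum_choose_succ (s X : ℝ) (N : ℕ) :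
    ∑ j ∈ Finset.range (N + 1), Ring.choose s j * X ^ j =
      (1 + X) * ∑ j ∈ Finset.range N, Ring.choose (s - 1) j * X ^ j +
        Ring.choose (s - 1) N * X ^ N := by
  induction N with
  | zero => simp
  | succ N ih =>
    have := Ring.choose_succ_succ (s - 1) N
    rw [sub_add_cancel] at this
    rw [Finset.sum_range_succ, ih, Finset.sum_range_succ, this]
    ring

/-- Induction on N, shifting s by one. For -1 < s < 0 this is a Beta integral with the reflection
formula. In the step, `mul_geomRemainder_succ` matches (1+X)^s = (1+X)(1+X)^{s-1} on one side and
Pascal's rule for the truncated binomial series (`sum_choose_succ`) on the other; the change of sign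
of sin(πs) compensates the factor -(1+X). -/
lemma sin_mul_integral_geomRemainder_of_lt {s X : ℝ} (hX : 0 ≤ X) {N : ℕ}
    (h1 : (N : ℝ) - 1 < s) (h2 : s < N) :
    Real.sin (Real.pi * s) / Real.pi * ∫ v in Set.Ioi (0 : ℝ), v ^ s * geomRemainder N v X =
      (1 + X) ^ s - ∑ j ∈ Finset.range N, Ring.choose s j * X ^ j := by
  have hX1 : 0 < 1 + X := by positivity
  induction N generalizing s with
  | zero =>
    simp only [Nat.cast_zero, zero_sub] at h1 h2
    have hb := (beta_integral_Ioi (a := s + 1) (c := 1) (by linarith) (by linarith) hX1).2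
    rw [add_sub_cancel_right, show 1 - (s + 1) = -s by ring,
      Real.Gamma_one, div_one] at hb
    have hint : ∫ v in Set.Ioi (0 : ℝ), v ^ s * geomRemainder 0 v X =
        -∫ v in Set.Ioi (0 : ℝ), v ^ s * (1 + X + v) ^ (-1 : ℝ) := by
      rw [← integral_neg]
      refine setIntegral_congr_fun measurableSet_Ioi fun v hv => ?_
      have hv : 0 < v := hv
      simp only [geomRemainder, Finset.range_zero, Finset.sum_empty, add_zero]
      rw [Real.rpow_neg_one, show 1 + X + v = 1 + v + X by ring]
      ring
    have hG := Real.Gamma_mul_Gamma_one_sub (s + 1)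
    rw [show 1 - (s + 1) = -s by ring] at hG
    rw [hint, hb, hG, show Real.pi * (s + 1) = Real.pi * s + Real.pi by ring, Real.sin_add_pi]
    have hsin : Real.sin (Real.pi * s) ≠ 0 := by
      have : Real.sin (Real.pi * s) < 0 :=
        Real.sin_neg_of_neg_of_neg_pi_lt (by nlinarith [Real.pi_pos]) (by nlinarith [Real.pi_pos])
      exact this.ne
    have := Real.pi_ne_zero
    simp only [Finset.range_zero, Finset.sum_empty, sub_zero]
    field_simp
  | succ N ih =>
    push_cast at h1 h2
    have hs0 : (0 : ℝ) < s := by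
      have : (0 : ℝ) ≤ N := by positivity
      linarith
    have ih := ih (s := s - 1) (by linarith) (by linarith)
    have hni : ∀ n : ℤ, s ≠ n := by
      rintro n rfl
      have h3 : (N : ℤ) < n := by exact_mod_cast (by linarith : (N : ℝ) < n)
      have h4 : n < N + 1 := by exact_mod_cast h2
      omega
    have hb := beta_integral_Ioi (a := s) (c := N + 1) hs0 h2 one_pos
    rw [Real.one_rpow, mul_one] at hb
    have hrec : ∫ v in Set.Ioi (0 : ℝ), v ^ s * geomRemainder (N + 1) v X =
        -(1 + X) * (∫ v in Set.Ioi (0 : ℝ), v ^ (s - 1) * geomRemainder N v X) -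
          (-X) ^ N * (Real.Gamma s * Real.Gamma (N + 1 - s) / Real.Gamma (N + 1)) := by
      rw [← hb.2, ← integral_const_mul, ← integral_const_mul, ← integral_sub
        ((integrableOn_rpow_mul_geomRemainder (by linarith) (by linarith) hX).const_mul _)
        (hb.1.const_mul _)]
      refine setIntegral_congr_fun measurableSet_Ioi fun v hv => ?_
      have hv : 0 < v := hv
      rw [Real.rpow_neg (by positivity : (0 : ℝ) ≤ 1 + v),
        show ((N : ℝ) + 1) = ((N + 1 : ℕ) : ℝ) by push_cast; rfl, Real.rpow_natCast]
      have h5 := mul_geomRemainder_succ hv.le hX N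
      have h6 : v ^ s = v ^ (s - 1) * v := by
        rw [← Real.rpow_add_one hv.ne', sub_add_cancel]
      rw [h6, mul_assoc, h5]
      ring
    have hsin : Real.sin (Real.pi * s) = -Real.sin (Real.pi * (s - 1)) := by
      rw [mul_sub, mul_one, Real.sin_sub_pi, neg_neg]
    have hg := sin_mul_Gamma_mul_Gamma hni N
    have hpow : (1 + X) ^ s = (1 + X) * (1 + X) ^ (s - 1) := by
      rw [mul_comm, ← Real.rpow_add_one hX1.ne', sub_add_cancel]
    have hsgn : (-X) ^ N * ((-1) ^ N * Ring.choose (s - 1) N) = Ring.choose (s - 1) N * X ^ N := by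
      rw [neg_pow, mul_mul_mul_comm, mul_comm ((-1 : ℝ) ^ N), mul_assoc, mul_left_comm,
        ← mul_assoc, ← mul_assoc]
      rw [mul_assoc ((-1 : ℝ) ^ N)]
      have : ((-1 : ℝ) ^ N) * (-1) ^ N = 1 := by rw [← mul_pow]; simp
      linear_combination (X ^ N * Ring.choose (s - 1) N) * this
    rw [hrec, sum_choose_succ, hpow]
    rw [hsin] at hg ⊢
    linear_combination (1 + X) * ih - (-X) ^ N * hg - hsgn

/-- The energy of order `s`, evaluated on `τ ↦ τ / (τ² + ξ²)`, in the variable `v = τ² - 1`. -/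
lemma sin_mul_integral_geomRemainder {s X : ℝ} (hs : -1 < s) (hX : 0 ≤ X) :
    Real.sin (Real.pi * s) / Real.pi *
        (∫ v in Set.Ioi (0 : ℝ), v ^ s * geomRemainder ⌊s + 1⌋₊ v X) +
      ∑ j ∈ Finset.range ⌊s + 1⌋₊, Ring.choose s j * X ^ j = (1 + X) ^ s := by
  have h1 := Nat.floor_le (by linarith : 0 ≤ s + 1)
  have h2 := Nat.lt_floor_add_one (s + 1)
  rcases h1.lt_or_eq with h | h
  · rw [sin_mul_integral_geomRemainder_of_lt hX (by linarith) (by linarith)]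
    ring
  -- For integer s the sine kills the integral, and the sum over j ≤ s is the full binomial
  -- expansion.
  · have hpos : ⌊s + 1⌋₊ ≠ 0 := by
      intro h0
      rw [h0, Nat.cast_zero] at h
      linarith
    obtain ⟨n, hn⟩ := Nat.exists_eq_succ_of_ne_zero hpos
    rw [hn] at h ⊢
    have hsn : s = n := by push_cast at h; linarith
    subst hsn
    rw [mul_comm Real.pi, Real.sin_nat_mul_pi, zero_div, zero_mul, zero_add, Real.rpow_natCast,
      add_comm 1 X, add_pow]
    refine Finset.sum_congr rfl fun j _ => ?_
    rw [Ring.choose_natCast, one_pow, mul_one, mul_comm]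

/-! ### The energy as a linear functional of G, and its expansion in ε -/

lemma image_sq_sub_one : (fun τ : ℝ => τ ^ 2 - 1) '' Set.Ioi 1 = Set.Ioi 0 := by
  ext v
  constructor
  · rintro ⟨τ, hτ, rfl⟩
    have hτ : 1 < τ := hτ
    exact show (0 : ℝ) < τ ^ 2 - 1 by nlinarith
  · intro hv
    have hv : 0 < v := hv
    refine ⟨Real.sqrt (1 + v), ?_, ?_⟩
    · exact Real.lt_sqrt_of_sq_lt (by linarith)
    · simp only
      rw [Real.sq_sqrt (by linarith)]
      ring

lemma injOn_sq_sub_one : Set.InjOn (fun τ : ℝ => τ ^ 2 - 1) (Set.Ioi 1) := by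
  intro a ha b hb h
  have ha : 1 < a := ha
  have hb : 1 < b := hb
  simp only at h
  nlinarith

lemma hasDerivWithinAt_sq_sub_one (τ : ℝ) (t : Set ℝ) :
    HasDerivWithinAt (fun τ : ℝ => τ ^ 2 - 1) (2 * τ) t τ := by
  simpa using ((hasDerivAt_pow 2 τ).sub_const 1).hasDerivWithinAt

lemma integral_sq_sub_one (g : ℝ → ℝ) :
    ∫ v in Set.Ioi (0 : ℝ), g v = ∫ τ in Set.Ioi (1 : ℝ), 2 * τ * g (τ ^ 2 - 1) := by
  rw [← image_sq_sub_one, integral_image_eq_integral_abs_deriv_smul measurableSet_Ioi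
    (fun τ _ => hasDerivWithinAt_sq_sub_one τ _) injOn_sq_sub_one]
  refine setIntegral_congr_fun measurableSet_Ioi fun τ hτ => ?_
  have hτ : 1 < τ := hτ
  simp only [smul_eq_mul]
  rw [abs_of_pos (by linarith)]

lemma integrableOn_sq_sub_one {g : ℝ → ℝ} (hg : IntegrableOn g (Set.Ioi 0)) :
    IntegrableOn (fun τ : ℝ => 2 * τ * g (τ ^ 2 - 1)) (Set.Ioi 1) := by
  rw [← image_sq_sub_one, integrableOn_image_iff_integrableOn_abs_deriv_smul measurableSet_Ioi
    (fun τ _ => hasDerivWithinAt_sq_sub_one τ _) injOn_sq_sub_one] at hg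
  refine hg.congr_fun (fun τ hτ => ?_) measurableSet_Ioi
  have hτ : 1 < τ := hτ
  simp only [smul_eq_mul]
  rw [abs_of_pos (by linarith)]

/-- Under v = τ² - 1 this is a Beta integrand: s > -1 is integrability at τ = 1 and s < M is
integrability at infinity. It dominates every energy integrand below. -/
lemma integrableOn_energy_weight {s : ℝ} {M : ℕ} (hs : -1 < s) (hsM : s < M) :
    IntegrableOn (fun τ : ℝ => (τ ^ 2 - 1) ^ s / τ ^ (2 * M + 1)) (Set.Ioi 1) := by
  have h := (integrableOn_sq_sub_one (integrableOn_rpow_div (c := M + 1) hs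
    (by linarith))).const_mul (1 / 2)
  refine IntegrableOn.congr_fun h (fun τ hτ => ?_) measurableSet_Ioi
  have hτ : 1 < τ := hτ
  have hτ0 : τ ≠ 0 := by positivity
  rw [add_sub_cancel, Real.rpow_neg (by positivity),
    show ((M : ℝ) + 1) = ((M + 1 : ℕ) : ℝ) by push_cast; rfl, Real.rpow_natCast, ← pow_mul]
  field_simp
  ring

lemma HasOddExpansion.nonneg {M : ℕ} {h : ℝ → ℝ} {η : ℕ → ℝ} {C : ℝ}
    (hC : ∀ τ, 1 ≤ τ →
      |h τ - ∑ j ∈ Finset.range M, (-1) ^ j * η j / τ ^ (2 * j + 1)| ≤ C / τ ^ (2 * M + 1)) :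
    0 ≤ C := by
  simpa using (abs_nonneg _).trans (hC 1 le_rfl)

lemma HasOddExpansion.of_succ {M : ℕ} {h : ℝ → ℝ} {η : ℕ → ℝ}
    (hh : HasOddExpansion (M + 1) h η) : HasOddExpansion M h η := by
  obtain ⟨C, hC⟩ := hh
  have hC0 := HasOddExpansion.nonneg hC
  refine ⟨C + |η M|, fun τ hτ => ?_⟩
  have hτ0 : 0 < τ := by linarith
  have h1 := hC τ hτ
  rw [Finset.sum_range_succ] at h1
  have h2 : |(-1) ^ M * η M / τ ^ (2 * M + 1)| = |η M| / τ ^ (2 * M + 1) := by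
    rw [abs_div, abs_mul, abs_pow, abs_neg, abs_one, one_pow, one_mul,
      abs_of_pos (pow_pos hτ0 _)]
  have h3 : C / τ ^ (2 * (M + 1) + 1) ≤ C / τ ^ (2 * M + 1) := by
    refine div_le_div_of_nonneg_left hC0 (by positivity) (pow_le_pow_right₀ hτ (by omega))
  rw [add_div, ← h2]
  have h4 := abs_add_le (h τ - (∑ j ∈ Finset.range M, (-1) ^ j * η j / τ ^ (2 * j + 1) +
    (-1) ^ M * η M / τ ^ (2 * M + 1))) ((-1) ^ M * η M / τ ^ (2 * M + 1))
  rw [show h τ - (∑ j ∈ Finset.range M, (-1) ^ j * η j / τ ^ (2 * j + 1) +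
    (-1) ^ M * η M / τ ^ (2 * M + 1)) + (-1) ^ M * η M / τ ^ (2 * M + 1) =
    h τ - ∑ j ∈ Finset.range M, (-1) ^ j * η j / τ ^ (2 * j + 1) by ring] at h4
  linarith

lemma HasOddExpansion.mono {M N : ℕ} {h : ℝ → ℝ} {η : ℕ → ℝ} (hNM : N ≤ M)
    (hh : HasOddExpansion M h η) : HasOddExpansion N h η := by
  induction M, hNM using Nat.le_induction with
  | base => exact hh
  | succ M _ ih => exact ih hh.of_succ

/-- Once the lower coefficients are identified, the expansion to order n + 1 shows that the
expression whose limit defines the next one differs from `η n` by at most Cτ⁻². -/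
lemma HasOddExpansion.evenCoeff_eq {M : ℕ} {h : ℝ → ℝ} {η : ℕ → ℝ}
    (hh : HasOddExpansion M h η) {n : ℕ} (hn : n < M) : evenCoeff h n = η n := by
  induction n using Nat.strong_induction_on with
  | _ n ih =>
    rw [evenCoeff]
    refine Tendsto.limUnder_eq ?_
    obtain ⟨C, hC⟩ := hh.mono (Nat.succ_le_of_lt hn)
    have hsum : ∀ τ : ℝ, ∑ j : Fin n, (-1) ^ (j : ℕ) * evenCoeff h j / τ ^ (2 * (j : ℕ) + 1) =
        ∑ j ∈ Finset.range n, (-1) ^ j * η j / τ ^ (2 * j + 1) := by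
      intro τ
      rw [Finset.sum_range]
      exact Finset.sum_congr rfl fun j _ => by rw [ih j j.isLt (j.isLt.trans hn)]
    simp_rw [hsum]
    rw [tendsto_iff_norm_sub_tendsto_zero]
    have hlim : Tendsto (fun τ : ℝ => C * (τ ^ 2)⁻¹) atTop (𝓝 0) := by
      simpa using (tendsto_inv_atTop_zero.comp
        (tendsto_pow_atTop (α := ℝ) two_ne_zero)).const_mul C
    refine squeeze_zero' (Eventually.of_forall fun _ => norm_nonneg _) ?_ hlim
    filter_upwards [eventually_ge_atTop 1] with τ hτ
    have hτ0 : 0 < τ := by linarith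
    have h1 := hC τ hτ
    rw [Finset.sum_range_succ] at h1
    have h2 : (-1) ^ n * τ ^ (2 * n + 1) *
        (h τ - ∑ j ∈ Finset.range n, (-1) ^ j * η j / τ ^ (2 * j + 1)) - η n =
        (-1) ^ n * τ ^ (2 * n + 1) *
        (h τ - (∑ j ∈ Finset.range n, (-1) ^ j * η j / τ ^ (2 * j + 1) +
          (-1) ^ n * η n / τ ^ (2 * n + 1))) := by
      have h3 : ((-1 : ℝ) ^ n) * (-1) ^ n = 1 := by rw [← mul_pow]; simp
      have h4 : τ ^ (2 * n + 1) ≠ 0 := by positivity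
      field_simp
      linear_combination (η n) * h3
    rw [h2, Real.norm_eq_abs, abs_mul, abs_mul, abs_pow, abs_neg, abs_one, one_pow, one_mul,
      abs_of_pos (pow_pos hτ0 _)]
    calc _ ≤ τ ^ (2 * n + 1) * (C / τ ^ (2 * (n + 1) + 1)) := by gcongr
      _ = C * (τ ^ 2)⁻¹ := by field_simp; ring

/-- The linear functional `h ↦ E_s` of a function `h` in the place of `logTransmission κ u`. -/
def energyFunctional (s : ℝ) (h : ℝ → ℝ) : ℝ :=
  2 * Real.sin (Real.pi * s) / Real.pi *
      (∫ τ in Set.Ioi (1 : ℝ), (τ ^ 2 - 1) ^ s *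
        (-h τ + ∑ j ∈ Finset.range ⌊s + 1⌋₊, (-1) ^ j * evenCoeff h j / τ ^ (2 * j + 1))) +
    ∑ j ∈ Finset.range ⌊s + 1⌋₊, Ring.choose s j * evenCoeff h j

/-- Limits chosen by `limUnder` obey no algebra until they are known to exist; any exhibited
expansion replaces them by explicit numbers, after which the expression is visibly linear. -/
lemma energyFunctional_eq {s : ℝ} {h : ℝ → ℝ} {η : ℕ → ℝ}
    (hh : HasOddExpansion ⌊s + 1⌋₊ h η) :
    energyFunctional s h = 2 * Real.sin (Real.pi * s) / Real.pi *
      (∫ τ in Set.Ioi (1 : ℝ), (τ ^ 2 - 1) ^ s *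
        (-h τ + ∑ j ∈ Finset.range ⌊s + 1⌋₊, (-1) ^ j * η j / τ ^ (2 * j + 1))) +
    ∑ j ∈ Finset.range ⌊s + 1⌋₊, Ring.choose s j * η j := by
  have h1 : ∀ τ : ℝ, ∑ j ∈ Finset.range ⌊s + 1⌋₊, (-1) ^ j * evenCoeff h j / τ ^ (2 * j + 1) =
      ∑ j ∈ Finset.range ⌊s + 1⌋₊, (-1) ^ j * η j / τ ^ (2 * j + 1) := fun τ =>
    Finset.sum_congr rfl fun j hj => by rw [hh.evenCoeff_eq (Finset.mem_range.1 hj)]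
  have h2 : ∑ j ∈ Finset.range ⌊s + 1⌋₊, Ring.choose s j * evenCoeff h j =
      ∑ j ∈ Finset.range ⌊s + 1⌋₊, Ring.choose s j * η j :=
    Finset.sum_congr rfl fun j hj => by rw [hh.evenCoeff_eq (Finset.mem_range.1 hj)]
  simp only [energyFunctional, h1, h2]

lemma measurable_energy_integrand {s : ℝ} {h : ℝ → ℝ} (hm : Measurable h) (η : ℕ → ℝ) (M : ℕ) :
    Measurable fun τ : ℝ => (τ ^ 2 - 1) ^ s *
      (-h τ + ∑ j ∈ Finset.range M, (-1) ^ j * η j / τ ^ (2 * j + 1)) := by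
  have h1 : Measurable fun τ : ℝ => (τ ^ 2 - 1) ^ s :=
    Measurable.pow_const (by fun_prop) _
  fun_prop

lemma norm_energy_integrand_le {s τ D : ℝ} {M : ℕ} {h : ℝ → ℝ} {η : ℕ → ℝ} (hτ : 1 ≤ τ)
    (hD : |h τ - ∑ j ∈ Finset.range M, (-1) ^ j * η j / τ ^ (2 * j + 1)| ≤ D / τ ^ (2 * M + 1)) :
    ‖(τ ^ 2 - 1) ^ s * (-h τ + ∑ j ∈ Finset.range M, (-1) ^ j * η j / τ ^ (2 * j + 1))‖ ≤
      D * ((τ ^ 2 - 1) ^ s / τ ^ (2 * M + 1)) := by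
  have h0 : 0 ≤ (τ ^ 2 - 1) ^ s := Real.rpow_nonneg (by nlinarith) _
  rw [norm_mul, Real.norm_of_nonneg h0, Real.norm_eq_abs, ← abs_neg, neg_add, neg_neg,
    ← sub_eq_add_neg]
  calc _ ≤ (τ ^ 2 - 1) ^ s * (D / τ ^ (2 * M + 1)) := by gcongr
    _ = _ := by ring

/-- Summability of |y_k| D_k plays two roles. It bounds the summed remainders uniformly in τ, so G
itself has an odd expansion with coefficients H. It also dominates the series of energy integrands,
so sum and integral may be exchanged. -/
lemma hasSum_energyFunctional {s : ℝ} (hs : -1 < s) {G : ℝ → ℝ} {h : ℕ → ℝ → ℝ}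
    {η : ℕ → ℕ → ℝ} {D y H : ℕ → ℝ} (hm : ∀ k, Measurable (h k))
    (hG : ∀ τ, 1 ≤ τ → HasSum (fun k => y k * h k τ) (G τ))
    (hD : ∀ k τ, 1 ≤ τ →
      |h k τ - ∑ j ∈ Finset.range ⌊s + 1⌋₊, (-1) ^ j * η k j / τ ^ (2 * j + 1)| ≤
        D k / τ ^ (2 * ⌊s + 1⌋₊ + 1))
    (hH : ∀ j < ⌊s + 1⌋₊, HasSum (fun k => y k * η k j) (H j))
    (hsum : Summable fun k => |y k| * D k) :
    HasSum (fun k => y k * energyFunctional s (h k)) (energyFunctional s G) := by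
  have hsM : s < ⌊s + 1⌋₊ := by linarith [Nat.lt_floor_add_one (s + 1)]
  set M := ⌊s + 1⌋₊ with hM
  have hD0 : ∀ k, 0 ≤ D k := fun k => HasOddExpansion.nonneg (hD k)
  have hr : ∀ τ, 1 ≤ τ → HasSum
      (fun k => y k * (-h k τ + ∑ j ∈ Finset.range M, (-1) ^ j * η k j / τ ^ (2 * j + 1)))
      (-G τ + ∑ j ∈ Finset.range M, (-1) ^ j * H j / τ ^ (2 * j + 1)) := by
    intro τ hτ
    have h2 := hasSum_sum (s := Finset.range M)
      (f := fun j k => (-1) ^ j / τ ^ (2 * j + 1) * (y k * η k j)) fun j hj =>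
        (hH j (Finset.mem_range.1 hj)).mul_left ((-1) ^ j / τ ^ (2 * j + 1))
    have h3 := (hG τ hτ).neg.add h2
    have h4 : ∑ j ∈ Finset.range M, (-1) ^ j / τ ^ (2 * j + 1) * H j =
        ∑ j ∈ Finset.range M, (-1) ^ j * H j / τ ^ (2 * j + 1) :=
      Finset.sum_congr rfl fun j _ => by ring
    rw [h4] at h3
    refine h3.congr_fun fun k => ?_
    rw [mul_add, mul_neg, Finset.mul_sum]
    congr 1
    exact Finset.sum_congr rfl fun j _ => by ring
  have hGexp : HasOddExpansion M G H := by
    refine ⟨∑' k, |y k| * D k, fun τ hτ => ?_⟩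
    rw [← abs_neg, neg_sub, ← neg_add_eq_sub, ← Real.norm_eq_abs, ← (hr τ hτ).tsum_eq]
    refine tsum_of_norm_bounded (hsum.hasSum.div_const (τ ^ (2 * M + 1))) fun k => ?_
    rw [norm_mul, Real.norm_eq_abs, Real.norm_eq_abs, neg_add_eq_sub, abs_sub_comm, mul_div_assoc]
    exact mul_le_mul_of_nonneg_left (hD k τ hτ) (abs_nonneg _)
  rw [energyFunctional_eq hGexp]
  have hbd : ∀ k, ∀ᵐ τ ∂volume.restrict (Set.Ioi (1 : ℝ)), ‖y k * ((τ ^ 2 - 1) ^ s *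
      (-h k τ + ∑ j ∈ Finset.range M, (-1) ^ j * η k j / τ ^ (2 * j + 1)))‖ ≤
      (|y k| * D k) * ((τ ^ 2 - 1) ^ s / τ ^ (2 * M + 1)) := by
    intro k
    filter_upwards [ae_restrict_mem measurableSet_Ioi] with τ hτ
    rw [norm_mul, Real.norm_eq_abs, mul_assoc]
    exact mul_le_mul_of_nonneg_left (norm_energy_integrand_le (le_of_lt hτ)
      (hD k τ (le_of_lt hτ))) (abs_nonneg _)
  have hw := integrableOn_energy_weight hs hsM
  have hint : ∀ k, IntegrableOn (fun τ : ℝ => y k * ((τ ^ 2 - 1) ^ s *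
      (-h k τ + ∑ j ∈ Finset.range M, (-1) ^ j * η k j / τ ^ (2 * j + 1)))) (Set.Ioi 1) :=
    fun k => Integrable.mono' (hw.const_mul _)
      ((measurable_energy_integrand (hm k) (η k) M).const_mul _).aestronglyMeasurable (hbd k)
  have hI := hasSum_integral_of_summable_integral_norm hint (by
    refine Summable.of_nonneg_of_le (fun k => integral_nonneg fun _ => norm_nonneg _)
      (fun k => ?_) (hsum.mul_right (∫ τ in Set.Ioi (1 : ℝ), (τ ^ 2 - 1) ^ s / τ ^ (2 * M + 1)))
    rw [← integral_const_mul]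
    exact integral_mono_ae (hint k).norm (hw.const_mul _) (hbd k))
  have hI2 : ∫ τ in Set.Ioi (1 : ℝ), ∑' k, y k * ((τ ^ 2 - 1) ^ s *
      (-h k τ + ∑ j ∈ Finset.range M, (-1) ^ j * η k j / τ ^ (2 * j + 1))) =
      ∫ τ in Set.Ioi (1 : ℝ), (τ ^ 2 - 1) ^ s *
      (-G τ + ∑ j ∈ Finset.range M, (-1) ^ j * H j / τ ^ (2 * j + 1)) := by
    refine setIntegral_congr_fun measurableSet_Ioi fun τ hτ => ?_
    rw [← (hr τ (le_of_lt hτ)).tsum_eq, ← tsum_mul_left]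
    exact tsum_congr fun k => by ring
  rw [hI2] at hI
  have hC := hasSum_sum (s := Finset.range M)
    (f := fun j k => Ring.choose s j * (y k * η k j)) fun j hj =>
      (hH j (Finset.mem_range.1 hj)).mul_left (Ring.choose s j)
  refine ((hI.mul_left (2 * Real.sin (Real.pi * s) / Real.pi)).add hC).congr_fun fun k => ?_
  rw [energyFunctional_eq ⟨D k, hD k⟩, integral_const_mul, mul_add, Finset.mul_sum]
  congr 1
  · ring
  · exact Finset.sum_congr rfl fun j _ => by ring

/-- The asymptotic expansions provide no control of the constants in k, but they are needed only for
k < M. For k ≥ M the coefficient is already O(τ^{-2k-1}), so it counts entirely as remainder, with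
explicit constants growing like Catalan numbers. -/
lemma exists_logTransmissionCoeff_bounds {κ B : ℝ} (hκ : |κ| = 1) (u : 𝓢(ℝ, ℂ)) (M : ℕ)
    (hB : ∀ x, ‖u x‖ ≤ B * (1 + x ^ 2)⁻¹) : ∃ (η : ℕ → ℕ → ℝ) (D : ℕ → ℝ),
    (∀ k τ, 1 ≤ τ → |logTransmissionCoeff κ u k τ -
      ∑ j ∈ Finset.range M, (-1) ^ j * η k j / τ ^ (2 * j + 1)| ≤ D k / τ ^ (2 * M + 1)) ∧
    (∀ k j, M ≤ k → η k j = 0) ∧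
    (∀ ε : ℝ, 8 * (6 * B * ε) ^ 2 ≤ 1 → Summable fun k : ℕ => |ε ^ (2 * k + 2)| * D k) := by
  have hB0 := nonneg_of_decay hB
  choose η C hC using fun k => exists_hasOddExpansion_logTransmissionCoeff hκ u k M
  refine ⟨fun k => if k < M then η k else 0, fun k => if k < M then C k else
    Real.pi * B * (6 * B) ^ (2 * k + 1) * catalan k, fun k τ hτ => ?_, fun k j hk => ?_,
    fun ε hε => ?_⟩
  · beta_reduce
    split_ifs with hk
    · exact hC k τ hτ
    · have hτ' : |τ| = τ := abs_of_nonneg (by linarith)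
      have h1 := norm_logCoeff_le (κ := κ) hκ hB (by rwa [hτ'] : 1 ≤ |τ|) k
      have h2 : ∑ j ∈ Finset.range M, (-1 : ℝ) ^ j * (0 : ℕ → ℝ) j / τ ^ (2 * j + 1) = 0 := by simp
      rw [h2, sub_zero, logTransmissionCoeff, abs_mul, hκ, one_mul]
      refine (Complex.abs_re_le_norm _).trans (h1.trans ?_)
      rw [hτ', div_pow, mul_div_assoc', div_mul_eq_mul_div]
      refine div_le_div_of_nonneg_left (by positivity) (by positivity)
        (pow_le_pow_right₀ hτ (by omega))
  · simp [not_lt.2 hk]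
  · rw [← summable_nat_add_iff M]
    refine Summable.of_nonneg_of_le (fun k => ?_) (fun k => ?_)
      ((summable_nat_add_iff M).2 (summable_geometric_two.mul_left
        (Real.pi * B * (6 * B) * |ε| ^ 2)))
    · simp only [not_lt.2 (Nat.le_add_left M k), if_false]
      positivity
    · simp only [not_lt.2 (Nat.le_add_left M k), if_false]
      have := pow_mul_catalan_le (by positivity) le_rfl hε (k + M)
      calc |ε ^ (2 * (k + M) + 2)| * (Real.pi * B * (6 * B) ^ (2 * (k + M) + 1) *
            catalan (k + M)) = (Real.pi * B * (6 * B) * |ε| ^ 2) * (|ε| ^ (2 * (k + M)) *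
              ((6 * B) ^ (2 * (k + M)) * catalan (k + M))) := by
            rw [abs_pow]; ring
        _ ≤ _ := by gcongr

lemma measurable_logTransmissionCoeff (κ : ℝ) (u : 𝓢(ℝ, ℂ)) (k : ℕ) :
    Measurable (logTransmissionCoeff κ u k) := by
  unfold logTransmissionCoeff
  exact (Complex.measurable_re.comp
    (stronglyMeasurable_logCoeff u.continuous k).measurable).const_mul κ

/-- The expansion of `E_s(ε u)` in powers of `ε`. -/
lemma exists_hasSum_energy {s κ : ℝ} (hs : -1 < s) (hκ : |κ| = 1) (u : 𝓢(ℝ, ℂ)) :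
    ∃ δ > 0, ∀ ε : ℝ, |ε| < δ →
      HasSum (fun k : ℕ => ε ^ (2 * k + 2) * energyFunctional s (logTransmissionCoeff κ u k))
        (energy s κ (ε • u)) := by
  obtain ⟨B, hB⟩ := schwartz_decay u
  obtain ⟨δ, hδ, hsmall⟩ := exists_pos_small B
  obtain ⟨η, D, hD, hη, hsum⟩ := exists_logTransmissionCoeff_bounds hκ u ⌊s + 1⌋₊ hB
  refine ⟨δ, hδ, fun ε hε => ?_⟩
  have hcoe : ⇑(ε • u) = fun x => (ε : ℂ) * u x := funext fun x => by simp
  have h1 : energy s κ (ε • u) = energyFunctional s (logTransmission κ fun x => ε * u x) := by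
    rw [energy, energyFunctional, hcoe]
  rw [h1]
  -- The coefficients of the sum are finite sums, since the terms with k ≥ ⌊s + 1⌋ have zero
  -- coefficients at these orders.
  refine hasSum_energyFunctional hs (H := fun j => ∑ k ∈ Finset.range ⌊s + 1⌋₊,
    ε ^ (2 * k + 2) * η k j) (measurable_logTransmissionCoeff κ u) (fun τ hτ =>
      hasSum_logTransmission (schwartz_c1Decay u) hκ hB hτ (hsmall ε hε)) hD (fun j _ => ?_)
      (hsum ε (hsmall ε hε))
  refine hasSum_sum_of_ne_finset_zero fun k hk => ?_
  rw [hη k j (by simpa using hk), mul_zero]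

/-! ### The unitary Fourier transform and quadrilinear Parseval identities -/

/-- The normalisation constant `(2π)^{-1/2}` of the Fourier transform. -/
def fourierConst : ℝ := (Real.sqrt (2 * Real.pi))⁻¹

lemma fourierConst_sq : fourierConst * fourierConst = 1 / (2 * Real.pi) := by
  rw [fourierConst, ← mul_inv, Real.mul_self_sqrt (by positivity), one_div]

lemma fourierConst_pos : 0 < fourierConst := by
  unfold fourierConst; positivity

lemma fourierU_eq (f : ℝ → ℂ) (ξ : ℝ) :
    fourierU f ξ = fourierConst * ∫ x : ℝ, f x * Complex.exp (-(Complex.I * x * ξ)) := by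
  rw [fourierU, fourierConst, Complex.ofReal_inv]

/-- The inverse of the unitary Fourier transform. -/
def invFourierU (A : ℝ → ℂ) (x : ℝ) : ℂ :=
  fourierConst * ∫ ξ : ℝ, A ξ * Complex.exp (Complex.I * x * ξ)

lemma fourierU_eq_fourier (f : ℝ → ℂ) (ξ : ℝ) :
    fourierU f ξ = fourierConst * FourierTransform.fourier f (ξ * (2 * Real.pi)⁻¹) := by
  rw [fourierU_eq, Real.fourier_real_eq_integral_exp_smul]
  congr 1
  refine integral_congr_ae (Eventually.of_forall fun x => ?_)
  simp only [smul_eq_mul]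
  rw [mul_comm]
  congr 2
  push_cast
  have : (Real.pi : ℂ) ≠ 0 := by exact_mod_cast Real.pi_ne_zero
  field_simp

/-- The unitary Fourier transform of a Schwartz function, as a Schwartz function. -/
def fourierSchwartz (u : 𝓢(ℝ, ℂ)) : 𝓢(ℝ, ℂ) :=
  fourierConst • SchwartzMap.compCLMOfContinuousLinearEquiv ℝ
    (ContinuousLinearEquiv.unitsEquivAut ℝ
      (Units.mk0 (2 * Real.pi)⁻¹ (inv_ne_zero Real.two_pi_pos.ne')))
    (FourierTransform.fourier u)

lemma coe_fourierSchwartz (u : 𝓢(ℝ, ℂ)) : ⇑(fourierSchwartz u) = fourierU u := by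
  funext ξ
  rw [fourierU_eq_fourier, fourierSchwartz, smul_apply, Complex.real_smul,
    SchwartzMap.compCLMOfContinuousLinearEquiv_apply, Function.comp_apply, SchwartzMap.fourier_coe,
    ContinuousLinearEquiv.unitsEquivAut_apply, Units.val_mk0]

/-- Fourier inversion in the normalization e^{2πivx}, rescaled by ξ = 2πv; the Jacobian (2π)⁻¹ is
split between the two unitary constants. -/
lemma invFourierU_fourierU (u : 𝓢(ℝ, ℂ)) (x : ℝ) : invFourierU (fourierU u) x = u x := by
  have h1 : u = FourierTransformInv.fourierInv (FourierTransform.fourier u) := by simp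
  have h2 : u x = ∫ v : ℝ, Complex.exp (((2 * Real.pi * v * x : ℝ) : ℂ) * Complex.I) •
      (FourierTransform.fourier (u : ℝ → ℂ)) v := by
    conv_lhs => rw [h1]
    rw [SchwartzMap.fourierInv_coe, SchwartzMap.fourier_coe, Real.fourierInv_eq']
    refine integral_congr_ae (Eventually.of_forall fun v => ?_)
    simp only [RCLike.inner_apply, conj_trivial]
    congr 4
    ring
  rw [h2, invFourierU]
  have h3 := Measure.integral_comp_mul_right (fun v : ℝ =>
    Complex.exp (((2 * Real.pi * v * x : ℝ) : ℂ) * Complex.I) •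
      (FourierTransform.fourier (u : ℝ → ℂ)) v) (2 * Real.pi)⁻¹
  rw [inv_inv, abs_of_pos Real.two_pi_pos] at h3
  have h4 : (∫ v : ℝ, Complex.exp (((2 * Real.pi * v * x : ℝ) : ℂ) * Complex.I) •
      (FourierTransform.fourier (u : ℝ → ℂ)) v) = ((2 * Real.pi)⁻¹ : ℝ) •
      ∫ ξ : ℝ, Complex.exp (((2 * Real.pi * (ξ * (2 * Real.pi)⁻¹) * x : ℝ) : ℂ) * Complex.I) •
      (FourierTransform.fourier (u : ℝ → ℂ)) (ξ * (2 * Real.pi)⁻¹) := by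
    rw [h3, smul_smul, inv_mul_cancel₀ Real.two_pi_pos.ne', one_smul]
  have h5 : ((2 * Real.pi)⁻¹ : ℝ) = fourierConst * fourierConst := by
    rw [fourierConst_sq, one_div]
  have h6 : (∫ ξ : ℝ, fourierU u ξ * Complex.exp (Complex.I * x * ξ)) = fourierConst *
      ∫ ξ : ℝ, Complex.exp (((2 * Real.pi * (ξ * (2 * Real.pi)⁻¹) * x : ℝ) : ℂ) * Complex.I) •
      (FourierTransform.fourier (u : ℝ → ℂ)) (ξ * (2 * Real.pi)⁻¹) := by
    rw [← integral_const_mul]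
    refine integral_congr_ae (Eventually.of_forall fun ξ => ?_)
    simp only [fourierU_eq_fourier, smul_eq_mul]
    have he : Complex.exp (((2 * Real.pi * (ξ * (2 * Real.pi)⁻¹) * x : ℝ) : ℂ) * Complex.I) =
        Complex.exp (Complex.I * x * ξ) := by
      congr 1
      push_cast
      have : (Real.pi : ℂ) ≠ 0 := by exact_mod_cast Real.pi_ne_zero
      field_simp
    rw [he]
    ring
  rw [h4, h6, Complex.real_smul, h5, Complex.ofReal_mul, mul_assoc]

lemma norm_exp_I_mul (x y : ℝ) : ‖Complex.exp (Complex.I * x * y)‖ = 1 := by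
  rw [Complex.norm_exp]
  simp

lemma norm_exp_neg_I_mul (x y : ℝ) : ‖Complex.exp (-(Complex.I * x * y))‖ = 1 := by
  rw [Complex.norm_exp]
  simp

lemma conj_exp_I_mul (x y : ℝ) :
    conj (Complex.exp (Complex.I * x * y)) = Complex.exp (-(Complex.I * x * y)) := by
  rw [← Complex.exp_conj]
  simp

lemma norm_invFourierU_le (A : ℝ → ℂ) (x : ℝ) :
    ‖invFourierU A x‖ ≤ fourierConst * ∫ ξ, ‖A ξ‖ := by
  rw [invFourierU, norm_mul, Complex.norm_real, Real.norm_of_nonneg fourierConst_pos.le]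
  refine mul_le_mul_of_nonneg_left ((norm_integral_le_integral_norm _).trans (le_of_eq ?_))
    fourierConst_pos.le
  simp [norm_exp_I_mul]

lemma norm_fourierU_le (A : ℝ → ℂ) (x : ℝ) :
    ‖fourierU A x‖ ≤ fourierConst * ∫ ξ, ‖A ξ‖ := by
  rw [fourierU_eq, norm_mul, Complex.norm_real, Real.norm_of_nonneg fourierConst_pos.le]
  refine mul_le_mul_of_nonneg_left ((norm_integral_le_integral_norm _).trans (le_of_eq ?_))
    fourierConst_pos.le
  simp [norm_exp_neg_I_mul]

lemma continuous_invFourierU {A : ℝ → ℂ} (hA : Integrable A) : Continuous (invFourierU A) := by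
  refine continuous_const.mul (continuous_of_dominated (bound := fun ξ => ‖A ξ‖)
    (fun x => hA.aestronglyMeasurable.mul (Continuous.aestronglyMeasurable (by fun_prop)))
    (fun x => Eventually.of_forall fun ξ => ?_) hA.norm
    (Eventually.of_forall fun ξ => by fun_prop))
  simp [norm_exp_I_mul]

lemma continuous_fourierU {A : ℝ → ℂ} (hA : Integrable A) : Continuous (fourierU A) := by
  rw [show fourierU A = fun ξ : ℝ => (fourierConst : ℂ) * ∫ x : ℝ, A x * Complex.exp (-(Complex.I * x * ξ))
    from funext (fourierU_eq A)]
  refine continuous_const.mul (continuous_of_dominated (bound := fun ξ => ‖A ξ‖)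
    (fun x => hA.aestronglyMeasurable.mul (Continuous.aestronglyMeasurable (by fun_prop)))
    (fun x => Eventually.of_forall fun ξ => ?_) hA.norm
    (Eventually.of_forall fun ξ => by fun_prop))
  simp [norm_exp_neg_I_mul]

lemma Integrable.mul_of_norm_le_one {α : Type*} [MeasurableSpace α] {μ : Measure α} {f g : α → ℂ}
    (hf : Integrable f μ) (hg : AEStronglyMeasurable g μ) (h : ∀ x, ‖g x‖ ≤ 1) :
    Integrable (fun x => f x * g x) μ :=
  hf.mul_bdd (c := 1) hg (Eventually.of_forall h)

lemma integrable_conj {f : ℝ → ℂ} (hf : Integrable f) : Integrable fun x => conj (f x) :=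
  Complex.conjCLE.toContinuousLinearMap.integrable_comp hf

lemma integral_conj_mul_fourierU {C m : ℝ → ℂ} (hC : Integrable C) (hm : Integrable m) :
    ∫ ξ, conj (C ξ) * fourierU m ξ = ∫ x, conj (invFourierU C x) * m x := by
  have hC' : Integrable fun ξ => conj (C ξ) := integrable_conj hC
  have hint : Integrable (Function.uncurry fun ξ x : ℝ =>
      conj (C ξ) * m x * Complex.exp (-(Complex.I * x * ξ))) (volume.prod volume) :=
    Integrable.mul_of_norm_le_one (hC'.mul_prod hm)
      (Continuous.aestronglyMeasurable (by fun_prop)) (fun p => (norm_exp_neg_I_mul _ _).le)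
  have h1 : ∀ ξ, conj (C ξ) * fourierU m ξ = fourierConst * ∫ x : ℝ,
      conj (C ξ) * m x * Complex.exp (-(Complex.I * x * ξ)) := by
    intro ξ
    rw [fourierU_eq, mul_left_comm, ← integral_const_mul]
    congr 1
    exact integral_congr_ae (Eventually.of_forall fun x => by ring)
  have h2 : ∀ x, conj (invFourierU C x) * m x = fourierConst * ∫ ξ : ℝ,
      conj (C ξ) * m x * Complex.exp (-(Complex.I * x * ξ)) := by
    intro x
    rw [invFourierU, map_mul, Complex.conj_ofReal, ← integral_conj, mul_assoc,
      ← integral_mul_const]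
    congr 1
    refine integral_congr_ae (Eventually.of_forall fun ξ => ?_)
    simp only [map_mul, conj_exp_I_mul]
    ring
  simp_rw [h1, h2]
  rw [integral_const_mul, integral_const_mul, integral_integral_swap hint]

/-- Fubini. Evaluating the transform of m at η₁ + η₂ - ξ builds in the constraint ξ₁ + ξ₂ = η₁ + η₂,
so no measure on a hyperplane is needed. -/
lemma fourierU_mul_mul_conj {A B m : ℝ → ℂ} (hA : Integrable A) (hB : Integrable B)
    (hm : Integrable m) (ξ : ℝ) :
    fourierU (fun x => invFourierU A x * invFourierU B x * conj (m x)) ξ =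
      (1 / (2 * Real.pi) : ℝ) *
        ∫ q : ℝ × ℝ, A q.1 * B q.2 * conj (fourierU m (q.1 + q.2 - ξ)) := by
  have hm' : Integrable fun x => conj (m x) := integrable_conj hm
  have hint : Integrable (Function.uncurry fun (q : ℝ × ℝ) (x : ℝ) =>
      (A q.1 * B q.2) * conj (m x) * Complex.exp (Complex.I * x * (q.1 + q.2 - ξ : ℝ)))
      ((volume : Measure (ℝ × ℝ)).prod volume) :=
    Integrable.mul_of_norm_le_one ((hA.mul_prod hB).mul_prod hm')
      (Continuous.aestronglyMeasurable (by fun_prop)) (fun p => (norm_exp_I_mul _ _).le)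
  have h1 : ∀ q : ℝ × ℝ, A q.1 * B q.2 * conj (fourierU m (q.1 + q.2 - ξ)) =
      fourierConst * ∫ x : ℝ, (A q.1 * B q.2) * conj (m x) *
        Complex.exp (Complex.I * x * (q.1 + q.2 - ξ : ℝ)) := by
    intro q
    rw [fourierU_eq, map_mul, Complex.conj_ofReal, ← integral_conj, mul_left_comm,
      ← integral_const_mul]
    congr 1
    refine integral_congr_ae (Eventually.of_forall fun x => ?_)
    simp only [map_mul]
    rw [← conj_exp_I_mul, Complex.conj_conj]
    ring
  have h2 : ∀ x : ℝ, ∫ q : ℝ × ℝ, (A q.1 * B q.2) * conj (m x) *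
        Complex.exp (Complex.I * x * (q.1 + q.2 - ξ : ℝ)) =
      (∫ η, A η * Complex.exp (Complex.I * x * η)) * (∫ η, B η * Complex.exp (Complex.I * x * η)) *
        (conj (m x) * Complex.exp (-(Complex.I * x * ξ))) := by
    intro x
    rw [← integral_prod_mul, ← integral_mul_const]
    refine integral_congr_ae (Eventually.of_forall fun q => ?_)
    simp only
    rw [show Complex.I * x * ((q.1 + q.2 - ξ : ℝ) : ℂ) = Complex.I * x * q.1 + Complex.I * x * q.2 +
      -(Complex.I * x * ξ) by push_cast; ring, Complex.exp_add, Complex.exp_add]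
    ring
  simp_rw [h1]
  rw [integral_const_mul, integral_integral_swap hint]
  simp_rw [h2]
  rw [fourierU_eq, ← integral_const_mul, ← integral_const_mul, ← integral_const_mul,
    ← fourierConst_sq]
  refine integral_congr_ae (Eventually.of_forall fun x => ?_)
  simp only [invFourierU]
  push_cast
  ring

lemma integrable_quartic {A B C m : ℝ → ℂ} (hA : Integrable A) (hB : Integrable B)
    (hC : Integrable C) (hm : Integrable m) :
    Integrable fun p : ℝ × ℝ × ℝ => conj (C p.1) *
      (A p.2.1 * B p.2.2 * conj (fourierU m (p.2.1 + p.2.2 - p.1))) := by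
  have hC' : Integrable fun ξ => conj (C ξ) := integrable_conj hC
  have hc := continuous_fourierU hm
  have := (hC'.mul_prod (hA.mul_prod hB)).mul_bdd (c := fourierConst * ∫ ξ, ‖m ξ‖)
    (g := fun p : ℝ × ℝ × ℝ => conj (fourierU m (p.2.1 + p.2.2 - p.1)))
    (Continuous.aestronglyMeasurable (by fun_prop))
    (Eventually.of_forall fun p => by simpa using norm_fourierU_le m _)
  refine this.congr (Eventually.of_forall fun p => ?_)
  simp only
  ring

/-- The quadrilinear Parseval identity. -/
lemma integral_conj_mul_fourierU_mul {A B C m : ℝ → ℂ} (hA : Integrable A) (hB : Integrable B)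
    (hC : Integrable C) (hm : Integrable m) :
    ∫ ξ, conj (C ξ) * fourierU (fun x => invFourierU A x * invFourierU B x * conj (m x)) ξ =
      (1 / (2 * Real.pi) : ℝ) * ∫ p : ℝ × ℝ × ℝ, conj (C p.1) *
        (A p.2.1 * B p.2.2 * conj (fourierU m (p.2.1 + p.2.2 - p.1))) := by
  rw [Measure.volume_eq_prod, integral_prod _ (by
    rw [← Measure.volume_eq_prod]; exact integrable_quartic hA hB hC hm), ← integral_const_mul]
  refine integral_congr_ae (Eventually.of_forall fun ξ => ?_)
  simp only
  rw [fourierU_mul_mul_conj hA hB hm, integral_const_mul]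
  ring

lemma integral_conj_invFourierU_mul {A B C m : ℝ → ℂ} (hA : Integrable A) (hB : Integrable B)
    (hC : Integrable C) (hm : Integrable m) :
    ∫ x, conj (invFourierU C x) * (invFourierU A x * invFourierU B x * conj (m x)) =
      (1 / (2 * Real.pi) : ℝ) * ∫ p : ℝ × ℝ × ℝ, conj (C p.1) *
        (A p.2.1 * B p.2.2 * conj (fourierU m (p.2.1 + p.2.2 - p.1))) := by
  rw [← integral_conj_mul_fourierU_mul hA hB hC hm, integral_conj_mul_fourierU hC]
  have hcA := continuous_invFourierU hA
  have hcB := continuous_invFourierU hB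
  have hm' : Integrable fun x => conj (m x) := integrable_conj hm
  refine hm'.bdd_mul (c := (fourierConst * ∫ ξ, ‖A ξ‖) * (fourierConst * ∫ ξ, ‖B ξ‖))
    (hcA.mul hcB).aestronglyMeasurable (Eventually.of_forall fun x => ?_)
  rw [norm_mul]
  exact mul_le_mul (norm_invFourierU_le A x) (norm_invFourierU_le B x) (norm_nonneg _)
    (mul_nonneg fourierConst_pos.le (integral_nonneg fun _ => norm_nonneg _))

lemma one_add_I_mul_ne_zero {τ : ℝ} (hτ : τ ≠ 0) (ξ : ℝ) : (τ : ℂ) + Complex.I * ξ ≠ 0 := by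
  intro h
  have := congrArg Complex.re h
  simp at this
  exact hτ this

lemma integral_exp_neg_mul_exp {τ : ℝ} (hτ : τ ≠ 0) (x η : ℝ) :
    (τ : ℂ)⁻¹ * ∫ r in Set.Ioi (0 : ℝ), (Real.exp (-r) : ℂ) *
      Complex.exp (Complex.I * (x - r / τ : ℝ) * η) =
      Complex.exp (Complex.I * x * η) / (τ + Complex.I * η) := by
  have hτ' : (τ : ℂ) ≠ 0 := by exact_mod_cast hτ
  have h0 := one_add_I_mul_ne_zero hτ η
  have ha : (-(1 + Complex.I * η / τ)).re < 0 := by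
    simp [Complex.div_re]
  have h1 : ∀ r : ℝ, (Real.exp (-r) : ℂ) * Complex.exp (Complex.I * (x - r / τ : ℝ) * η) =
      Complex.exp (Complex.I * x * η) * Complex.exp (-(1 + Complex.I * η / τ) * r) := by
    intro r
    push_cast
    rw [← Complex.exp_add, ← Complex.exp_add]
    congr 1
    ring
  simp_rw [h1]
  rw [integral_const_mul, integral_exp_mul_complex_Ioi ha]
  have h2 : 1 + Complex.I * η / τ = (τ + Complex.I * η) / τ := by field_simp
  rw [h2]
  simp only [Complex.ofReal_zero, mul_zero, Complex.exp_zero]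
  field_simp

lemma integrable_div_add {A : ℝ → ℂ} (hA : Integrable A) {τ : ℝ} (hτ : 1 ≤ |τ|) :
    Integrable fun η : ℝ => A η / (τ + Complex.I * η) := by
  have hτ0 : τ ≠ 0 := by rintro rfl; norm_num at hτ
  simp_rw [div_eq_mul_inv]
  refine Integrable.mul_of_norm_le_one hA (Continuous.aestronglyMeasurable ?_) fun η => ?_
  · exact Continuous.inv₀ (by fun_prop) (one_add_I_mul_ne_zero hτ0)
  · rw [norm_inv]
    refine inv_le_one_of_one_le₀ (hτ.trans ?_)
    have := Complex.abs_re_le_norm ((τ : ℂ) + Complex.I * η)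
    simpa using this

/-- On the exponential e^{ixη} the operator (τ + d/dx)⁻¹ is division by τ + iη; Fubini superposes
the exponentials. -/
lemma resolvent_invFourierU {A : ℝ → ℂ} (hA : Integrable A) {τ : ℝ} (hτ : τ ≠ 0) (x : ℝ) :
    resolvent τ (invFourierU A) x = invFourierU (fun η => A η / (τ + Complex.I * η)) x := by
  have he : Integrable (fun r : ℝ => (Real.exp (-r) : ℂ)) (volume.restrict (Set.Ioi 0)) :=
    integrableOn_exp_neg.ofReal
  have hint : Integrable (Function.uncurry fun r η : ℝ => (Real.exp (-r) : ℂ) * A η *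
      Complex.exp (Complex.I * (x - r / τ : ℝ) * η)) ((volume.restrict (Set.Ioi 0)).prod volume) :=
    Integrable.mul_of_norm_le_one (he.mul_prod hA)
      (Continuous.aestronglyMeasurable (by fun_prop)) (fun p => (norm_exp_I_mul _ _).le)
  have h1 : ∀ r : ℝ, (Real.exp (-r) : ℂ) * invFourierU A (x - r / τ) = fourierConst *
      ∫ η : ℝ, (Real.exp (-r) : ℂ) * A η * Complex.exp (Complex.I * (x - r / τ : ℝ) * η) := by
    intro r
    rw [invFourierU, mul_left_comm, ← integral_const_mul]
    congr 1
    exact integral_congr_ae (Eventually.of_forall fun η => by ring)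
  rw [resolvent]
  simp_rw [h1]
  rw [integral_const_mul, integral_integral_swap hint, invFourierU, mul_left_comm,
    ← integral_const_mul]
  congr 1
  refine integral_congr_ae (Eventually.of_forall fun η => ?_)
  simp only
  rw [show (fun r : ℝ => (Real.exp (-r) : ℂ) * A η *
    Complex.exp (Complex.I * (x - r / τ : ℝ) * η)) = fun r : ℝ => A η * ((Real.exp (-r) : ℂ) *
    Complex.exp (Complex.I * (x - r / τ : ℝ) * η)) from funext fun r => by ring,
    integral_const_mul, mul_left_comm, integral_exp_neg_mul_exp hτ]
  ring

/-! ### Symmetries of the momentum variables -/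

instance isAddHaarMeasure_volume_prod :
    Measure.IsAddHaarMeasure (volume : Measure (ℝ × ℝ)) :=
  inferInstanceAs (Measure.IsAddHaarMeasure ((volume : Measure ℝ).prod (volume : Measure ℝ)))

instance isAddHaarMeasure_volume_prod_prod :
    Measure.IsAddHaarMeasure (volume : Measure (ℝ × ℝ × ℝ)) :=
  inferInstanceAs (Measure.IsAddHaarMeasure
    ((volume : Measure ℝ).prod (volume : Measure (ℝ × ℝ))))

/-- The determinant of a linear involution squares to 1, so its absolute value is 1. -/
lemma measurePreserving_of_involutive (f : (ℝ × ℝ × ℝ) →ₗ[ℝ] ℝ × ℝ × ℝ)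
    (hf : Function.Involutive f) : MeasurePreserving f := by
  have h1 : LinearMap.det f * LinearMap.det f = 1 := by
    rw [← LinearMap.det_comp, show f ∘ₗ f = LinearMap.id from LinearMap.ext hf, LinearMap.det_id]
  have h2 : |(LinearMap.det f)⁻¹| = 1 := by
    rw [abs_inv, inv_eq_one]
    rcases mul_self_eq_one_iff.1 h1 with h | h <;> simp [h]
  have h0 : LinearMap.det f ≠ 0 := left_ne_zero_of_mul_eq_one h1
  refine ⟨f.continuous_of_finiteDimensional.measurable, ?_⟩
  rw [Measure.map_linearMap_addHaar_eq_smul_addHaar volume h0, h2, ENNReal.ofReal_one, one_smul]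

lemma integral_comp_involutive (f : (ℝ × ℝ × ℝ) →ₗ[ℝ] ℝ × ℝ × ℝ) (hf : Function.Involutive f)
    (g : ℝ × ℝ × ℝ → ℂ) : ∫ p, g (f p) = ∫ p, g p :=
  (measurePreserving_of_involutive f hf).integral_comp
    (MeasurableEquiv.ofInvolutive f hf
      f.continuous_of_finiteDimensional.measurable).measurableEmbedding g

/-- Exchange of `ξ₁` and `ξ₂`. -/
def swapXi : (ℝ × ℝ × ℝ) →ₗ[ℝ] ℝ × ℝ × ℝ where
  toFun p := (p.2.1 + p.2.2 - p.1, p.2.1, p.2.2)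
  map_add' p q := by ext <;> simp; ring
  map_smul' c p := by ext <;> simp; ring

/-- Exchange of `(ξ₁, ξ₂)` and `(η₁, η₂)`. -/
def swapPairs : (ℝ × ℝ × ℝ) →ₗ[ℝ] ℝ × ℝ × ℝ where
  toFun p := (p.2.1, p.1, p.2.1 + p.2.2 - p.1)
  map_add' p q := by ext <;> simp; ring
  map_smul' c p := by ext <;> simp; ring

lemma swapXi_apply (p : ℝ × ℝ × ℝ) : swapXi p = (p.2.1 + p.2.2 - p.1, p.2.1, p.2.2) := rfl

lemma swapPairs_apply (p : ℝ × ℝ × ℝ) : swapPairs p = (p.2.1, p.1, p.2.1 + p.2.2 - p.1) := rfl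

lemma integral_swapXi (g : ℝ × ℝ × ℝ → ℂ) : ∫ p, g (swapXi p) = ∫ p, g p :=
  integral_comp_involutive _ (fun p => by ext <;> simp [swapXi_apply]) g

lemma integral_swapPairs (g : ℝ × ℝ × ℝ → ℂ) : ∫ p, g (swapPairs p) = ∫ p, g p :=
  integral_comp_involutive _ (fun p => by ext <;> simp [swapPairs_apply]) g

/-- The denominator `(ξ₁ - η₁)(ξ₁ - η₂)`. -/
def resonance (p : ℝ × ℝ × ℝ) : ℝ := (p.1 - p.2.1) * (p.1 - p.2.2)

/-- The kernel of a nonzero linear form is a proper subspace, hence null. It makes the resonant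
planes negligible. -/
lemma ae_linear_ne_zero (l : (ℝ × ℝ × ℝ) →ₗ[ℝ] ℝ) (q : ℝ × ℝ × ℝ) (hq : l q ≠ 0) :
    ∀ᵐ p : ℝ × ℝ × ℝ, l p ≠ 0 := by
  have h := Measure.addHaar_submodule (volume : Measure (ℝ × ℝ × ℝ)) (LinearMap.ker l)
    (fun h => hq (by rw [← LinearMap.mem_ker, h]; trivial))
  rw [ae_iff]
  refine measure_mono_null (fun p hp => ?_) h
  simpa using hp

lemma ae_resonance_ne_zero : ∀ᵐ p : ℝ × ℝ × ℝ, resonance p ≠ 0 := by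
  have h1 := ae_linear_ne_zero (LinearMap.fst ℝ ℝ (ℝ × ℝ) -
    LinearMap.fst ℝ ℝ ℝ ∘ₗ LinearMap.snd ℝ ℝ (ℝ × ℝ)) (1, 0, 0) (by simp)
  have h2 := ae_linear_ne_zero (LinearMap.fst ℝ ℝ (ℝ × ℝ) -
    LinearMap.snd ℝ ℝ ℝ ∘ₗ LinearMap.snd ℝ ℝ (ℝ × ℝ)) (1, 0, 0) (by simp)
  filter_upwards [h1, h2] with p hp1 hp2
  exact mul_ne_zero (by simpa using hp1) (by simpa using hp2)

/-! ### Second differences -/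

/-- `f(ξ₁) + f(ξ₂) - f(η₁) - f(η₂)`. -/
def secondDiff (f : ℝ → ℝ) (p : ℝ × ℝ × ℝ) : ℝ :=
  f p.1 + f (p.2.1 + p.2.2 - p.1) - f p.2.1 - f p.2.2

/-- The symbol `(f(ξ₁) + f(ξ₂) - f(η₁) - f(η₂)) / ((ξ₁ - η₁)(ξ₁ - η₂))`. -/
def diffQuot (f : ℝ → ℝ) (p : ℝ × ℝ × ℝ) : ℝ := secondDiff f p / resonance p

lemma secondDiff_swapPairs (f : ℝ → ℝ) (p : ℝ × ℝ × ℝ) :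
    secondDiff f (swapPairs p) = -secondDiff f p := by
  simp only [secondDiff, swapPairs_apply]
  rw [show p.1 + (p.2.1 + p.2.2 - p.1) - p.2.1 = p.2.2 by ring]
  ring

lemma diffQuot_swapPairs (f : ℝ → ℝ) (p : ℝ × ℝ × ℝ) :
    diffQuot f (swapPairs p) = diffQuot f p := by
  rw [diffQuot, diffQuot, secondDiff_swapPairs, show resonance (swapPairs p) = -resonance p by
    simp only [resonance, swapPairs_apply]; ring, neg_div_neg_eq]

lemma secondDiff_sq (p : ℝ × ℝ × ℝ) : secondDiff (fun x => x ^ 2) p = 2 * resonance p := by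
  simp only [secondDiff, resonance]
  ring

/-- `f` and its first two derivatives are at most `c (1 + |x|)^m`. -/
def C2Bound (f : ℝ → ℝ) (c : ℝ) (m : ℕ) : Prop :=
  ∃ f' f'' : ℝ → ℝ, ∀ x, HasDerivAt f (f' x) x ∧ HasDerivAt f' (f'' x) x ∧
    |f x| ≤ c * (1 + |x|) ^ m ∧ |f' x| ≤ c * (1 + |x|) ^ m ∧ |f'' x| ≤ c * (1 + |x|) ^ m

namespace C2Bound

variable {f g : ℝ → ℝ} {c d : ℝ} {m n : ℕ}

lemma continuous (hf : C2Bound f c m) : Continuous f := by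
  obtain ⟨f', f'', h⟩ := hf
  exact continuous_iff_continuousAt.2 fun x => (h x).1.continuousAt

lemma nonneg (hf : C2Bound f c m) : 0 ≤ c := by
  obtain ⟨f', f'', h⟩ := hf
  have := (abs_nonneg _).trans (h 0).2.2.1
  simpa using this

lemma mul (hf : C2Bound f c m) (hg : C2Bound g d n) :
    C2Bound (fun x => f x * g x) (4 * (c * d)) (m + n) := by
  have hc := hf.nonneg
  have hd := hg.nonneg
  obtain ⟨f', f'', hf⟩ := hf
  obtain ⟨g', g'', hg⟩ := hg
  refine ⟨fun x => f' x * g x + f x * g' x,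
    fun x => (f'' x * g x + f' x * g' x) + (f' x * g' x + f x * g'' x), fun x => ?_⟩
  obtain ⟨h1, h2, h3, h4, h5⟩ := hf x
  obtain ⟨k1, k2, k3, k4, k5⟩ := hg x
  have key : ∀ {a b : ℝ}, |a| ≤ c * (1 + |x|) ^ m → |b| ≤ d * (1 + |x|) ^ n →
      |a * b| ≤ c * d * (1 + |x|) ^ (m + n) := by
    intro a b ha hb
    rw [abs_mul, pow_add]
    calc |a| * |b| ≤ (c * (1 + |x|) ^ m) * (d * (1 + |x|) ^ n) :=
          mul_le_mul ha hb (abs_nonneg _) ((abs_nonneg _).trans ha)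
      _ = _ := by ring
  have h0 : 0 ≤ c * d * (1 + |x|) ^ (m + n) := by positivity
  refine ⟨h1.mul k1, (h2.mul k1).add (h1.mul k2), ?_, ?_, ?_⟩
  · linarith [key h3 k3]
  · linarith [key h4 k3, key h3 k4, abs_add_le (f' x * g x) (f x * g' x)]
  · linarith [key h5 k3, key h4 k4, key h3 k5, abs_add_le (f'' x * g x) (f' x * g' x),
      abs_add_le (f' x * g' x) (f x * g'' x),
      abs_add_le (f'' x * g x + f' x * g' x) (f' x * g' x + f x * g'' x)]

lemma const (c : ℝ) (hc : 0 ≤ c) : C2Bound (fun _ => c) c 0 :=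
  ⟨fun _ => 0, fun _ => 0, fun x => ⟨hasDerivAt_const _ _, hasDerivAt_const _ _, by
    simp [abs_of_nonneg hc], by simpa, by simpa⟩⟩

lemma sq : C2Bound (fun x => x ^ 2) 2 2 := by
  refine ⟨fun x => 2 * x, fun _ => 2, fun x => ⟨?_, ?_, ?_, ?_, ?_⟩⟩
  · simpa using hasDerivAt_pow 2 x
  · simpa using (hasDerivAt_id x).const_mul 2
  · rw [abs_pow]; nlinarith [abs_nonneg x]
  · rw [abs_mul, abs_two]; nlinarith [abs_nonneg x]
  · rw [abs_two]; nlinarith [abs_nonneg x]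

lemma sq_pow (j : ℕ) : C2Bound (fun x => (x ^ 2) ^ j) (8 ^ j) (2 * j) := by
  induction j with
  | zero => simpa using const 1 zero_le_one
  | succ j ih =>
    have h := ih.mul sq
    simp only [← pow_succ] at h
    rwa [show (4 : ℝ) * (8 ^ j * 2) = 8 ^ (j + 1) by ring] at h

/-- The constant 6 comes from the second derivative. Keeping the factor τ⁻² preserves the decay in τ
needed for the energy integral. -/
lemma inv_sq_add_sq {τ : ℝ} (hτ : 1 ≤ τ) :
    C2Bound (fun x => (τ ^ 2 + x ^ 2)⁻¹) (6 * (τ ^ 2)⁻¹) 0 := by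
  have h0 : ∀ x : ℝ, 1 ≤ τ ^ 2 + x ^ 2 := fun x => by nlinarith [sq_nonneg x]
  have h0' : ∀ x : ℝ, τ ^ 2 + x ^ 2 ≠ 0 := fun x => by linarith [h0 x]
  have hd : ∀ x : ℝ, HasDerivAt (fun x => τ ^ 2 + x ^ 2) (2 * x) x := fun x => by
    simpa using (hasDerivAt_pow 2 x).const_add (τ ^ 2)
  refine ⟨fun x => -(2 * x) / (τ ^ 2 + x ^ 2) ^ 2,
    fun x => (6 * x ^ 2 - 2 * τ ^ 2) / (τ ^ 2 + x ^ 2) ^ 3, fun x => ?_⟩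
  have hx := h0 x
  have hτ2 : 0 < τ ^ 2 := by positivity
  have hinv : (τ ^ 2 + x ^ 2)⁻¹ ≤ (τ ^ 2)⁻¹ :=
    inv_anti₀ hτ2 (by nlinarith [sq_nonneg x])
  have hinv0 : 0 < (τ ^ 2 + x ^ 2)⁻¹ := by positivity
  refine ⟨(hd x).inv (h0' x), ?_, ?_, ?_, ?_⟩
  · have h1 : HasDerivAt (fun x : ℝ => -(2 * x)) (-2) x := by
      simpa only [mul_one, id] using! ((hasDerivAt_id x).const_mul (2 : ℝ)).neg
    have h2 := h1.div ((hd x).pow 2) (pow_ne_zero 2 (h0' x))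
    refine h2.congr_deriv ?_
    have := h0' x
    simp only [Pi.pow_apply]
    field_simp
    ring
  · rw [abs_of_pos hinv0, pow_zero, mul_one]
    linarith
  · rw [pow_zero, mul_one]
    have : |-(2 * x) / (τ ^ 2 + x ^ 2) ^ 2| ≤ (τ ^ 2 + x ^ 2)⁻¹ := by
      rw [abs_div, abs_neg, abs_of_nonneg (by positivity : 0 ≤ (τ ^ 2 + x ^ 2) ^ 2),
        div_le_iff₀ (by positivity), pow_two (τ ^ 2 + x ^ 2), inv_mul_cancel_left₀ (h0' x), abs_le]
      constructor <;> nlinarith [sq_nonneg (x - 1), sq_nonneg (x + 1)]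
    linarith
  · rw [pow_zero, mul_one]
    have : |(6 * x ^ 2 - 2 * τ ^ 2) / (τ ^ 2 + x ^ 2) ^ 3| ≤ 6 * (τ ^ 2 + x ^ 2)⁻¹ := by
      rw [abs_div, abs_of_nonneg (by positivity : 0 ≤ (τ ^ 2 + x ^ 2) ^ 3),
        div_le_iff₀ (by positivity), pow_succ' (τ ^ 2 + x ^ 2), mul_assoc,
        inv_mul_cancel_left₀ (h0' x), abs_le]
      have : τ ^ 2 + x ^ 2 ≤ (τ ^ 2 + x ^ 2) ^ 2 := by nlinarith
      constructor <;> nlinarith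
    linarith

lemma one_add_sq_rpow_le (a x : ℝ) : (1 + x ^ 2) ^ a ≤ (1 + |x|) ^ (2 * ⌈|a|⌉₊) := by
  have h1 : (1 : ℝ) ≤ 1 + x ^ 2 := by nlinarith [sq_nonneg x]
  calc (1 + x ^ 2) ^ a ≤ (1 + x ^ 2) ^ (⌈|a|⌉₊ : ℝ) :=
        Real.rpow_le_rpow_of_exponent_le h1 ((le_abs_self a).trans (Nat.le_ceil _))
    _ = (1 + x ^ 2) ^ ⌈|a|⌉₊ := Real.rpow_natCast _ _
    _ ≤ ((1 + |x|) ^ 2) ^ ⌈|a|⌉₊ := by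
        refine pow_le_pow_left₀ (by positivity) ?_ _
        nlinarith [abs_nonneg x, sq_abs x]
    _ = _ := (pow_mul _ _ _).symm

lemma one_add_sq_rpow (s : ℝ) : ∃ c m, C2Bound (fun x => (1 + x ^ 2) ^ s) c m := by
  have h0 : ∀ x : ℝ, 1 ≤ 1 + x ^ 2 := fun x => by nlinarith [sq_nonneg x]
  have h0' : ∀ x : ℝ, 1 + x ^ 2 ≠ 0 := fun x => by linarith [h0 x]
  have hd : ∀ x : ℝ, HasDerivAt (fun x => 1 + x ^ 2) (2 * x) x := fun x => by
    simpa using (hasDerivAt_pow 2 x).const_add (1 : ℝ)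
  have hr : ∀ a x : ℝ, HasDerivAt (fun x => (1 + x ^ 2) ^ a)
      (2 * a * x * (1 + x ^ 2) ^ (a - 1)) x := fun a x => by
    refine ((hd x).rpow_const (Or.inl (h0' x))).congr_deriv ?_
    ring
  refine ⟨1 + 2 * |s| + 4 * |s| * |s - 1|, 2 * ⌈|s|⌉₊,
    fun x => 2 * s * x * (1 + x ^ 2) ^ (s - 1),
    fun x => 2 * s * (1 + x ^ 2) ^ (s - 1) + 4 * s * (s - 1) * x ^ 2 * (1 + x ^ 2) ^ (s - 2),
    fun x => ?_⟩
  have hE := one_add_sq_rpow_le s x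
  have hpos : 0 < (1 + x ^ 2) ^ s := by have := h0 x; positivity
  have hs1 : (1 + x ^ 2) ^ (s - 1) = (1 + x ^ 2) ^ s / (1 + x ^ 2) :=
    Real.rpow_sub_one (h0' x) s
  have hs2 : (1 + x ^ 2) ^ (s - 2) = (1 + x ^ 2) ^ s / (1 + x ^ 2) ^ 2 := by
    rw [show s - 2 = s - 1 - 1 by ring, Real.rpow_sub_one (h0' x), hs1]
    field_simp
  have b1 : |2 * s * x * (1 + x ^ 2) ^ (s - 1)| ≤ 2 * |s| * (1 + x ^ 2) ^ s := by
    rw [hs1, abs_mul, abs_mul, abs_mul, abs_two, abs_of_pos (div_pos hpos (by linarith [h0 x])),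
      mul_assoc]
    refine mul_le_mul_of_nonneg_left ?_ (by positivity)
    rw [mul_div_assoc', div_le_iff₀ (by linarith [h0 x]), mul_comm]
    refine mul_le_mul_of_nonneg_left ?_ hpos.le
    nlinarith [sq_nonneg (|x| - 1), sq_abs x, abs_nonneg x]
  have b2 : |2 * s * (1 + x ^ 2) ^ (s - 1)| ≤ 2 * |s| * (1 + x ^ 2) ^ s := by
    rw [hs1, abs_mul, abs_mul, abs_two, abs_of_pos (div_pos hpos (by linarith [h0 x]))]
    exact mul_le_mul_of_nonneg_left (div_le_self hpos.le (h0 x)) (by positivity)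
  have b3 : |4 * s * (s - 1) * x ^ 2 * (1 + x ^ 2) ^ (s - 2)| ≤
      4 * |s| * |s - 1| * (1 + x ^ 2) ^ s := by
    rw [hs2, abs_mul, abs_mul, abs_mul, abs_mul, abs_of_pos (by norm_num : (0 : ℝ) < 4),
      abs_of_pos (div_pos hpos (by have := h0 x; positivity)), mul_assoc (4 * |s| * |s - 1|),
      abs_of_nonneg (sq_nonneg x)]
    refine mul_le_mul_of_nonneg_left ?_ (by positivity)
    rw [mul_div_assoc', div_le_iff₀ (by have := h0 x; positivity), mul_comm]
    refine mul_le_mul_of_nonneg_left ?_ hpos.le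
    nlinarith [sq_nonneg x]
  have hs3 : 0 ≤ |s| := abs_nonneg _
  have hs4 : 0 ≤ |s| * |s - 1| := by positivity
  have hE0 : 0 ≤ (1 + |x|) ^ (2 * ⌈|s|⌉₊) := by positivity
  have m1 := mul_le_mul_of_nonneg_left hE hs3
  have m2 := mul_le_mul_of_nonneg_left hE hs4
  have m3 := mul_nonneg hs3 hE0
  have m4 := mul_nonneg hs4 hE0
  refine ⟨hr s x, ?_, ?_, ?_, ?_⟩
  · have := ((hasDerivAt_id x).const_mul (2 * s)).mul (hr (s - 1) x)
    refine this.congr_deriv ?_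
    rw [show s - 1 - 1 = s - 2 by ring]
    simp only [id]
    ring
  · rw [abs_of_pos hpos]; nlinarith
  · nlinarith
  · nlinarith [abs_add_le (2 * s * (1 + x ^ 2) ^ (s - 1))
      (4 * s * (s - 1) * x ^ 2 * (1 + x ^ 2) ^ (s - 2))]

end C2Bound

/-- Two mean value estimates. With a = ξ₁, b = η₁, d = η₂, the second difference is the increment
over the segment from b + d - a to b of the function x ↦ f(x + a - b) - f(x), whose derivative is at
most K|a - b|; that segment has length |a - d|. Thus the symbol has no singularity at resonance
beyond the growth of f''. -/
lemma abs_secondDiff_le_mul {f f' f'' : ℝ → ℝ} {K ρ : ℝ} (hf : ∀ x, HasDerivAt f (f' x) x)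
    (hf' : ∀ x, HasDerivAt f' (f'' x) x) (hK : ∀ x ∈ Set.Icc (-ρ) ρ, |f'' x| ≤ K)
    {p : ℝ × ℝ × ℝ} (h1 : p.1 ∈ Set.Icc (-ρ) ρ) (h2 : p.2.1 ∈ Set.Icc (-ρ) ρ)
    (h3 : p.2.2 ∈ Set.Icc (-ρ) ρ) (h4 : p.2.1 + p.2.2 - p.1 ∈ Set.Icc (-ρ) ρ) :
    |secondDiff f p| ≤ K * |resonance p| := by
  obtain ⟨a, b, d⟩ := p
  simp only at h1 h2 h3 h4
  have hc : Convex ℝ (Set.Icc (-ρ) ρ) := convex_Icc _ _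
  have hfirst : ∀ x ∈ Set.uIcc b (b + d - a), |f' (x + (a - b)) - f' x| ≤ K * |a - b| := by
    intro x hx
    have hx1 : x ∈ Set.Icc (-ρ) ρ := Set.uIcc_subset_Icc h2 h4 hx
    have hx2 : x + (a - b) ∈ Set.Icc (-ρ) ρ := by
      refine Set.uIcc_subset_Icc h1 h3 ?_
      rw [Set.mem_uIcc] at hx ⊢
      rcases hx with ⟨hx, hx'⟩ | ⟨hx, hx'⟩
      · left; constructor <;> linarith
      · right; constructor <;> linarith
    have := Convex.norm_image_sub_le_of_norm_hasDerivWithin_le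
      (fun y _ => (hf' y).hasDerivWithinAt) hK hc hx1 hx2
    simpa [Real.norm_eq_abs] using this
  have := Convex.norm_image_sub_le_of_norm_hasDerivWithin_le
    (f := fun x => f (x + (a - b)) - f x) (f' := fun x => f' (x + (a - b)) - f' x)
    (fun y _ => (((hf _).comp_add_const y (a - b)).sub (hf y)).hasDerivWithinAt) hfirst
    (convex_uIcc b (b + d - a)) Set.right_mem_uIcc Set.left_mem_uIcc
  simp only [Real.norm_eq_abs] at this
  rw [show b + d - a + (a - b) = d by ring, show b + (a - b) = a by ring,
    show b - (b + d - a) = a - d by ring] at this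
  simp only [secondDiff, resonance]
  rw [abs_mul, ← mul_assoc, show f a + f (b + d - a) - f b - f d =
    f a - f b - (f d - f (b + d - a)) by ring]
  exact this

/-- The size `1 + |ξ₁| + |η₁| + |η₂|` of the momenta. -/
def momentumSize (p : ℝ × ℝ × ℝ) : ℝ := 1 + |p.1| + |p.2.1| + |p.2.2|

lemma one_le_momentumSize (p : ℝ × ℝ × ℝ) : 1 ≤ momentumSize p := by
  have := abs_nonneg p.1
  have := abs_nonneg p.2.1
  have := abs_nonneg p.2.2
  unfold momentumSize
  linarith

namespace C2Bound

variable {f : ℝ → ℝ} {c : ℝ} {m : ℕ}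

lemma abs_diffQuot_le (hf : C2Bound f c m) (p : ℝ × ℝ × ℝ) :
    |diffQuot f p| ≤ c * momentumSize p ^ m := by
  have hc := hf.nonneg
  have h0 := one_le_momentumSize p
  obtain ⟨f', f'', h⟩ := hf
  rw [diffQuot, abs_div]
  refine div_le_of_le_mul₀ (abs_nonneg _) (by positivity) ?_
  have e1 := abs_le.1 (le_refl |p.1|)
  have e2 := abs_le.1 (le_refl |p.2.1|)
  have e3 := abs_le.1 (le_refl |p.2.2|)
  have n1 := abs_nonneg p.1
  have n2 := abs_nonneg p.2.1
  have n3 := abs_nonneg p.2.2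
  refine abs_secondDiff_le_mul (ρ := |p.1| + |p.2.1| + |p.2.2|) (fun x => (h x).1)
    (fun x => (h x).2.1) (fun x hx => ?_) ?_ ?_ ?_ ?_
  · refine (h x).2.2.2.2.trans (mul_le_mul_of_nonneg_left
      (pow_le_pow_left₀ (by positivity) ?_ _) hc)
    have := abs_le.2 hx
    unfold momentumSize
    linarith
  all_goals constructor <;> linarith [e1.1, e1.2, e2.1, e2.2, e3.1, e3.2]

lemma abs_secondDiff_le (hf : C2Bound f c m) (p : ℝ × ℝ × ℝ) :
    |secondDiff f p| ≤ 4 * (c * momentumSize p ^ m) := by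
  have hc := hf.nonneg
  have h0 := one_le_momentumSize p
  obtain ⟨f', f'', h⟩ := hf
  have n1 := abs_nonneg p.1
  have n2 := abs_nonneg p.2.1
  have n3 := abs_nonneg p.2.2
  have key : ∀ x, |x| ≤ |p.1| + |p.2.1| + |p.2.2| → |f x| ≤ c * momentumSize p ^ m := by
    intro x hx
    refine (h x).2.2.1.trans (mul_le_mul_of_nonneg_left
      (pow_le_pow_left₀ (by positivity) ?_ _) hc)
    unfold momentumSize
    linarith
  have k1 := key p.1 (by linarith)
  have k2 := key p.2.1 (by linarith)
  have k3 := key p.2.2 (by linarith)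
  have k4 := key (p.2.1 + p.2.2 - p.1) (by
    linarith [abs_sub (p.2.1 + p.2.2) p.1, abs_add_le p.2.1 p.2.2])
  rw [abs_le] at k1 k2 k3 k4
  unfold secondDiff
  rw [abs_le]
  constructor <;> linarith [k1.1, k1.2, k2.1, k2.2, k3.1, k3.2, k4.1, k4.2]

end C2Bound

lemma measurable_secondDiff {f : ℝ → ℝ} (hf : Measurable f) : Measurable (secondDiff f) := by
  unfold secondDiff
  fun_prop

lemma measurable_resonance : Measurable resonance := by
  unfold resonance
  fun_prop

lemma measurable_diffQuot {f : ℝ → ℝ} (hf : Measurable f) : Measurable (diffQuot f) :=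
  (measurable_secondDiff hf).div measurable_resonance

/-! ### The quartic density -/

/-- `conj(g(ξ₁) g(ξ₂)) g(η₁) g(η₂)`. -/
def quarticProd (g : ℝ → ℂ) (p : ℝ × ℝ × ℝ) : ℂ :=
  conj (g p.1 * g (p.2.1 + p.2.2 - p.1)) * (g p.2.1 * g p.2.2)

lemma quarticProd_swapPairs (g : ℝ → ℂ) (p : ℝ × ℝ × ℝ) :
    quarticProd g (swapPairs p) = conj (quarticProd g p) := by
  simp only [quarticProd, swapPairs_apply]
  rw [show p.1 + (p.2.1 + p.2.2 - p.1) - p.2.1 = p.2.2 by ring]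
  simp only [map_mul, Complex.conj_conj]
  ring

lemma quarticProd_swapXi (g : ℝ → ℂ) (p : ℝ × ℝ × ℝ) :
    quarticProd g (swapXi p) = quarticProd g p := by
  simp only [quarticProd, swapXi_apply, sub_sub_cancel]
  rw [mul_comm (g (p.2.1 + p.2.2 - p.1))]

lemma schwartz_one_add_pow (u : 𝓢(ℝ, ℂ)) (m : ℕ) :
    Integrable fun x => (1 + |x|) ^ m * ‖u x‖ := by
  have hu := u.continuous
  refine integrable_of_decay (C := 2 ^ (m + 2) * (Finset.Iic (m + 2, 0)).sup
      (fun m => SchwartzMap.seminorm ℝ m.1 m.2) u)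
    (Continuous.aestronglyMeasurable (by fun_prop)) fun x => ?_
  have h := SchwartzMap.one_add_le_sup_seminorm_apply (𝕜 := ℝ) (m := (m + 2, 0)) (k := m + 2)
    (n := 0) le_rfl le_rfl u x
  simp only [norm_iteratedFDeriv_zero, Real.norm_eq_abs] at h
  rw [← div_eq_mul_inv, le_div_iff₀ (by positivity), norm_mul, norm_norm, norm_pow,
    Real.norm_of_nonneg (by positivity)]
  refine le_trans ?_ h
  rw [pow_add, mul_right_comm]
  refine mul_le_mul_of_nonneg_right (mul_le_mul_of_nonneg_left ?_ (by positivity))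
    (norm_nonneg _)
  nlinarith [abs_nonneg x, sq_abs x]

lemma integrable_fourierU (u : 𝓢(ℝ, ℂ)) : Integrable (fourierU u) := by
  rw [← coe_fourierSchwartz]
  exact (fourierSchwartz u).integrable

lemma continuous_fourierU_schwartz (u : 𝓢(ℝ, ℂ)) : Continuous (fourierU u) :=
  continuous_fourierU u.integrable

lemma continuous_quarticProd (u : 𝓢(ℝ, ℂ)) : Continuous (quarticProd (fourierU u)) := by
  have := continuous_fourierU_schwartz u
  unfold quarticProd
  fun_prop

lemma continuous_momentumSize : Continuous momentumSize := by
  unfold momentumSize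
  fun_prop

/-- The three factors at independent momenta absorb the polynomial weight, since 1 + |ξ₁| + |η₁| +
|η₂| is at most the product of the 1 + |·|; the fourth factor, at ξ₂, is simply bounded. -/
lemma integrable_momentumSize_pow_mul (u : 𝓢(ℝ, ℂ)) (m : ℕ) :
    Integrable fun p => momentumSize p ^ m * ‖quarticProd (fourierU u) p‖ := by
  have h1 : Integrable fun x => (1 + |x|) ^ m * ‖fourierU u x‖ := by
    rw [← coe_fourierSchwartz]
    exact schwartz_one_add_pow _ m
  have hQ := continuous_quarticProd u
  have hM := continuous_momentumSize
  set K := fourierConst * ∫ x, ‖u x‖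
  have hK : ∀ x, ‖fourierU u x‖ ≤ K := norm_fourierU_le u
  refine ((h1.mul_prod (h1.mul_prod h1)).const_mul K).mono'
    (Continuous.aestronglyMeasurable (by fun_prop)) (Eventually.of_forall fun p => ?_)
  have hK0 : 0 ≤ K := (norm_nonneg _).trans (hK 0)
  have hs := one_le_momentumSize p
  have hle : momentumSize p ^ m ≤ (1 + |p.1|) ^ m * ((1 + |p.2.1|) ^ m * (1 + |p.2.2|) ^ m) := by
    rw [← mul_pow, ← mul_pow]
    refine pow_le_pow_left₀ (by linarith) ?_ _
    have n1 := abs_nonneg p.1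
    have n2 := abs_nonneg p.2.1
    have n3 := abs_nonneg p.2.2
    unfold momentumSize
    nlinarith [mul_nonneg n1 n2, mul_nonneg n1 n3, mul_nonneg n2 n3, mul_nonneg (mul_nonneg n1 n2) n3]
  rw [norm_mul, norm_norm, Real.norm_of_nonneg (by positivity)]
  simp only [quarticProd, norm_mul, RCLike.norm_conj]
  calc momentumSize p ^ m * (‖fourierU u p.1‖ * ‖fourierU u (p.2.1 + p.2.2 - p.1)‖ *
        (‖fourierU u p.2.1‖ * ‖fourierU u p.2.2‖))
      ≤ ((1 + |p.1|) ^ m * ((1 + |p.2.1|) ^ m * (1 + |p.2.2|) ^ m)) * (‖fourierU u p.1‖ * K *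
        (‖fourierU u p.2.1‖ * ‖fourierU u p.2.2‖)) := by
        gcongr
        exact hK _
    _ = _ := by ring

lemma integrable_mul_quarticProd (u : 𝓢(ℝ, ℂ)) {b : ℝ × ℝ × ℝ → ℂ} (hb : AEStronglyMeasurable b)
    {c : ℝ} {m : ℕ} (h : ∀ p, ‖b p‖ ≤ c * momentumSize p ^ m) :
    Integrable fun p => b p * quarticProd (fourierU u) p := by
  refine ((integrable_momentumSize_pow_mul u m).const_mul c).mono'
    (hb.mul (continuous_quarticProd u).aestronglyMeasurable) (Eventually.of_forall fun p => ?_)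
  rw [norm_mul, ← mul_assoc]
  exact mul_le_mul_of_nonneg_right (h p) (norm_nonneg _)

namespace C2Bound

variable {f : ℝ → ℝ} {c : ℝ} {m : ℕ}

lemma integrable_diffQuot (hf : C2Bound f c m) (u : 𝓢(ℝ, ℂ)) :
    Integrable fun p => (diffQuot f p : ℂ) * quarticProd (fourierU u) p :=
  integrable_mul_quarticProd u
    (Complex.measurable_ofReal.comp (measurable_diffQuot hf.continuous.measurable)).aestronglyMeasurable
    fun p => by rw [Complex.norm_real]; exact hf.abs_diffQuot_le p

lemma integrable_secondDiff (hf : C2Bound f c m) (u : 𝓢(ℝ, ℂ)) :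
    Integrable fun p => (secondDiff f p : ℂ) * quarticProd (fourierU u) p :=
  integrable_mul_quarticProd u (c := 4 * c)
    (Complex.measurable_ofReal.comp (measurable_secondDiff hf.continuous.measurable)).aestronglyMeasurable
    fun p => by rw [Complex.norm_real, mul_assoc]; exact hf.abs_secondDiff_le p

end C2Bound

/-- `∫ (Δ²f / ((ξ₁ - η₁)(ξ₁ - η₂))) Re Q`, where `Q = conj(û(ξ₁) û(ξ₂)) û(η₁) û(η₂)`. -/
def quarticEnergy (u : ℝ → ℂ) (f : ℝ → ℝ) : ℝ :=
  ∫ p, diffQuot f p * (quarticProd (fourierU u) p).re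

/-- The quartic form is real. -/
lemma integral_diffQuot_mul (u : ℝ → ℂ) (f : ℝ → ℝ)
    (hf : Integrable fun p => (diffQuot f p : ℂ) * quarticProd (fourierU u) p) :
    ∫ p, (diffQuot f p : ℂ) * quarticProd (fourierU u) p = (quarticEnergy u f : ℂ) := by
  -- Exchanging the pairs fixes the symbol, whose numerator and denominator both change sign, and
  -- conjugates the density.
  have h1 : (∫ p, (diffQuot f p : ℂ) * quarticProd (fourierU u) p) =
      conj (∫ p, (diffQuot f p : ℂ) * quarticProd (fourierU u) p) := by
    conv_lhs => rw [← integral_swapPairs]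
    rw [← integral_conj]
    refine integral_congr_ae (Eventually.of_forall fun p => ?_)
    simp only [diffQuot_swapPairs, quarticProd_swapPairs, map_mul, Complex.conj_ofReal]
  rw [← Complex.conj_eq_iff_re.1 h1.symm, quarticEnergy]
  congr 1
  have := integral_re hf
  simp only [RCLike.re_eq_complex_re, Complex.re_ofReal_mul] at this
  exact this.symm

/-! ### The quartic coefficient of the logarithm of the transmission coefficient -/

/-- The transpose of (τ + d/dx)⁻¹ is (τ - d/dx)⁻¹ = -R_{-τ}; concretely, the sum of the two
integrands is the derivative of a decaying product. -/
lemma integral_mul_resolvent {f g : ℝ → ℂ} (hf : C1Decay f) (hg : C1Decay g) {τ : ℝ}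
    (hτ : 1 ≤ |τ|) :
    ∫ x, g x * resolvent τ f x = -∫ x, resolvent (-τ) g x * f x := by
  have hτ0 : τ ≠ 0 := by rintro rfl; norm_num at hτ
  have hτ' : 1 ≤ |-τ| := by rwa [abs_neg]
  have hb := hf.resolvent hτ
  have ha := hg.resolvent hτ'
  have h1 := (hg.mul hb).integrable
  have h2 := (ha.mul hf).integrable
  have hd : ∀ x, HasDerivAt (fun x => resolvent (-τ) g x * resolvent τ f x)
      (g x * resolvent τ f x + resolvent (-τ) g x * f x) x := by
    intro x
    refine ((hg.hasDerivAt_resolvent (neg_ne_zero.2 hτ0) x).mul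
      (hf.hasDerivAt_resolvent hτ0 x)).congr_deriv ?_
    push_cast
    ring
  have := integral_eq_zero_of_hasDerivAt_of_integrable hd (h1.add h2) (ha.mul hb).integrable
  rw [integral_add h1 h2] at this
  exact eq_neg_of_add_eq_zero_left this

lemma resolvent_const_mul_conj (κ τ : ℝ) (u : ℝ → ℂ) (x : ℝ) :
    resolvent τ (fun x => (κ : ℂ) * conj (u x)) x = κ * conj (resolvent τ u x) := by
  simp only [resolvent]
  rw [map_mul, ← integral_conj, map_inv₀, Complex.conj_ofReal, mul_left_comm,
    ← integral_const_mul (κ : ℂ)]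
  congr 1
  refine integral_congr_ae (Eventually.of_forall fun r => ?_)
  simp only [map_mul, Complex.conj_ofReal]
  ring

lemma logCoeff_one_eq {κ τ : ℝ} {u : ℝ → ℂ} (hu : C1Decay u) (hκ : |κ| = 1) (hτ : 1 ≤ |τ|) :
    logCoeff κ u 1 τ = ∫ x, resolvent (-τ) u x * (u x * conj (resolvent τ u x) ^ 2) := by
  have hκ2 : (κ : ℂ) * κ = 1 := by
    rw [← Complex.ofReal_mul, ← abs_mul_abs_self, hκ]; simp
  have h0 : riccatiSource κ u τ 1 = fun x => -(u x * conj (resolvent τ u x) ^ 2) := by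
    funext x
    have h00 : riccatiCoeff κ u τ 0 x = κ * conj (resolvent τ u x) := by
      rw [riccatiCoeff_eq]; exact resolvent_const_mul_conj κ τ u x
    change -(u x * ∑ i : Fin 1, riccatiCoeff κ u τ i x * riccatiCoeff κ u τ (0 - i) x) = _
    rw [Fin.sum_univ_one]
    change -(u x * (riccatiCoeff κ u τ 0 x * riccatiCoeff κ u τ 0 x)) = _
    rw [h00]
    linear_combination (-u x * conj (resolvent τ u x) ^ 2) * hκ2
  have h1 := integral_mul_resolvent (riccatiSource_c1Decay (κ := κ) hu hτ 1) hu hτ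
  rw [logCoeff, riccatiCoeff_eq, h1, h0, ← integral_neg]
  refine integral_congr_ae (Eventually.of_forall fun x => ?_)
  simp only
  ring

/-- `1 / ((τ + iξ₁)(τ + iη₁)(τ + iη₂))`. -/
def cubicKernel (τ : ℝ) (p : ℝ × ℝ × ℝ) : ℂ :=
  ((τ + Complex.I * p.1) * (τ + Complex.I * p.2.1) * (τ + Complex.I * p.2.2))⁻¹

/-- Conjugating first puts the factor R_{-τ}u in the conjugated slot ξ₁ and the two factors R_τ u in
the slots η₁, η₂. The minus sign arises because the conjugate of -τ + iξ₁ is -(τ + iξ₁). -/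
lemma conj_logCoeff_one {κ τ : ℝ} (u : 𝓢(ℝ, ℂ)) (hκ : |κ| = 1) (hτ : 1 ≤ τ) :
    conj (logCoeff κ u 1 τ) =
      -((1 / (2 * Real.pi) : ℝ) * ∫ p, cubicKernel τ p * quarticProd (fourierU u) p) := by
  have hτa : 1 ≤ |τ| := hτ.trans (le_abs_self τ)
  have hτa' : 1 ≤ |-τ| := by rwa [abs_neg]
  have hτ0 : τ ≠ 0 := by linarith
  have hu := integrable_fourierU u
  have hinv : invFourierU (fourierU u) = u := funext (invFourierU_fourierU u)
  have hR : ∀ σ : ℝ, σ ≠ 0 → ∀ x, resolvent σ u x =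
      invFourierU (fun η => fourierU u η / (σ + Complex.I * η)) x := by
    intro σ hσ x
    rw [← resolvent_invFourierU hu hσ, hinv]
  rw [logCoeff_one_eq (schwartz_c1Decay u) hκ hτa, ← integral_conj]
  have h1 : ∀ x, conj (resolvent (-τ) u x * (u x * conj (resolvent τ u x) ^ 2)) =
      conj (invFourierU (fun η => fourierU u η / ((-τ : ℝ) + Complex.I * η)) x) *
        (invFourierU (fun η => fourierU u η / (τ + Complex.I * η)) x *
          invFourierU (fun η => fourierU u η / (τ + Complex.I * η)) x * conj (u x)) := by
    intro x
    rw [← hR _ (neg_ne_zero.2 hτ0), ← hR _ hτ0]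
    simp only [map_mul, map_pow, Complex.conj_conj]
    ring
  simp_rw [h1]
  rw [integral_conj_invFourierU_mul (integrable_div_add hu hτa) (integrable_div_add hu hτa)
    (integrable_div_add hu hτa') u.integrable, ← mul_neg, ← integral_neg]
  congr 1
  refine integral_congr_ae (Eventually.of_forall fun p => ?_)
  simp only [cubicKernel, quarticProd]
  have e1 := one_add_I_mul_ne_zero hτ0 p.1
  have e2 := one_add_I_mul_ne_zero hτ0 p.2.1
  have e3 := one_add_I_mul_ne_zero hτ0 p.2.2
  have e4 : -(τ : ℂ) - Complex.I * p.1 ≠ 0 := by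
    rw [← neg_add']; exact neg_ne_zero.2 e1
  rw [map_div₀, map_add, map_mul, Complex.conj_I, Complex.conj_ofReal, Complex.conj_ofReal,
    Complex.ofReal_neg, neg_mul, ← sub_eq_add_neg, ← neg_add', map_mul]
  field_simp

/-- The symmetrization of `cubicKernel` in `ξ₁` and `ξ₂`. -/
def symmKernel (τ : ℝ) (p : ℝ × ℝ × ℝ) : ℂ := cubicKernel τ p + cubicKernel τ (swapXi p)

/-- Over the product of all four factors the numerator is 2τ + i(ξ₁ + ξ₂), which the momentum
constraint makes symmetric in the pairs. -/
lemma symmKernel_swapPairs {τ : ℝ} (hτ : τ ≠ 0) (p : ℝ × ℝ × ℝ) :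
    symmKernel τ (swapPairs p) = symmKernel τ p := by
  have e1 := one_add_I_mul_ne_zero hτ p.1
  have e2 := one_add_I_mul_ne_zero hτ p.2.1
  have e3 := one_add_I_mul_ne_zero hτ p.2.2
  have e4 := one_add_I_mul_ne_zero hτ (p.2.1 + p.2.2 - p.1)
  simp only [symmKernel, cubicKernel, swapXi_apply, swapPairs_apply]
  rw [show p.1 + (p.2.1 + p.2.2 - p.1) - p.2.1 = p.2.2 by ring]
  generalize hξ : p.2.1 + p.2.2 - p.1 = ξ₂ at *
  have hp : ((p.2.1 : ℝ) : ℂ) + (p.2.2 : ℝ) = (p.1 : ℝ) + (ξ₂ : ℝ) := by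
    rw [← hξ]; push_cast; ring
  field_simp
  linear_combination Complex.I * hp

/-- Put a, b = τ + iξ₁, τ + iξ₂ and c, d = τ + iη₁, τ + iη₂. As a + b = c + d, one has 1/a + 1/b -
1/c - 1/d = (a + b)(cd - ab)/(abcd), and cd - ab = ξ₁ξ₂ - η₁η₂ = -(ξ₁-η₁)(ξ₁-η₂). Finally Re 1/(τ +
ix) = τ/(τ² + x²). -/
lemma re_symmKernel {τ : ℝ} (hτ : τ ≠ 0) {p : ℝ × ℝ × ℝ} (hp : resonance p ≠ 0) :
    (symmKernel τ p).re = -diffQuot (fun x => τ * (τ ^ 2 + x ^ 2)⁻¹) p := by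
  have e1 := one_add_I_mul_ne_zero hτ p.1
  have e2 := one_add_I_mul_ne_zero hτ p.2.1
  have e3 := one_add_I_mul_ne_zero hτ p.2.2
  have e4 := one_add_I_mul_ne_zero hτ (p.2.1 + p.2.2 - p.1)
  have hre : ∀ x : ℝ, τ * (τ ^ 2 + x ^ 2)⁻¹ = (((τ : ℂ) + Complex.I * x)⁻¹).re := by
    intro x
    rw [Complex.inv_re]
    simp [Complex.normSq_apply, div_eq_mul_inv, sq]
  have key : symmKernel τ p * (resonance p : ℝ) = -(((τ : ℂ) + Complex.I * p.1)⁻¹ +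
      ((τ : ℂ) + Complex.I * (p.2.1 + p.2.2 - p.1 : ℝ))⁻¹ - ((τ : ℂ) + Complex.I * p.2.1)⁻¹ -
      ((τ : ℂ) + Complex.I * p.2.2)⁻¹) := by
    simp only [symmKernel, cubicKernel, swapXi_apply, resonance]
    generalize hξ : p.2.1 + p.2.2 - p.1 = ξ₂ at *
    have hp : (ξ₂ : ℂ) = p.2.1 + p.2.2 - p.1 := by rw [← hξ]; push_cast; ring
    push_cast
    field_simp
    rw [hp]
    ring_nf
    simp only [Complex.I_sq, show Complex.I ^ 3 = -Complex.I from by rw [pow_succ, Complex.I_sq]; ring]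
    ring
  rw [diffQuot, ← neg_div, eq_div_iff hp, ← Complex.re_mul_ofReal, key, secondDiff, hre, hre, hre,
    hre]
  simp

lemma norm_cubicKernel_le {τ : ℝ} (hτ : 1 ≤ τ) (p : ℝ × ℝ × ℝ) : ‖cubicKernel τ p‖ ≤ 1 := by
  have h : ∀ x : ℝ, 1 ≤ ‖(τ : ℂ) + Complex.I * x‖ := fun x => by
    have := Complex.abs_re_le_norm ((τ : ℂ) + Complex.I * x)
    simp only [Complex.add_re, Complex.ofReal_re, Complex.mul_re, Complex.I_re, zero_mul,
      Complex.I_im, Complex.ofReal_im, mul_zero, sub_self, add_zero] at this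
    exact hτ.trans ((le_abs_self τ).trans this)
  rw [cubicKernel, norm_inv, norm_mul, norm_mul]
  exact inv_le_one_of_one_le₀ (one_le_mul_of_one_le_of_one_le
    (one_le_mul_of_one_le_of_one_le (h _) (h _)) (h _))

lemma measurable_cubicKernel (τ : ℝ) : Measurable (cubicKernel τ) := by
  unfold cubicKernel
  fun_prop

lemma integrable_cubicKernel (u : 𝓢(ℝ, ℂ)) {τ : ℝ} (hτ : 1 ≤ τ) :
    Integrable fun p => cubicKernel τ p * quarticProd (fourierU u) p :=
  integrable_mul_quarticProd u (c := 1) (m := 0) (measurable_cubicKernel τ).aestronglyMeasurable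
    fun p => by simpa using norm_cubicKernel_le hτ p

lemma measurable_symmKernel (τ : ℝ) : Measurable (symmKernel τ) :=
  (measurable_cubicKernel τ).add
    ((measurable_cubicKernel τ).comp swapXi.continuous_of_finiteDimensional.measurable)

lemma integrable_symmKernel (u : 𝓢(ℝ, ℂ)) {τ : ℝ} (hτ : 1 ≤ τ) :
    Integrable fun p => symmKernel τ p * quarticProd (fourierU u) p :=
  integrable_mul_quarticProd u (c := 2) (m := 0)
    (measurable_symmKernel τ).aestronglyMeasurable
    fun p => by
      rw [pow_zero, mul_one]
      exact (norm_add_le _ _).trans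
        (by linarith [norm_cubicKernel_le hτ p, norm_cubicKernel_le hτ (swapXi p)])

lemma two_mul_integral_cubicKernel (u : 𝓢(ℝ, ℂ)) {τ : ℝ} (hτ : 1 ≤ τ) :
    2 * ∫ p, cubicKernel τ p * quarticProd (fourierU u) p =
      ∫ p, symmKernel τ p * quarticProd (fourierU u) p := by
  have h1 := integrable_cubicKernel u hτ
  have h2 : Integrable fun p => symmKernel τ p * quarticProd (fourierU u) p -
    cubicKernel τ p * quarticProd (fourierU u) p := (integrable_symmKernel u hτ).sub h1
  have h3 : ∫ p, cubicKernel τ p * quarticProd (fourierU u) p =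
      ∫ p, (symmKernel τ p * quarticProd (fourierU u) p -
        cubicKernel τ p * quarticProd (fourierU u) p) := by
    conv_lhs => rw [← integral_swapXi]
    refine integral_congr_ae (Eventually.of_forall fun p => ?_)
    simp only [quarticProd_swapXi, symmKernel]
    ring
  rw [integral_sub (integrable_symmKernel u hτ) h1] at h3
  linear_combination h3

/-- Invariance of the kernel under the exchange of pairs lets the density be averaged with its
conjugate. Only the real part of the density survives, so taking real parts falls on the kernel
alone. -/
lemma re_integral_symmKernel (u : 𝓢(ℝ, ℂ)) {τ : ℝ} (hτ : 1 ≤ τ) :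
    (∫ p, symmKernel τ p * quarticProd (fourierU u) p).re =
      -quarticEnergy u fun x => τ * (τ ^ 2 + x ^ 2)⁻¹ := by
  have hτ0 : τ ≠ 0 := by linarith
  have h1 := integrable_symmKernel u hτ
  have h2 : Integrable fun p => symmKernel τ p * conj (quarticProd (fourierU u) p) := by
    refine h1.norm.mono' ((measurable_symmKernel τ).aestronglyMeasurable.mul
      (Complex.continuous_conj.comp (continuous_quarticProd u)).aestronglyMeasurable)
      (Eventually.of_forall fun p => ?_)
    rw [norm_mul, norm_mul, RCLike.norm_conj]
  have h3 : ∫ p, symmKernel τ p * quarticProd (fourierU u) p =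
      ∫ p, symmKernel τ p * conj (quarticProd (fourierU u) p) := by
    conv_lhs => rw [← integral_swapPairs]
    refine integral_congr_ae (Eventually.of_forall fun p => ?_)
    simp only [quarticProd_swapPairs, symmKernel_swapPairs hτ0]
  have h4 : (2 : ℂ) * ∫ p, symmKernel τ p * quarticProd (fourierU u) p =
      ∫ p, 2 * (symmKernel τ p * ((quarticProd (fourierU u) p).re : ℂ)) := by
    rw [two_mul]
    nth_rewrite 2 [h3]
    rw [← integral_add h1 h2]
    refine integral_congr_ae (Eventually.of_forall fun p => ?_)
    simp only
    rw [← mul_add, Complex.add_conj]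
    push_cast
    ring
  rw [integral_const_mul] at h4
  have h6 : Integrable fun p => symmKernel τ p * ((quarticProd (fourierU u) p).re : ℂ) := by
    have := (h1.add h2).const_mul (1 / 2)
    refine this.congr (Eventually.of_forall fun p => ?_)
    simp only [Pi.add_apply]
    rw [← mul_add, Complex.add_conj]
    push_cast
    ring
  rw [mul_left_cancel₀ two_ne_zero h4]
  have h5 := integral_re h6
  simp only [RCLike.re_eq_complex_re, Complex.re_mul_ofReal] at h5
  rw [← h5, quarticEnergy, ← integral_neg]
  refine integral_congr_ae ?_
  filter_upwards [ae_resonance_ne_zero] with p hp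
  rw [re_symmKernel hτ0 hp, neg_mul]

lemma logTransmissionCoeff_one {κ τ : ℝ} (u : 𝓢(ℝ, ℂ)) (hκ : |κ| = 1) (hτ : 1 ≤ τ) :
    logTransmissionCoeff κ u 1 τ =
      κ / (4 * Real.pi) * quarticEnergy u fun x => τ * (τ ^ 2 + x ^ 2)⁻¹ := by
  have h1 := congrArg Complex.re (conj_logCoeff_one u hκ hτ)
  have h2 := congrArg Complex.re (two_mul_integral_cubicKernel u hτ)
  rw [re_integral_symmKernel u hτ, show (2 : ℂ) = ((2 : ℝ) : ℂ) by norm_num,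
    Complex.re_ofReal_mul] at h2
  rw [Complex.conj_re, Complex.neg_re, Complex.re_ofReal_mul] at h1
  rw [logTransmissionCoeff, h1]
  generalize (quarticEnergy u fun x => τ * (τ ^ 2 + x ^ 2)⁻¹) = E at *
  have : Real.pi ≠ 0 := Real.pi_ne_zero
  field_simp
  linear_combination (-2 : ℝ) * κ * h2

/-! ### The quartic part of the energy -/

lemma C2Bound.const_mul {f : ℝ → ℝ} {c : ℝ} {m : ℕ} (hf : C2Bound f c m) (a : ℝ) :
    C2Bound (fun x => a * f x) (|a| * c) m := by
  obtain ⟨f', f'', h⟩ := hf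
  refine ⟨fun x => a * f' x, fun x => a * f'' x, fun x => ?_⟩
  obtain ⟨h1, h2, h3, h4, h5⟩ := h x
  refine ⟨h1.const_mul a, h2.const_mul a, ?_, ?_, ?_⟩ <;> rw [abs_mul, mul_assoc] <;>
    gcongr

lemma C2Bound.integrable_diffQuot_re {f : ℝ → ℝ} {c : ℝ} {m : ℕ} (hf : C2Bound f c m)
    (u : 𝓢(ℝ, ℂ)) : Integrable fun p => diffQuot f p * (quarticProd (fourierU u) p).re := by
  simpa only [RCLike.re_eq_complex_re, Complex.re_ofReal_mul] using (hf.integrable_diffQuot u).re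

lemma C2Bound.abs_quarticEnergy_le {f : ℝ → ℝ} {c : ℝ} {m : ℕ} (hf : C2Bound f c m)
    (u : 𝓢(ℝ, ℂ)) : |quarticEnergy u f| ≤
      c * ∫ p, momentumSize p ^ m * ‖quarticProd (fourierU u) p‖ := by
  rw [quarticEnergy, ← Real.norm_eq_abs, ← integral_const_mul]
  refine norm_integral_le_of_norm_le ((integrable_momentumSize_pow_mul u m).const_mul c)
    (Eventually.of_forall fun p => ?_)
  rw [norm_mul, ← mul_assoc]
  exact mul_le_mul (hf.abs_diffQuot_le p) (Complex.abs_re_le_norm _) (norm_nonneg _)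
    ((abs_nonneg _).trans (hf.abs_diffQuot_le p))

/-- The remainder in the expansion of `τ / (τ² + x²)` in powers of `τ⁻¹`, with opposite sign. -/
def evenRemainder (M : ℕ) (τ x : ℝ) : ℝ := τ * geomRemainder M (τ ^ 2 - 1) (x ^ 2)

lemma evenRemainder_eq_sum (M : ℕ) {τ : ℝ} (hτ : 1 ≤ τ) (x : ℝ) :
    evenRemainder M τ x = -(τ * (τ ^ 2 + x ^ 2)⁻¹) +
      ∑ j ∈ Finset.range M, (-1) ^ j / τ ^ (2 * j + 1) * (x ^ 2) ^ j := by
  have hτ0 : τ ≠ 0 := by linarith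
  rw [evenRemainder, geomRemainder, add_sub_cancel, mul_add, Finset.mul_sum]
  congr 1
  · ring
  · refine Finset.sum_congr rfl fun j _ => ?_
    rw [neg_pow, ← pow_mul τ 2 (j + 1), show 2 * (j + 1) = 2 * j + 1 + 1 by ring, pow_succ τ]
    field_simp

lemma evenRemainder_eq (M : ℕ) {τ : ℝ} (hτ : 1 ≤ τ) (x : ℝ) :
    evenRemainder M τ x =
      -(-1) ^ M * τ / τ ^ (2 * M) * ((x ^ 2) ^ M * (τ ^ 2 + x ^ 2)⁻¹) := by
  rw [evenRemainder, geomRemainder_eq (by nlinarith) (sq_nonneg x), add_sub_cancel, neg_pow,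
    ← pow_mul τ 2 M]
  have : τ ^ 2 + x ^ 2 ≠ 0 := by nlinarith [sq_nonneg x]
  have hτ0 : τ ≠ 0 := by linarith
  field_simp

/-- The closed form is a multiple of τ^{1-2M} x^{2M}/(τ² + x²), so the product rule for the bounds
gives 4 · 8^M · 6 and the power τ^{-2M-1}. With M = ⌊s + 1⌋ this is integrable against (τ² - 1)^s.
-/
lemma c2Bound_evenRemainder (M : ℕ) {τ : ℝ} (hτ : 1 ≤ τ) :
    C2Bound (evenRemainder M τ) (24 * 8 ^ M / τ ^ (2 * M + 1)) (2 * M) := by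
  have h := ((C2Bound.sq_pow M).mul (C2Bound.inv_sq_add_sq hτ)).const_mul
    (-(-1) ^ M * τ / τ ^ (2 * M))
  have hτ0 : 0 < τ := by linarith
  rw [← funext (evenRemainder_eq M hτ), abs_div, abs_mul, abs_neg, abs_pow, abs_neg, abs_one,
    one_pow, one_mul, abs_of_pos hτ0, abs_of_pos (pow_pos hτ0 _), add_zero] at h
  convert h using 1
  rw [pow_succ]
  field_simp
  ring

lemma diffQuot_evenRemainder (M : ℕ) {τ : ℝ} (hτ : 1 ≤ τ) (p : ℝ × ℝ × ℝ) :
    diffQuot (evenRemainder M τ) p = -diffQuot (fun x => τ * (τ ^ 2 + x ^ 2)⁻¹) p +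
      ∑ j ∈ Finset.range M, (-1) ^ j / τ ^ (2 * j + 1) * diffQuot (fun x => (x ^ 2) ^ j) p := by
  simp only [diffQuot, secondDiff, evenRemainder_eq_sum M hτ]
  simp only [mul_div_assoc', ← Finset.sum_div, mul_sub, mul_add, Finset.sum_add_distrib,
    Finset.sum_sub_distrib]
  ring

lemma quarticEnergy_evenRemainder (u : 𝓢(ℝ, ℂ)) (M : ℕ) {τ : ℝ} (hτ : 1 ≤ τ) :
    quarticEnergy u (evenRemainder M τ) = -quarticEnergy u (fun x => τ * (τ ^ 2 + x ^ 2)⁻¹) +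
      ∑ j ∈ Finset.range M, (-1) ^ j / τ ^ (2 * j + 1) *
        quarticEnergy u (fun x => (x ^ 2) ^ j) := by
  have h1 := ((C2Bound.inv_sq_add_sq hτ).const_mul τ).integrable_diffQuot_re u
  have h2 := fun j => (C2Bound.sq_pow j).integrable_diffQuot_re u
  have h3 : ∀ j ∈ Finset.range M, Integrable fun p => (-1) ^ j / τ ^ (2 * j + 1) *
      (diffQuot (fun x => (x ^ 2) ^ j) p * (quarticProd (fourierU u) p).re) :=
    fun j _ => (h2 j).const_mul _
  have h4 : Integrable fun p => -(diffQuot (fun x => τ * (τ ^ 2 + x ^ 2)⁻¹) p *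
      (quarticProd (fourierU u) p).re) := h1.neg
  simp only [quarticEnergy, ← integral_const_mul]
  rw [← integral_neg, ← integral_finsetSum _ h3, ← integral_add h4 (integrable_finsetSum _ h3)]
  refine integral_congr_ae (Eventually.of_forall fun p => ?_)
  simp only [diffQuot_evenRemainder M hτ, add_mul, Finset.sum_mul, neg_mul, mul_assoc]

lemma logTransmissionCoeff_one_sub {κ τ : ℝ} (u : 𝓢(ℝ, ℂ)) (hκ : |κ| = 1) (M : ℕ) (hτ : 1 ≤ τ) :
    -logTransmissionCoeff κ u 1 τ + ∑ j ∈ Finset.range M,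
      (-1) ^ j * (κ / (4 * Real.pi) * quarticEnergy u (fun x => (x ^ 2) ^ j)) / τ ^ (2 * j + 1) =
      κ / (4 * Real.pi) * quarticEnergy u (evenRemainder M τ) := by
  rw [logTransmissionCoeff_one u hκ hτ, quarticEnergy_evenRemainder u M hτ, mul_add,
    Finset.mul_sum, mul_neg]
  congr 1
  exact Finset.sum_congr rfl fun j _ => by ring

/-- Makes the coefficients of the quartic term explicit: they are the quartic forms built from
ξ^{2j}, so subtracting them amounts to replacing τ/(τ² + ξ²) by its Taylor remainder inside the
form. -/
lemma hasOddExpansion_logTransmissionCoeff_one {κ : ℝ} (u : 𝓢(ℝ, ℂ)) (hκ : |κ| = 1) (M : ℕ) :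
    HasOddExpansion M (logTransmissionCoeff κ u 1)
      fun j => κ / (4 * Real.pi) * quarticEnergy u (fun x => (x ^ 2) ^ j) := by
  refine ⟨|κ / (4 * Real.pi)| * (24 * 8 ^ M *
    ∫ p, momentumSize p ^ (2 * M) * ‖quarticProd (fourierU u) p‖), fun τ hτ => ?_⟩
  rw [← abs_neg, neg_sub', sub_neg_eq_add, logTransmissionCoeff_one_sub u hκ M hτ, abs_mul,
    mul_div_assoc]
  refine mul_le_mul_of_nonneg_left ?_ (abs_nonneg _)
  refine ((c2Bound_evenRemainder M hτ).abs_quarticEnergy_le u).trans (le_of_eq ?_)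
  ring

lemma sin_mul_integral_evenRemainder {s : ℝ} (hs : -1 < s) (x : ℝ) :
    2 * Real.sin (Real.pi * s) / Real.pi *
        (∫ τ in Set.Ioi (1 : ℝ), (τ ^ 2 - 1) ^ s * evenRemainder ⌊s + 1⌋₊ τ x) =
      (1 + x ^ 2) ^ s - ∑ j ∈ Finset.range ⌊s + 1⌋₊, Ring.choose s j * (x ^ 2) ^ j := by
  rw [eq_sub_iff_add_eq, ← sin_mul_integral_geomRemainder hs (sq_nonneg x), integral_sq_sub_one]
  congr 1
  rw [mul_comm 2, mul_div_right_comm, mul_assoc, ← integral_const_mul]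
  congr 2
  funext τ
  rw [evenRemainder]
  ring

lemma integrableOn_evenRemainder {s : ℝ} (hs : -1 < s) (x : ℝ) :
    IntegrableOn (fun τ => (τ ^ 2 - 1) ^ s * evenRemainder ⌊s + 1⌋₊ τ x) (Set.Ioi 1) := by
  have h := (integrableOn_sq_sub_one (integrableOn_rpow_mul_geomRemainder hs
    (by have := Nat.lt_floor_add_one (s + 1); linarith) (sq_nonneg x))).const_mul (1 / 2)
  refine IntegrableOn.congr_fun h (fun τ _ => ?_) measurableSet_Ioi
  simp only [evenRemainder]
  ring

lemma integral_diffQuot_evenRemainder {s : ℝ} (hs : -1 < s) (p : ℝ × ℝ × ℝ) :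
    2 * Real.sin (Real.pi * s) / Real.pi *
        (∫ τ in Set.Ioi (1 : ℝ), (τ ^ 2 - 1) ^ s * diffQuot (evenRemainder ⌊s + 1⌋₊ τ) p) =
      diffQuot (fun x => (1 + x ^ 2) ^ s) p -
        ∑ j ∈ Finset.range ⌊s + 1⌋₊, Ring.choose s j * diffQuot (fun x => (x ^ 2) ^ j) p := by
  have hI := fun x => integrableOn_evenRemainder hs x
  have h1 : ∫ τ in Set.Ioi (1 : ℝ), (τ ^ 2 - 1) ^ s * diffQuot (evenRemainder ⌊s + 1⌋₊ τ) p =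
      diffQuot (fun x => ∫ τ in Set.Ioi (1 : ℝ), (τ ^ 2 - 1) ^ s * evenRemainder ⌊s + 1⌋₊ τ x) p := by
    have h2 : ∀ (f g : ℝ → ℝ), IntegrableOn f (Set.Ioi 1) → IntegrableOn g (Set.Ioi 1) →
        IntegrableOn (fun τ => f τ + g τ) (Set.Ioi 1) := fun f g hf hg => hf.add hg
    have h3 : ∀ (f g : ℝ → ℝ), IntegrableOn f (Set.Ioi 1) → IntegrableOn g (Set.Ioi 1) →
        IntegrableOn (fun τ => f τ - g τ) (Set.Ioi 1) := fun f g hf hg => hf.sub hg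
    simp only [diffQuot, secondDiff, mul_div_assoc', mul_sub, mul_add]
    rw [integral_div, integral_sub (h3 _ _ (h2 _ _ (hI _) (hI _)) (hI _)) (hI _),
      integral_sub (h2 _ _ (hI _) (hI _)) (hI _), integral_add (hI _) (hI _)]
  rw [h1]
  have h3 : ∀ (a : ℝ) (f : ℝ → ℝ), a * diffQuot f p = diffQuot (fun x => a * f x) p := by
    intro a f
    simp only [diffQuot, secondDiff]
    ring
  rw [h3]
  simp only [sin_mul_integral_evenRemainder hs]
  simp only [diffQuot, secondDiff, mul_div_assoc', ← Finset.sum_div, mul_sub, mul_add,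
    Finset.sum_add_distrib, Finset.sum_sub_distrib]
  ring

lemma measurable_diffQuot_evenRemainder (M : ℕ) :
    Measurable fun q : ℝ × (ℝ × ℝ × ℝ) => diffQuot (evenRemainder M q.1) q.2 := by
  simp only [diffQuot, secondDiff, evenRemainder, geomRemainder, resonance]
  fun_prop

/-- Fubini moves the τ-integral inside the quartic form, where the one-variable formula applies
pointwise in the momenta. The double integral converges because the bound on the symbol factors into
a weight in τ and a power of the momenta. -/
lemma integral_quarticEnergy_evenRemainder {s : ℝ} (hs : -1 < s) (u : 𝓢(ℝ, ℂ)) :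
    2 * Real.sin (Real.pi * s) / Real.pi * (∫ τ in Set.Ioi (1 : ℝ), (τ ^ 2 - 1) ^ s *
        quarticEnergy u (evenRemainder ⌊s + 1⌋₊ τ)) =
      quarticEnergy u (fun x => (1 + x ^ 2) ^ s) -
        ∑ j ∈ Finset.range ⌊s + 1⌋₊, Ring.choose s j * quarticEnergy u (fun x => (x ^ 2) ^ j) := by
  have hsM : s < (⌊s + 1⌋₊ : ℝ) := by have := Nat.lt_floor_add_one (s + 1); linarith
  obtain ⟨c, m, hc⟩ := C2Bound.one_add_sq_rpow s
  have h1 := hc.integrable_diffQuot_re u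
  have h2 := fun j => (C2Bound.sq_pow j).integrable_diffQuot_re u
  have h3 : ∀ j ∈ Finset.range ⌊s + 1⌋₊, Integrable fun p => Ring.choose s j *
      (diffQuot (fun x => (x ^ 2) ^ j) p * (quarticProd (fourierU u) p).re) :=
    fun j _ => (h2 j).const_mul _
  set M := ⌊s + 1⌋₊ with hM
  have hQ : Measurable fun p => (quarticProd (fourierU u) p).re :=
    Complex.measurable_re.comp (continuous_quarticProd u).measurable
  have hint : Integrable (Function.uncurry fun (τ : ℝ) (p : ℝ × ℝ × ℝ) => (τ ^ 2 - 1) ^ s *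
      (diffQuot (evenRemainder M τ) p * (quarticProd (fourierU u) p).re))
      ((volume.restrict (Set.Ioi 1)).prod volume) := by
    have hw : Integrable (fun τ : ℝ => (τ ^ 2 - 1) ^ s / τ ^ (2 * M + 1))
      (volume.restrict (Set.Ioi 1)) := integrableOn_energy_weight hs hsM
    refine ((hw.mul_prod (integrable_momentumSize_pow_mul u (2 * M))).const_mul (24 * 8 ^ M)).mono'
      ?_ ?_
    · have hr : Measurable fun τ : ℝ => (τ ^ 2 - 1) ^ s := Measurable.pow_const (by fun_prop) _
      exact ((hr.comp measurable_fst).mul ((measurable_diffQuot_evenRemainder M).mul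
        (hQ.comp measurable_snd))).aestronglyMeasurable
    · filter_upwards [Measure.quasiMeasurePreserving_fst.ae (ae_restrict_mem measurableSet_Ioi)]
        with q hq
      have hq : 1 < q.1 := hq
      have hq0 : 0 < q.1 := by linarith
      have hw0 : 0 ≤ (q.1 ^ 2 - 1) ^ s := Real.rpow_nonneg (by nlinarith) _
      have hb := (c2Bound_evenRemainder M hq.le).abs_diffQuot_le q.2
      rw [Function.uncurry, norm_mul, norm_mul, Real.norm_of_nonneg hw0]
      calc (q.1 ^ 2 - 1) ^ s * (‖diffQuot (evenRemainder M q.1) q.2‖ *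
            ‖(quarticProd (fourierU u) q.2).re‖)
          ≤ (q.1 ^ 2 - 1) ^ s * ((24 * 8 ^ M / q.1 ^ (2 * M + 1) * momentumSize q.2 ^ (2 * M)) *
            ‖quarticProd (fourierU u) q.2‖) := by
            refine mul_le_mul_of_nonneg_left (mul_le_mul hb (Complex.abs_re_le_norm _)
              (norm_nonneg _) ((abs_nonneg _).trans hb)) hw0
        _ = _ := by ring
  simp only [quarticEnergy]
  have h4 : ∫ τ in Set.Ioi (1 : ℝ), (τ ^ 2 - 1) ^ s *
      ∫ p, diffQuot (evenRemainder M τ) p * (quarticProd (fourierU u) p).re =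
      ∫ τ in Set.Ioi (1 : ℝ), ∫ p, (τ ^ 2 - 1) ^ s *
        (diffQuot (evenRemainder M τ) p * (quarticProd (fourierU u) p).re) := by
    simp only [integral_const_mul]
  rw [h4, integral_integral_swap hint, ← integral_const_mul]
  simp only [← integral_const_mul (Ring.choose s _)]
  rw [← integral_finsetSum _ h3, ← integral_sub h1 (integrable_finsetSum _ h3)]
  refine integral_congr_ae (Eventually.of_forall fun p => ?_)
  simp only
  simp_rw [← mul_assoc]
  rw [integral_mul_const, ← mul_assoc, integral_diffQuot_evenRemainder hs, sub_mul, Finset.sum_mul]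

lemma energyFunctional_logTransmissionCoeff_one {s κ : ℝ} (hs : -1 < s) (hκ : |κ| = 1)
    (u : 𝓢(ℝ, ℂ)) :
    energyFunctional s (logTransmissionCoeff κ u 1) =
      κ / (4 * Real.pi) * quarticEnergy u (fun x => (1 + x ^ 2) ^ s) := by
  rw [energyFunctional_eq (hasOddExpansion_logTransmissionCoeff_one u hκ _)]
  have h1 : ∫ τ in Set.Ioi (1 : ℝ), (τ ^ 2 - 1) ^ s * (-logTransmissionCoeff κ u 1 τ +
      ∑ j ∈ Finset.range ⌊s + 1⌋₊, (-1) ^ j *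
        (κ / (4 * Real.pi) * quarticEnergy u (fun x => (x ^ 2) ^ j)) / τ ^ (2 * j + 1)) =
      κ / (4 * Real.pi) * ∫ τ in Set.Ioi (1 : ℝ), (τ ^ 2 - 1) ^ s *
        quarticEnergy u (evenRemainder ⌊s + 1⌋₊ τ) := by
    rw [← integral_const_mul]
    refine setIntegral_congr_fun measurableSet_Ioi fun τ hτ => ?_
    rw [logTransmissionCoeff_one_sub u hκ _ (le_of_lt hτ)]
    ring
  rw [h1, mul_left_comm, integral_quarticEnergy_evenRemainder hs, mul_sub, Finset.mul_sum]
  rw [sub_add_eq_add_sub, sub_eq_iff_eq_add]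
  congr 1
  exact Finset.sum_congr rfl fun j _ => by ring

/-! ### The `I`-method correction -/

lemma quarticProd_phase (g : ℝ → ℂ) (t : ℝ) (p : ℝ × ℝ × ℝ) :
    quarticProd (fun ξ => Complex.exp (-(Complex.I * t * (ξ : ℂ) ^ 2)) * g ξ) p =
      Complex.exp (Complex.I * t * secondDiff (fun x => x ^ 2) p) * quarticProd g p := by
  have hc : ∀ ξ : ℝ, conj (Complex.exp (-(Complex.I * t * (ξ : ℂ) ^ 2))) =
      Complex.exp (Complex.I * t * (ξ : ℂ) ^ 2) := by
    intro ξ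
    rw [← Complex.exp_conj]
    simp
  have he : Complex.exp (Complex.I * t * secondDiff (fun x => x ^ 2) p) =
      Complex.exp (Complex.I * t * (p.1 : ℂ) ^ 2) *
      Complex.exp (Complex.I * t * ((p.2.1 + p.2.2 - p.1 : ℝ) : ℂ) ^ 2) *
      Complex.exp (-(Complex.I * t * (p.2.1 : ℂ) ^ 2)) *
      Complex.exp (-(Complex.I * t * (p.2.2 : ℂ) ^ 2)) := by
    rw [← Complex.exp_add, ← Complex.exp_add, ← Complex.exp_add]
    congr 1
    simp only [secondDiff]
    push_cast
    ring
  simp only [quarticProd, map_mul, hc, he]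
  ring

lemma hasDerivAt_integral_phase {φ : ℝ × ℝ × ℝ → ℂ} {θ : ℝ × ℝ × ℝ → ℝ} (hφ : Integrable φ)
    (hθ : Measurable θ) (hθφ : Integrable fun p => (θ p : ℂ) * φ p) :
    HasDerivAt (fun t : ℝ => ∫ p, Complex.exp (Complex.I * t * θ p) * φ p)
      (Complex.I * ∫ p, (θ p : ℂ) * φ p) 0 := by
  have hm : ∀ t : ℝ, AEStronglyMeasurable fun p => Complex.exp (Complex.I * t * θ p) * φ p :=
    fun t => AEStronglyMeasurable.mul (Measurable.aestronglyMeasurable (by fun_prop))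
      hφ.aestronglyMeasurable
  have h := hasDerivAt_integral_of_dominated_loc_of_deriv_le (μ := volume) (x₀ := (0 : ℝ))
    (s := Set.univ) (bound := fun p => ‖(θ p : ℂ) * φ p‖)
    (F := fun (t : ℝ) p => Complex.exp (Complex.I * t * θ p) * φ p)
    (F' := fun (t : ℝ) p => Complex.exp (Complex.I * t * θ p) * (Complex.I * ((θ p : ℂ) * φ p)))
    Filter.univ_mem (Eventually.of_forall hm) (by simpa using hφ)
    (AEStronglyMeasurable.mul (Measurable.aestronglyMeasurable (by fun_prop))
      (hθφ.const_mul _).aestronglyMeasurable)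
    (Eventually.of_forall fun p t _ => by
      rw [norm_mul, norm_exp_I_mul, one_mul, norm_mul, Complex.norm_I, one_mul])
    hθφ.norm (Eventually.of_forall fun p t _ => by
      have h1 : HasDerivAt (fun t : ℝ => Complex.I * t * θ p) (Complex.I * θ p) t := by
        simpa using ((Complex.ofRealCLM.hasDerivAt (x := t)).const_mul Complex.I).mul_const (θ p : ℂ)
      refine (h1.cexp.mul_const (φ p)).congr_deriv ?_
      ring)
  have h2 := h.2
  simp only [Complex.ofReal_zero, mul_zero, zero_mul, Complex.exp_zero, one_mul] at h2
  rwa [integral_const_mul] at h2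

/-- The derivative of the phase brings down the second difference of ξ², which is twice the
denominator of the symbol; away from the null set of resonances the two cancel. -/
lemma hasDerivAt_quarticForm_phase (s a : ℝ) (u : 𝓢(ℝ, ℂ)) :
    HasDerivAt (fun t : ℝ => quarticForm (fun ξ₁ η₁ η₂ => a * quarticSymbol s ξ₁ η₁ η₂) fun ξ =>
      Complex.exp (-(Complex.I * t * (ξ : ℂ) ^ 2)) * fourierU u ξ)
      (2 * a * Complex.I *
        ∫ p, (secondDiff (fun x => (1 + x ^ 2) ^ s) p : ℂ) * quarticProd (fourierU u) p) 0 := by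
  obtain ⟨c, m, hc⟩ := C2Bound.one_add_sq_rpow s
  have hform : ∀ t : ℝ, (quarticForm (fun ξ₁ η₁ η₂ => a * quarticSymbol s ξ₁ η₁ η₂) fun ξ =>
      Complex.exp (-(Complex.I * t * (ξ : ℂ) ^ 2)) * fourierU u ξ) =
      a * ∫ p, Complex.exp (Complex.I * t * secondDiff (fun x => x ^ 2) p) *
        ((diffQuot (fun x => (1 + x ^ 2) ^ s) p : ℂ) * quarticProd (fourierU u) p) := by
    intro t
    rw [quarticForm, ← integral_const_mul]
    refine integral_congr_ae (Eventually.of_forall fun p => ?_)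
    change ((a * diffQuot (fun x => (1 + x ^ 2) ^ s) p : ℝ) : ℂ) * quarticProd (fun ξ =>
      Complex.exp (-(Complex.I * t * (ξ : ℂ) ^ 2)) * fourierU u ξ) p = _
    rw [quarticProd_phase, Complex.ofReal_mul]
    ring
  have heq : (fun p => ((secondDiff (fun x => x ^ 2) p : ℝ) : ℂ) *
      ((diffQuot (fun x => (1 + x ^ 2) ^ s) p : ℂ) * quarticProd (fourierU u) p)) =ᵐ[volume]
      fun p => 2 * ((secondDiff (fun x => (1 + x ^ 2) ^ s) p : ℂ) *
        quarticProd (fourierU u) p) := by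
    filter_upwards [ae_resonance_ne_zero] with p hp
    have hp' : (resonance p : ℂ) ≠ 0 := by exact_mod_cast hp
    rw [secondDiff_sq, diffQuot]
    push_cast
    field_simp
  have h := (hasDerivAt_integral_phase (hc.integrable_diffQuot u)
    (measurable_secondDiff (by fun_prop))
    (((hc.integrable_secondDiff u).const_mul 2).congr heq.symm)).const_mul (a : ℂ)
  rw [integral_congr_ae heq, integral_const_mul] at h
  simp_rw [hform]
  refine h.congr_deriv ?_
  ring

lemma C2Bound.integrable_apply {f : ℝ → ℝ} {c : ℝ} {m : ℕ} (hf : C2Bound f c m) (u : 𝓢(ℝ, ℂ))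
    {l : (ℝ × ℝ × ℝ) → ℝ} (hl : Measurable l) (hle : ∀ p, 1 + |l p| ≤ momentumSize p) :
    Integrable fun p => (f (l p) : ℂ) * quarticProd (fourierU u) p := by
  refine integrable_mul_quarticProd u (c := c) (m := m)
    (Complex.measurable_ofReal.comp (hf.continuous.measurable.comp hl)).aestronglyMeasurable
    fun p => ?_
  have hc := hf.nonneg
  obtain ⟨f', f'', h⟩ := hf
  rw [Complex.norm_real]
  exact (h (l p)).2.2.1.trans (mul_le_mul_of_nonneg_left
    (pow_le_pow_left₀ (by positivity) (hle p) _) hc)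

/-- With Z the integral weighted by f(ξ₁), the symmetries give Z for ξ₂ and the conjugate of Z for
η₁ and η₂, so the total is 2(Z - Z̄). -/
lemma integral_secondDiff_mul {f : ℝ → ℝ} {c : ℝ} {m : ℕ} (hf : C2Bound f c m) (u : 𝓢(ℝ, ℂ)) :
    ∫ p, (secondDiff f p : ℂ) * quarticProd (fourierU u) p =
      4 * Complex.I * ((∫ p, (f p.1 : ℂ) * quarticProd (fourierU u) p).im : ℂ) := by
  have hs : ∀ p : ℝ × ℝ × ℝ, 0 ≤ |p.1| ∧ 0 ≤ |p.2.1| ∧ 0 ≤ |p.2.2| := fun p =>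
    ⟨abs_nonneg _, abs_nonneg _, abs_nonneg _⟩
  have i1 := hf.integrable_apply u (l := fun p => p.1) (by fun_prop) fun p => by
    unfold momentumSize; linarith [hs p]
  have i2 := hf.integrable_apply u (l := fun p => p.2.1 + p.2.2 - p.1) (by fun_prop) fun p => by
    unfold momentumSize
    linarith [abs_sub (p.2.1 + p.2.2) p.1, abs_add_le p.2.1 p.2.2]
  have i3 := hf.integrable_apply u (l := fun p => p.2.1) (by fun_prop) fun p => by
    unfold momentumSize; linarith [hs p]
  have i4 := hf.integrable_apply u (l := fun p => p.2.2) (by fun_prop) fun p => by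
    unfold momentumSize; linarith [hs p]
  have e2 : ∫ p : ℝ × ℝ × ℝ, (f (p.2.1 + p.2.2 - p.1) : ℂ) * quarticProd (fourierU u) p =
      ∫ p : ℝ × ℝ × ℝ, (f p.1 : ℂ) * quarticProd (fourierU u) p := by
    rw [← integral_swapXi fun p : ℝ × ℝ × ℝ => (f p.1 : ℂ) * quarticProd (fourierU u) p]
    simp only [quarticProd_swapXi]
    rfl
  have e3 : ∫ p : ℝ × ℝ × ℝ, (f p.2.1 : ℂ) * quarticProd (fourierU u) p =
      conj (∫ p : ℝ × ℝ × ℝ, (f p.1 : ℂ) * quarticProd (fourierU u) p) := by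
    rw [← integral_conj, ← integral_swapPairs]
    simp only [quarticProd_swapPairs, map_mul, Complex.conj_ofReal]
    rfl
  have e4 : ∫ p : ℝ × ℝ × ℝ, (f p.2.2 : ℂ) * quarticProd (fourierU u) p =
      conj (∫ p : ℝ × ℝ × ℝ, (f p.1 : ℂ) * quarticProd (fourierU u) p) := by
    rw [← e2, ← integral_conj, ← integral_swapPairs]
    simp only [quarticProd_swapPairs, map_mul, Complex.conj_ofReal]
    rfl
  have hsplit : ∫ p, (secondDiff f p : ℂ) * quarticProd (fourierU u) p =
      (∫ p : ℝ × ℝ × ℝ, (f p.1 : ℂ) * quarticProd (fourierU u) p) +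
      (∫ p : ℝ × ℝ × ℝ, (f (p.2.1 + p.2.2 - p.1) : ℂ) * quarticProd (fourierU u) p) -
      ((∫ p : ℝ × ℝ × ℝ, (f p.2.1 : ℂ) * quarticProd (fourierU u) p) +
      ∫ p : ℝ × ℝ × ℝ, (f p.2.2 : ℂ) * quarticProd (fourierU u) p) := by
    rw [← integral_add i1 i2, ← integral_add i3 i4]
    refine Eq.trans ?_ (integral_sub (i1.add i2) (i3.add i4))
    refine integral_congr_ae (Eventually.of_forall fun p => ?_)
    simp only [secondDiff]
    push_cast
    ring
  rw [hsplit, e2, e3, e4]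
  generalize (∫ p : ℝ × ℝ × ℝ, (f p.1 : ℂ) * quarticProd (fourierU u) p) = Z
  have := Complex.sub_conj Z
  push_cast at this
  linear_combination 2 * this

lemma C2Bound.integrable_weight_mul {f : ℝ → ℝ} {c : ℝ} {m : ℕ} (hf : C2Bound f c m)
    (v : 𝓢(ℝ, ℂ)) : Integrable fun ξ => (f ξ : ℂ) * fourierU v ξ := by
  have h := schwartz_one_add_pow (fourierSchwartz v) m
  rw [coe_fourierSchwartz] at h
  refine (h.const_mul c).mono' (AEStronglyMeasurable.mul
    (Complex.continuous_ofReal.comp hf.continuous).aestronglyMeasurable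
    (continuous_fourierU_schwartz v).aestronglyMeasurable) (Eventually.of_forall fun ξ => ?_)
  obtain ⟨f', f'', hb⟩ := hf
  rw [norm_mul, Complex.norm_real, ← mul_assoc]
  exact mul_le_mul_of_nonneg_right (hb ξ).2.2.1 (norm_nonneg _)

lemma C2Bound.integrable_weight_pairing {f : ℝ → ℝ} {c : ℝ} {m : ℕ} (hf : C2Bound f c m)
    (v w : 𝓢(ℝ, ℂ)) : Integrable fun ξ => f ξ * (conj (fourierU v ξ) * fourierU w ξ).re := by
  have hc := continuous_fourierU_schwartz w
  have h := ((integrable_conj (hf.integrable_weight_mul v)).mul_bdd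
    (c := fourierConst * ∫ x, ‖w x‖) hc.aestronglyMeasurable
    (Eventually.of_forall (norm_fourierU_le w))).re
  refine h.congr (Eventually.of_forall fun ξ => ?_)
  simp only [RCLike.re_eq_complex_re, map_mul, Complex.conj_ofReal, mul_assoc,
    Complex.re_ofReal_mul]

lemma fourierU_add_smul (v w : 𝓢(ℝ, ℂ)) (t : ℝ) (ξ : ℝ) :
    fourierU (fun x => v x + t * w x) ξ = fourierU v ξ + t * fourierU w ξ := by
  have hi : ∀ v : 𝓢(ℝ, ℂ), Integrable fun x : ℝ => v x * Complex.exp (-(Complex.I * x * ξ)) :=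
    fun v => Integrable.mul_of_norm_le_one v.integrable
      (Continuous.aestronglyMeasurable (by fun_prop)) fun x => (norm_exp_neg_I_mul x ξ).le
  rw [fourierU_eq, fourierU_eq, fourierU_eq, mul_left_comm, ← mul_add,
    ← integral_const_mul (t : ℂ), ← integral_add (hi v) ((hi w).const_mul _)]
  congr 2
  funext x
  ring

/-- The energy is an exact quadratic polynomial in t, so no differentiation under the integral is
needed. -/
lemma hasDerivAt_sobolevEnergy (s : ℝ) (v w : 𝓢(ℝ, ℂ)) :
    HasDerivAt (fun t : ℝ => sobolevEnergy s fun x => v x + t * w x)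
      (2 * ∫ ξ, (1 + ξ ^ 2) ^ s * (conj (fourierU v ξ) * fourierU w ξ).re) 0 := by
  obtain ⟨c, m, hc⟩ := C2Bound.one_add_sq_rpow s
  have h1 := hc.integrable_weight_pairing v v
  have h2 := hc.integrable_weight_pairing v w
  have h3 := hc.integrable_weight_pairing w w
  have hE : ∀ t : ℝ, (sobolevEnergy s fun x => v x + t * w x) =
      (∫ ξ, (1 + ξ ^ 2) ^ s * (conj (fourierU v ξ) * fourierU v ξ).re) +
      t * (2 * ∫ ξ, (1 + ξ ^ 2) ^ s * (conj (fourierU v ξ) * fourierU w ξ).re) +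
      t ^ 2 * ∫ ξ, (1 + ξ ^ 2) ^ s * (conj (fourierU w ξ) * fourierU w ξ).re := by
    intro t
    rw [← mul_assoc, ← integral_const_mul (t * 2), ← integral_const_mul (t ^ 2),
      ← integral_add h1 (h2.const_mul _), sobolevEnergy]
    refine Eq.trans ?_ (integral_add (h1.add (h2.const_mul _)) (h3.const_mul _))
    refine integral_congr_ae (Eventually.of_forall fun ξ => ?_)
    simp only [fourierU_add_smul]
    rw [← Complex.normSq_eq_norm_sq]
    simp only [Complex.normSq_apply, Complex.add_re, Complex.add_im, Complex.mul_re,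
      Complex.mul_im, Complex.ofReal_re, Complex.ofReal_im, Complex.conj_re, Complex.conj_im]
    ring
  simp_rw [hE]
  have h4 := ((hasDerivAt_id (0 : ℝ)).mul_const
    (2 * ∫ ξ, (1 + ξ ^ 2) ^ s * (conj (fourierU v ξ) * fourierU w ξ).re)).const_add
    (∫ ξ, (1 + ξ ^ 2) ^ s * (conj (fourierU v ξ) * fourierU v ξ).re)
  have h5 := (hasDerivAt_pow 2 (0 : ℝ)).mul_const
    (∫ ξ, (1 + ξ ^ 2) ^ s * (conj (fourierU w ξ) * fourierU w ξ).re)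
  exact (h4.add h5).congr_deriv (by simp)

/-- The nonlinearity `-2iκ|u|²u`. -/
def cubicNonlinearity (κ : ℝ) (u : 𝓢(ℝ, ℂ)) : 𝓢(ℝ, ℂ) :=
  (-2 * Complex.I * (κ : ℂ)) • schwartzMul (schwartzMul u u) (schwartzConj u)

lemma cubicNonlinearity_apply (κ : ℝ) (u : 𝓢(ℝ, ℂ)) (x : ℝ) :
    cubicNonlinearity κ u x =
      -2 * Complex.I * (κ : ℂ) * ((‖u x‖ ^ 2 : ℝ) : ℂ) * u x := by
  rw [cubicNonlinearity, smul_apply, schwartzMul_apply, schwartzMul_apply, schwartzConj_apply,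
    smul_eq_mul, Complex.ofReal_pow, ← Complex.mul_conj']
  ring

/-- The quadrilinear Parseval identity turns the pairing into Re(-2iκ Z/(2π)) = (κ/π) Im Z, with the
same Z as in `integral_secondDiff_mul`. -/
lemma integral_weight_mul_cubicNonlinearity {f : ℝ → ℝ} {c : ℝ} {m : ℕ} (hf : C2Bound f c m)
    (κ : ℝ) (u : 𝓢(ℝ, ℂ)) :
    ∫ ξ, f ξ * (conj (fourierU u ξ) * fourierU (cubicNonlinearity κ u) ξ).re =
      κ / Real.pi * (∫ p, (f p.1 : ℂ) * quarticProd (fourierU u) p).im := by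
  have hu := integrable_fourierU u
  have hinv : ∀ x, invFourierU (fourierU u) x = u x := invFourierU_fourierU u
  have hN : ∀ ξ, fourierU (cubicNonlinearity κ u) ξ = (-2 * Complex.I * (κ : ℂ)) *
      fourierU (fun x => invFourierU (fourierU u) x * invFourierU (fourierU u) x *
        conj (u x)) ξ := by
    intro ξ
    rw [fourierU_eq, fourierU_eq, mul_left_comm, ← integral_const_mul (-2 * Complex.I * (κ : ℂ))]
    congr 2
    funext x
    rw [cubicNonlinearity_apply, hinv, Complex.ofReal_pow, ← Complex.mul_conj']
    ring
  have h1 := integral_conj_mul_fourierU_mul hu hu (hf.integrable_weight_mul u) u.integrable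
  have h2 : Integrable fun ξ => conj ((f ξ : ℂ) * fourierU u ξ) *
      fourierU (cubicNonlinearity κ u) ξ :=
    (integrable_conj (hf.integrable_weight_mul u)).mul_bdd
      (c := fourierConst * ∫ x, ‖cubicNonlinearity κ u x‖)
      (continuous_fourierU_schwartz _).aestronglyMeasurable
      (Eventually.of_forall (norm_fourierU_le _))
  have h3 : ∫ ξ, conj ((f ξ : ℂ) * fourierU u ξ) * fourierU (cubicNonlinearity κ u) ξ =
      (-2 * Complex.I * (κ : ℂ)) * ((1 / (2 * Real.pi) : ℝ) *
        ∫ p, (f p.1 : ℂ) * quarticProd (fourierU u) p) := by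
    simp only [hN, mul_left_comm _ (-2 * Complex.I * (κ : ℂ))]
    rw [integral_const_mul, h1]
    congr 3
    funext p
    simp only [quarticProd, map_mul, Complex.conj_ofReal]
    ring
  have h4 := integral_re h2
  rw [h3] at h4
  simp only [RCLike.re_eq_complex_re, map_mul, Complex.conj_ofReal, mul_assoc,
    Complex.re_ofReal_mul] at h4
  rw [h4]
  generalize (∫ p : ℝ × ℝ × ℝ, (f p.1 : ℂ) * quarticProd (fourierU u) p) = Z
  have : Real.pi ≠ 0 := Real.pi_ne_zero
  simp
  field_simp

theorem isIMethodSymbol_quarticSymbol (s κ : ℝ) :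
    IsIMethodSymbol s κ (fun ξ₁ η₁ η₂ => κ * (1 / (4 * Real.pi)) * quarticSymbol s ξ₁ η₁ η₂) := by
  intro u
  obtain ⟨c, m, hc⟩ := C2Bound.one_add_sq_rpow s
  have h1 := hasDerivAt_sobolevEnergy s u (cubicNonlinearity κ u)
  rw [integral_weight_mul_cubicNonlinearity hc κ u] at h1
  simp only [cubicNonlinearity_apply] at h1
  refine ⟨_, h1, (hasDerivAt_quarticForm_phase s (κ * (1 / (4 * Real.pi))) u).congr_deriv ?_⟩
  rw [integral_secondDiff_mul hc u]
  push_cast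
  -- The form contributes 2ai · 4i Im Z = -8a Im Z with a = κ/(4π), that is -(2κ/π) Im Z, opposite
  -- to twice the pairing (κ/π) Im Z.
  linear_combination (8 * (κ * (1 / (4 * (Real.pi : ℂ)))) *
    ((∫ p : ℝ × ℝ × ℝ, (((1 + p.1 ^ 2) ^ s : ℝ) : ℂ) * quarticProd (fourierU u) p).im : ℂ)) *
    Complex.I_sq

end NLSEnergy

end

theorem proposition8p2 (s : ℝ) (hs : -1 / 2 < s) (κ : ℝ) (hκ : κ = 1 ∨ κ = -1) :
    (∀ u : 𝓢(ℝ, ℂ),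
      AnalyticAt ℝ (fun ε : ℝ => NLSEnergy.energy s κ (ε • u)) 0 ∧
      Integrable (NLSEnergy.quarticIntegrand (NLSEnergy.quarticSymbol s)
        (NLSEnergy.fourierU u)) ∧
      ((NLSEnergy.homogeneousPart 4 (NLSEnergy.energy s κ) u : ℝ) : ℂ) =
        (κ : ℂ) * (1 / (4 * (Real.pi : ℂ))) *
          NLSEnergy.quarticForm (NLSEnergy.quarticSymbol s) (NLSEnergy.fourierU u)) ∧
    NLSEnergy.IsIMethodSymbol s κ
      (fun ξ₁ η₁ η₂ => κ * (1 / (4 * Real.pi)) * NLSEnergy.quarticSymbol s ξ₁ η₁ η₂) := by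
  have hs1 : -1 < s := by linarith
  have hκ1 : |κ| = 1 := by rcases hκ with rfl | rfl <;> simp
  refine ⟨fun u => ?_, NLSEnergy.isIMethodSymbol_quarticSymbol s κ⟩
  obtain ⟨δ, hδ, h⟩ := NLSEnergy.exists_hasSum_energy hs1 hκ1 u
  obtain ⟨c, m, hc⟩ := NLSEnergy.C2Bound.one_add_sq_rpow s
  have hint := hc.integrable_diffQuot u
  refine ⟨NLSEnergy.analyticAt_of_hasSum_even hδ h, hint, ?_⟩
  have h4 := NLSEnergy.iteratedDeriv_four_of_hasSum_even hδ h
  rw [NLSEnergy.energyFunctional_logTransmissionCoeff_one hs1 hκ1 u] at h4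
  have h5 : NLSEnergy.quarticForm (NLSEnergy.quarticSymbol s) (NLSEnergy.fourierU u) =
      (NLSEnergy.quarticEnergy u (fun x => (1 + x ^ 2) ^ s) : ℂ) :=
    NLSEnergy.integral_diffQuot_mul u _ hint
  rw [NLSEnergy.homogeneousPart, h4, h5]
  push_cast
  ring
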